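/- **Setting.** $\mathcal P=\{P_1,\dots,P_n\}$ are parties, $\mathbb F$ is a finite field, and $\mathcal Z=\{Z_1,\dots,Z_h\}$ is a non-empty set of subsets of $\mathcal P$ (the adversary structure; a set is called admissible if it is contained in some member of $\mathcal Z$). A computationally unbounded malicious static adversary corrupts a fixed admissible set $Z^\star$; the other parties are honest. Communication is asynchronous over pairwise secure channels: the adversary schedules all events, but every message between honest parties, every output of a functionality that an honest party requests, and every enabled step of an honest party is eventually scheduled. $\mathcal Z$ satisfies $\mathbb Q^{(4)}(\mathcal P,\mathcal Z)$: no four members of $\mathcal Z$ cover $\mathcal P$. Let $S_q=\mathcal P\setminus Z_q$, $\mathbb S=(S_1,\dots,S_h)$ and $t=\max\{|Z|:Z\in\mathcal Z\}$. A sharing $[s]$ of $s\in\mathbb F$ consists of $[s]_1,\dots,[s]_h\in\mathbb F$ with $\sum_q[s]_q=s$, where $[s]_q$ is known to every honest party of $S_q$. **Functionalities.** $\mathcal F_{VSS}$ receives a vector of $h$ shares from a dealer and delivers the $q$-th share to the parties of $S_q$ (a corrupt dealer may provide nothing). $\mathcal F_{ABA}$ collects binary votes; the adversary chooses a core set $C$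 with $\mathcal P\setminus C$ admissible; once all of $C$ have voted, the output is the common vote of the honest parties of $C$ if there is one, and otherwise a bit controlled by the adversary; every party gets this output, and it is eventually computed if all honest parties vote. "Agreement among the parties" (ACS) means: one $\mathcal F_{ABA}$ instance per party $P_j$; a party votes $1$ for those $P_j$ that meet a stated condition and, as soon as some instance outputs $1$, votes $0$ in all instances in which it has not voted; when all $n$ instances have output, the least $P_j$ with output $1$ is chosen. **Reconstruction.** To reconstruct $[s]_q$, the parties of $S_q$ send it to all parties outside $S_q$, and these accept a value $v$ received from a set $S'\subseteq S_q$ with $S_q\setminus S'$ admissible. To reconstruct $s$, all $[s]_q$ are reconstructed and added. **Protocol $\Pi_{Mult}$** on input sharings $[a],[b]$. Start with $\mathcal{GD}=\emptyset$; run iterations $\mathrm{iter}=1,2,\dots$ as follows. 1. For every $Z\in\mathcal Z$ run an optimistic multiplication. All index pairs $(p,q)\in\{1,\dots,h\}^2$ are initially unmarked, and $P_j$ is assigned the pairs with $P_j\in S_p\cap S_q$. While unmarked pairs remain, perform a hop: every $P_i\notin Z$ not selected before calls $\mathcal F_{VSS}$ with random shares of $c^{(i)}=\sum[a]_p[b]_q$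 over its assigned unmarked pairs; by agreement a party $P_j$ is selected, where $P_i$ votes $1$ for $P_j$ if $P_j\notin\mathcal{GD}\cup Z$, $P_j$ has not been selected, $P_j$ is in no set $\mathcal W^{(i)}_{r}$, $\mathcal{LD}^{(i)}_{r}$ with $r<\mathrm{iter}$, and $P_i$ has received its shares of $P_j$'s value; the pairs of $P_j$ are then marked. The output is $[c_Z]$, the sum of the sharings of the selected parties. 2. For a publicly fixed $Z'\in\mathcal Z$, reconstruct $c_Z-c_{Z'}$ for all $Z$. If all are $0$, the iteration is successful: output $[c_{Z'}]$ (parties continue to serve the other parties). Otherwise it fails; let $Z$ be the first set with $c_Z\ne c_{Z'}$. Cheater identification for $(Z,Z')$ runs in the background: every party $P_j$ selected for one of $Z,Z'$ shares by $\mathcal F_{VSS}$, for every $P_k$ selected for the other one, the sum $d_{jk}$ of the products over the pairs common to its own summands and those of $P_k$. $\mathcal W^{(i)}_{\mathrm{iter}}$ consists of the selected parties for which $P_i$ still misses a share of such a part. The differences $c^{(j)}-\sum_kd_{jk}$ are reconstructed, and $P_i$ puts $P_j$ into $\mathcal{LD}^{(i)}_{\mathrm{iter}}$ if the difference is non-zero.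 For $P_j$ selected for $Z$ and $P_k$ selected for $Z'$ the difference of the two corresponding parts is reconstructed; if it is non-zero, both parts and all $[a]_p,[b]_q$ involved are reconstructed, and those of $P_j,P_k$ whose part is wrong are put into $\mathcal{LD}^{(i)}_{\mathrm{iter}}$. 3. After a failed iteration whose number is a multiple of $tn+1$, the parties agree on one party to be added to $\mathcal{GD}$, where $P_i$ votes $1$ for $P_j$ if $P_j\notin\mathcal{GD}$ and $P_j\in\mathcal{LD}^{(i)}_r$ for some $r\le\mathrm{iter}$. Then the next iteration starts. **Lemma.** Under these hypotheses, in the $(\mathcal F_{VSS},\mathcal F_{ABA})$-hybrid model and for every adversary: * at most $t(tn+1)$ iterations of $\Pi_{Mult}$ fail, so that it takes at most $t(tn+1)+1$ iterations; * all honest parties eventually output a sharing of $ab$; * the adversary learns nothing additional about $a$ and $b$: for every adversary strategy, the distribution of its view is the same for any two pairs of input sharings that agree on all shares $[a]_q,[b]_q$ with $S_q\cap Z^\star\neq\emptyset$; * the honest parties call $\mathcal O(|\mathcal Z|\,n^5)$ instances of $\mathcal F_{VSS}$ and of $\mathcal F_{ABA}$ and additionally send $\mathcal O(|\mathcal Z|^2n^5\log|\mathbb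 F|+|\mathcal Z|\,n^7\log|\mathbb F|)$ bits (each message being one field element), with absolute constants. -/

import Mathlib

namespace AsyncMult

/-! ### Parties, adversary structure, sharing specification -/

/-- The condition `Q^(k)(P', Z)`: no `k` sets of the structure cover `P'`. -/
def QCond {n h : ℕ} (k : ℕ) (P' : Finset (Fin n)) (Z : Fin h → Finset (Fin n)) : Prop :=
  ∀ f : Fin k → Fin h, ¬ P' ⊆ Finset.univ.biUnion fun m => Z (f m)

/-- Public parameters: the adversary structure, enumerated as `Z 0, …, Z (h - 1)`, and for every
iteration the publicly known set `Z (ref iter)` with which all other sets are compared. -/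
structure Setup (n h : ℕ) where
  Z : Fin h → Finset (Fin n)
  ref : ℕ → Fin h

namespace Setup
variable {n h : ℕ} (G : Setup n h)

/-- The sharing specification: the `q`-th group is the complement of the `q`-th set. -/
def S (q : Fin h) : Finset (Fin n) := (G.Z q)ᶜ

/-- Sets that the adversary structure allows to be corrupt (members of the structure and their
subsets; for a structure closed under subsets this is membership). -/
def Admissible (W : Finset (Fin n)) : Prop := ∃ z, W ⊆ G.Z z

/-- The largest cardinality of a set of the structure. -/
def t : ℕ := Finset.univ.sup fun z => (G.Z z).card

/-- The number of failed iterations after which a cheater is globally discarded. -/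
def block : ℕ := G.t * n + 1

end Setup

/-! ### Session identifiers -/

/-- Instances of the VSS functionality; the dealer is `j`.
`sum iter z hop j`: the summand-sum shared by `j` in a hop of the optimistic multiplication for `z`.
`part iter z j k`: the part of the summand-sum of `j` (in the instance for `z`) that overlaps with
the summands of `k` in the conflicting instance. -/
inductive VssId (n h : ℕ)
  | sum (iter : ℕ) (z : Fin h) (hop : ℕ) (j : Fin n)
  | part (iter : ℕ) (z : Fin h) (j k : Fin n)
  deriving DecidableEq

def VssId.dealer {n h : ℕ} : VssId n h → Fin n
  | .sum _ _ _ j => j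
  | .part _ _ j _ => j

/-- Instances of the ABA functionality: selecting a summand-sharing party in a hop, and globally
discarding a cheater after an iteration. -/
inductive AbaId (n h : ℕ)
  | select (iter : ℕ) (z : Fin h) (hop : ℕ) (j : Fin n)
  | discard (iter : ℕ) (j : Fin n)
  deriving DecidableEq

/-- Public reconstructions. `diff`: the difference of two products; `check`: a summand-sum minus
the sum of its parts; `pair`: the difference of two corresponding parts; `part`: a part;
`inputA`, `inputB`: single shares of the two inputs, for the conflicting pair `(j, k)`. -/
inductive RecId (n h : ℕ)
  | diff (iter : ℕ) (z : Fin h)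
  | check (iter : ℕ) (z : Fin h) (j : Fin n)
  | pair (iter : ℕ) (j k : Fin n)
  | part (iter : ℕ) (z : Fin h) (j k : Fin n)
  | inputA (iter : ℕ) (j k : Fin n)
  | inputB (iter : ℕ) (j k : Fin n)
  deriving DecidableEq

/-! ### The code of a party

The local state of a party consists of its input shares and of everything it has received so far;
all sets and flags that the party maintains are functions of it. -/

structure Local (n h : ℕ) (F : Type*) where
  me : Fin n
  /-- input shares (`0` where the party does not hold the share) -/
  a : Fin h → F
  b : Fin h → F
  /-- outputs received from the VSS functionality (`0` where the party does not hold the share) -/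
  vss : VssId n h → Option (Fin h → F)
  /-- outputs received from the ABA functionality -/
  aba : AbaId n h → Option Bool
  /-- `msg r q j` is the value that `j` has sent as the `q`-th share in reconstruction `r` -/
  msg : RecId n h → Fin h → Fin n → Option F
  /-- the ABA instances to which a vote has been sent -/
  voted : AbaId n h → Bool

/-- The variables of an optimistic multiplication: the number of completed hops, the hop in which
a party was selected, the unmarked summands, and the summands assigned to each party. -/
structure OptState (n h : ℕ) where
  hop : ℕ
  hopOf : Fin n → Option ℕ
  summands : Finset (Fin h × Fin h)
  own : Fin n → Finset (Fin h × Fin h)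

namespace OptState
variable {n h : ℕ} (G : Setup n h)

def init : OptState n h where
  hop := 0
  hopOf := fun _ => none
  summands := Finset.univ
  own := fun j => Finset.univ.filter fun pq => j ∈ G.S pq.1 ∧ j ∈ G.S pq.2

/-- The summand-sharing parties selected so far. -/
def selected (o : OptState n h) : Finset (Fin n) :=
  Finset.univ.filter fun j => (o.hopOf j).isSome

/-- The update at the end of a hop in which `j` has been selected. -/
def next (z : Fin h) (o : OptState n h) (j : Fin n) : OptState n h where
  hop := o.hop + 1
  hopOf := Function.update o.hopOf j (some o.hop)
  summands := o.summands \ o.own j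
  own := fun k => if k ∈ G.Z z ∪ insert j o.selected then o.own k else o.own k \ o.own j

end OptState

/-- The sum of the given values, once all of them are known. -/
def optSum {ι F : Type*} [AddCommMonoid F] (s : Finset ι) (f : ι → Option F) : Option F :=
  if ∀ i ∈ s, (f i).isSome then some (∑ i ∈ s, (f i).getD 0) else none

namespace Local
variable {n h : ℕ} {F : Type*} [Field F] [DecidableEq F] (G : Setup n h) (L : Local n h F)

/-- The outcome of an agreement on a common subset: the least party whose ABA instance has
returned `1`, once all `n` instances have returned an output. -/
def winner (sid : Fin n → AbaId n h) : Option (Fin n) :=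
  if ∀ j, (L.aba (sid j)).isSome then
    (List.finRange n).find? fun j => decide (L.aba (sid j) = some true)
  else none

/-! #### Optimistic multiplication -/

/-- One hop: nothing changes while the hop is not completed, or when no summand is left. -/
def advance (iter : ℕ) (z : Fin h) (o : OptState n h) : OptState n h :=
  if o.summands = ∅ then o
  else match L.winner (AbaId.select iter z o.hop) with
    | none => o
    | some j => o.next G z j

/-- The current values of the variables of the optimistic multiplication for `z`. Distinct parties
are selected in distinct hops, so that there are at most `n` hops. -/
def opt (iter : ℕ) (z : Fin h) : OptState n h :=
  (L.advance G iter z)^[n] (OptState.init G)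

def sel (iter : ℕ) (z : Fin h) : Finset (Fin n) := (L.opt G iter z).selected

def summ (iter : ℕ) (z : Fin h) (j : Fin n) : Finset (Fin h × Fin h) := (L.opt G iter z).own j

/-- The `q`-th share of the value shared by `j` in the instance for `z`; parties that have not been
selected contribute the default sharing of `0`. -/
def sumShare (iter : ℕ) (z : Fin h) (j : Fin n) (q : Fin h) : Option F :=
  match (L.opt G iter z).hopOf j with
  | none => some 0
  | some m => (L.vss (.sum iter z m j)).map fun v => v q

/-- The `q`-th share of the output of the instance for `z`, once the instance is completed. -/
def prodShare (iter : ℕ) (z : Fin h) (q : Fin h) : Option F :=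
  if (L.opt G iter z).summands = ∅ then optSum Finset.univ fun j => L.sumShare G iter z j q
  else none

/-! #### Public reconstruction -/

open Classical in
/-- Reconstruction of a single share: a party outside the `q`-th group outputs a value received
from all but an admissible set of the members of the group. -/
noncomputable def recShare (r : RecId n h) (own : Fin h → Option F) (q : Fin h) : Option F :=
  if L.me ∈ G.S q then own q
  else if hv : ∃ v, G.Admissible (G.S q \ (G.S q).filter fun j => L.msg r q j = some v) then
    some hv.choose
  else none

/-- Reconstruction of a shared value. -/
noncomputable def recValue (r : RecId n h) (own : Fin h → Option F) : Option F :=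
  optSum Finset.univ (L.recShare G r own)

/-! #### Multiplication with cheater identification -/

def diffIn (iter : ℕ) (z : Fin h) (q : Fin h) : Option F :=
  Option.map₂ (· - ·) (L.prodShare G iter z q) (L.prodShare G iter (G.ref iter) q)

noncomputable def diffVal (iter : ℕ) (z : Fin h) : Option F :=
  L.recValue G (.diff iter z) (L.diffIn G iter z)

/-- `none`: not decided yet; `some none`: the iteration is successful; `some (some z)`: the
iteration has failed and `z`, `G.ref iter` are the conflicting sets. -/
noncomputable def verdict (iter : ℕ) : Option (Option (Fin h)) :=
  if ∀ z, (L.opt G iter z).summands = ∅ ∧ (L.diffVal G iter z).isSome then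
    some ((List.finRange h).find? fun z => decide (L.diffVal G iter z ≠ some 0))
  else none

/-- `L.Conflict G iter z`: the iteration has failed with conflicting sets `z`, `G.ref iter`. -/
def Conflict (iter : ℕ) (z : Fin h) : Prop := L.verdict G iter = some (some z)

/-- The other one of the two conflicting sets `z₀` and `G.ref iter`. -/
def _root_.AsyncMult.Setup.opp (iter : ℕ) (z₀ z : Fin h) : Fin h :=
  if z = z₀ then G.ref iter else z₀

def partShare (iter : ℕ) (z : Fin h) (j k : Fin n) (q : Fin h) : Option F :=
  (L.vss (.part iter z j k)).map fun v => v q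

def checkIn (iter : ℕ) (z₀ z : Fin h) (j : Fin n) (q : Fin h) : Option F :=
  Option.map₂ (· - ·) (L.sumShare G iter z j q)
    (optSum (L.sel G iter (G.opp iter z₀ z)) fun k => L.partShare iter z j k q)

noncomputable def checkVal (iter : ℕ) (z₀ z : Fin h) (j : Fin n) : Option F :=
  L.recValue G (.check iter z j) (L.checkIn G iter z₀ z j)

def pairIn (iter : ℕ) (z₀ : Fin h) (j k : Fin n) (q : Fin h) : Option F :=
  Option.map₂ (· - ·) (L.partShare iter z₀ j k q) (L.partShare iter (G.ref iter) k j q)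

noncomputable def pairVal (iter : ℕ) (z₀ : Fin h) (j k : Fin n) : Option F :=
  L.recValue G (.pair iter j k) (L.pairIn G iter z₀ j k)

/-- `j` (selected for `z₀`) and `k` (selected for the reference set) have been found to have shared
different values for the part of the summands that they have in common. -/
def Mismatch (iter : ℕ) (z₀ : Fin h) (j k : Fin n) : Prop :=
  j ∈ L.sel G iter z₀ ∧ k ∈ L.sel G iter (G.ref iter) ∧
    ∃ v, L.pairVal G iter z₀ j k = some v ∧ v ≠ 0

/-- The summands common to `j` and `k`. -/
def common (iter : ℕ) (z₀ : Fin h) (j k : Fin n) : Finset (Fin h × Fin h) :=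
  L.summ G iter z₀ j ∩ L.summ G iter (G.ref iter) k

noncomputable def partVal (iter : ℕ) (z : Fin h) (j k : Fin n) : Option F :=
  L.recValue G (.part iter z j k) (L.partShare iter z j k)

/-- The sum of the common summands, computed from publicly reconstructed input shares. -/
noncomputable def commonVal (iter : ℕ) (z₀ : Fin h) (j k : Fin n) : Option F :=
  optSum (L.common G iter z₀ j k) fun pq =>
    Option.map₂ (· * ·) (L.recShare G (.inputA iter j k) (fun p => some (L.a p)) pq.1)
      (L.recShare G (.inputB iter j k) (fun q => some (L.b q)) pq.2)

/-- The wait-list of an iteration. -/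
def W (iter : ℕ) : Set (Fin n) :=
  {j | ∃ z₀, L.Conflict G iter z₀ ∧ ∃ z, (z = z₀ ∨ z = G.ref iter) ∧ j ∈ L.sel G iter z ∧
    ∃ k ∈ L.sel G iter (G.opp iter z₀ z), L.vss (.part iter z j k) = none}

/-- The parties locally discarded in an iteration. -/
def LD (iter : ℕ) : Set (Fin n) :=
  {j | ∃ z₀, L.Conflict G iter z₀ ∧
    ((∃ z, (z = z₀ ∨ z = G.ref iter) ∧ j ∈ L.sel G iter z ∧
        ∃ v, L.checkVal G iter z₀ z j = some v ∧ v ≠ 0) ∨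
      (∃ k, L.Mismatch G iter z₀ j k ∧ ∃ d s, L.partVal G iter z₀ j k = some d ∧
        L.commonVal G iter z₀ j k = some s ∧ d ≠ s) ∨
      (∃ k, L.Mismatch G iter z₀ k j ∧ ∃ e s, L.partVal G iter (G.ref iter) j k = some e ∧
        L.commonVal G iter z₀ k j = some s ∧ e ≠ s))}

/-! #### The multiplication protocol -/

/-- The party takes part in iteration `iter`: all earlier iterations have failed, and after every
block of failed iterations a party has been globally discarded. -/
def Reached (iter : ℕ) : Prop :=
  1 ≤ iter ∧ ∀ r, 1 ≤ r → r < iter → (∃ z, L.Conflict G r z) ∧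
    (G.block ∣ r → (L.winner (AbaId.discard r)).isSome)

/-- The parties globally discarded before iteration `iter`. -/
def GD (iter : ℕ) : Set (Fin n) :=
  {j | ∃ r, 1 ≤ r ∧ r < iter ∧ G.block ∣ r ∧ L.winner (AbaId.discard r) = some j}

/-- The party has terminated the loop with success. -/
def Finished : Prop := ∃ iter, L.Reached G iter ∧ L.verdict G iter = some none

/-- The party outputs `v` as its `q`-th share of the product. -/
def Outputs (q : Fin h) (v : F) : Prop :=
  ∃ iter, L.Reached G iter ∧ L.verdict G iter = some none ∧
    L.prodShare G iter (G.ref iter) q = some v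

/-! #### Messages of a party -/

/-- The party is executing hop `hop` of the optimistic multiplication for `z`. -/
def InHop (iter : ℕ) (z : Fin h) (hop : ℕ) : Prop :=
  L.Reached G iter ∧ (L.opt G iter z).hop = hop ∧ (L.opt G iter z).summands ≠ ∅

/-- The party runs the agreement on a globally discarded party after iteration `iter`. -/
def InDiscard (iter : ℕ) : Prop :=
  L.Reached G iter ∧ G.block ∣ iter ∧ ∃ z, L.Conflict G iter z

/-- The party, as the dealer of `sid`, has to share the value `c`. -/
def Deals (c : F) : VssId n h → Prop
  | .sum iter z hop j => j = L.me ∧ L.InHop G iter z hop ∧ j ∉ G.Z z ∧ j ∉ L.sel G iter z ∧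
      c = ∑ pq ∈ L.summ G iter z j, L.a pq.1 * L.b pq.2
  | .part iter z j k => j = L.me ∧ L.Reached G iter ∧ ∃ z₀, L.Conflict G iter z₀ ∧
      (z = z₀ ∨ z = G.ref iter) ∧ j ∈ L.sel G iter z ∧ k ∈ L.sel G iter (G.opp iter z₀ z) ∧
      c = ∑ pq ∈ L.summ G iter z j ∩ L.summ G iter (G.opp iter z₀ z) k, L.a pq.1 * L.b pq.2

/-- The party requests an output from the VSS instance. -/
def RequestsVss : VssId n h → Prop
  | .sum iter z hop _ => L.Reached G iter ∧ (hop < (L.opt G iter z).hop ∨ L.InHop G iter z hop)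
  | .part iter z j k => L.Reached G iter ∧ ∃ z₀, L.Conflict G iter z₀ ∧
      (z = z₀ ∨ z = G.ref iter) ∧ j ∈ L.sel G iter z ∧ k ∈ L.sel G iter (G.opp iter z₀ z)

/-- The party requests an output from the ABA instance. -/
def RequestsAba : AbaId n h → Prop
  | .select iter z hop _ =>
      L.Reached G iter ∧ (hop < (L.opt G iter z).hop ∨ L.InHop G iter z hop)
  | .discard iter _ => L.InDiscard G iter

/-- The party may send the vote `b`, if it has not voted yet. -/
def MayVote : AbaId n h → Bool → Prop
  | .select iter z hop j, true => L.InHop G iter z hop ∧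
      j ∉ L.GD G iter ∧ j ∉ G.Z z ∧ j ∉ L.sel G iter z ∧
      (∀ r, 1 ≤ r → r < iter → j ∉ L.W G r ∧ j ∉ L.LD G r) ∧
      L.vss (.sum iter z hop j) ≠ none
  | .select iter z hop _, false => L.InHop G iter z hop ∧
      ∃ k, L.aba (.select iter z hop k) = some true
  | .discard iter j, true => L.InDiscard G iter ∧ L.winner (AbaId.discard iter) = none ∧
      (∃ r, 1 ≤ r ∧ r ≤ iter ∧ j ∈ L.LD G r) ∧ j ∉ L.GD G iter
  | .discard iter _, false => L.InDiscard G iter ∧ L.winner (AbaId.discard iter) = none ∧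
      ∃ k, L.aba (.discard iter k) = some true

/-- The party takes part in reconstruction `r` with `v` as the `q`-th share. -/
def Contributes (q : Fin h) (v : F) : RecId n h → Prop
  | .diff iter z => L.Reached G iter ∧ L.diffIn G iter z q = some v
  | .check iter z j => L.Reached G iter ∧ ∃ z₀, L.Conflict G iter z₀ ∧
      (z = z₀ ∨ z = G.ref iter) ∧ j ∈ L.sel G iter z ∧ L.checkIn G iter z₀ z j q = some v
  | .pair iter j k => L.Reached G iter ∧ ∃ z₀, L.Conflict G iter z₀ ∧
      j ∈ L.sel G iter z₀ ∧ k ∈ L.sel G iter (G.ref iter) ∧ L.pairIn G iter z₀ j k q = some v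
  | .part iter z j k => L.Reached G iter ∧ ∃ z₀, L.Conflict G iter z₀ ∧
      ((z = z₀ ∧ L.Mismatch G iter z₀ j k) ∨ (z = G.ref iter ∧ L.Mismatch G iter z₀ k j)) ∧
      L.partShare iter z j k q = some v
  | .inputA iter j k => L.Reached G iter ∧ ∃ z₀, L.Conflict G iter z₀ ∧
      L.Mismatch G iter z₀ j k ∧ (∃ p, (q, p) ∈ L.common G iter z₀ j k) ∧ v = L.a q
  | .inputB iter j k => L.Reached G iter ∧ ∃ z₀, L.Conflict G iter z₀ ∧
      L.Mismatch G iter z₀ j k ∧ (∃ p, (p, q) ∈ L.common G iter z₀ j k) ∧ v = L.b q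

end Local

/-! ### The ABA functionality -/

/-- Votes, the core set recorded last together with the bit that settles a disagreement of honest
parties when the core set has no corrupt party, and the output. -/
structure AbaState (n : ℕ) where
  vote : Fin n → Option Bool
  core : Option (Finset (Fin n) × Bool)
  out : Option Bool

namespace AbaState
variable {n : ℕ} (K : Finset (Fin n)) (x : AbaState n)

/-- The output for core set `C`: the common vote of the honest parties of `C`, if there is one,
and otherwise the vote of the least corrupt party of `C`. -/
def decision (C : Finset (Fin n)) (tie : Bool) : Bool :=
  if ∀ i ∈ C \ K, x.vote i = some true then true
  else if ∀ i ∈ C \ K, x.vote i = some false then false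
  else match (List.finRange n).find? fun i => decide (i ∈ C ∩ K) with
    | some i => (x.vote i).getD tie
    | none => tie

/-- Computes the output as soon as every party of the recorded core set has voted. -/
def settle : AbaState n :=
  match x.out, x.core with
  | none, some (C, tie) =>
      if ∀ i ∈ C, (x.vote i).isSome then { x with out := some (x.decision K C tie) } else x
  | _, _ => x

def addVote (i : Fin n) (b : Bool) : AbaState n :=
  if x.out.isSome then x else settle K { x with vote := Function.update x.vote i (some b) }

def addCore (C : Finset (Fin n)) (tie : Bool) : AbaState n :=
  if x.out.isSome then x else settle K { x with core := some (C, tie) }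

end AbaState

/-! ### Executions

`K` is the set of corrupt parties. The adversary schedules all events. -/

structure State (n h : ℕ) (F : Type*) where
  loc : Fin n → Local n h F
  /-- sharings that the VSS functionality has received from the dealers -/
  vss : VssId n h → Option (Fin h → F)
  aba : AbaId n h → AbaState n
  /-- `sent i r q` is the value that the honest party `i` has sent, as its `q`-th share in
  reconstruction `r`, to all parties outside the `q`-th group -/
  sent : Fin n → RecId n h → Fin h → Option F

/-- Events: an honest party shares a value, votes, or sends a share; an honest party receives an
output of a functionality, or a message of an honest party; and the inputs of the adversary to the
functionalities and its messages to honest parties on behalf of corrupt parties. -/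
inductive Action (n h : ℕ) (F : Type*)
  | deal (i : Fin n) (sid : VssId n h)
  | vote (i : Fin n) (sid : AbaId n h) (b : Bool)
  | send (i : Fin n) (r : RecId n h) (q : Fin h)
  | vssOut (i : Fin n) (sid : VssId n h)
  | abaOut (i : Fin n) (sid : AbaId n h)
  | deliver (j i : Fin n) (r : RecId n h) (q : Fin h)
  | advDeal (sid : VssId n h) (v : Fin h → F)
  | advVote (j : Fin n) (sid : AbaId n h) (b : Bool)
  | advCore (sid : AbaId n h) (C : Finset (Fin n)) (tie : Bool)
  | advSend (j i : Fin n) (r : RecId n h) (q : Fin h) (v : F)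

/-- What the adversary sees of an event: `none` if it did not take place, otherwise the
values that reach corrupt parties. -/
abbrev Obs (h : ℕ) (F : Type*) := Option (Fin h → Option F)

/-- All sharings of `c`, as vectors of shares. -/
def sharings (h : ℕ) {F : Type*} [Field F] [Fintype F] [DecidableEq F] (c : F) :
    Finset (Fin h → F) := Finset.univ.filter fun v => ∑ q, v q = c

theorem sharings_nonempty {h : ℕ} [NeZero h] {F : Type*} [Field F] [Fintype F] [DecidableEq F]
    (c : F) : (sharings h c).Nonempty :=
  ⟨Pi.single 0 c, by simp [sharings]⟩

section Executions
variable {n h : ℕ} {F : Type*} [Field F] [DecidableEq F] (G : Setup n h) (K : Finset (Fin n))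

/-- The initial state for the sharings `a`, `b` of the two inputs. -/
def initial (a b : Fin h → F) : State n h F where
  loc := fun i =>
    { me := i
      a := fun q => if i ∈ G.S q then a q else 0
      b := fun q => if i ∈ G.S q then b q else 0
      vss := fun _ => none
      aba := fun _ => none
      msg := fun _ _ _ => none
      voted := fun _ => false }
  vss := fun _ => none
  aba := fun _ => { vote := fun _ => none, core := none, out := none }
  sent := fun _ _ _ => none

/-- The adversary learns the `q`-th share of every sharing. -/
def Known (q : Fin h) : Prop := ∃ j ∈ K, j ∈ G.S q

/-- The event can take place. -/
def Enabled (st : State n h F) : Action n h F → Prop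
  | .deal i sid => i ∉ K ∧ st.vss sid = none ∧ ∃ c, (st.loc i).Deals G c sid
  | .vote i sid b => i ∉ K ∧ (st.loc i).voted sid = false ∧ (st.loc i).MayVote G sid b
  | .send i r q => i ∉ K ∧ i ∈ G.S q ∧ st.sent i r q = none ∧
      ∃ v, (st.loc i).Contributes G q v r
  | .vssOut i sid => i ∉ K ∧ (st.vss sid).isSome ∧ (st.loc i).vss sid = none ∧
      (st.loc i).RequestsVss G sid
  | .abaOut i sid => i ∉ K ∧ (st.aba sid).out.isSome ∧ (st.loc i).aba sid = none ∧
      (st.loc i).RequestsAba G sid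
  | .deliver j i r q => j ∉ K ∧ i ∉ K ∧ j ∈ G.S q ∧ i ∉ G.S q ∧ (st.sent j r q).isSome ∧
      (st.loc i).msg r q j = none
  | .advDeal sid _ => sid.dealer ∈ K ∧ st.vss sid = none
  | .advVote j _ _ => j ∈ K
  | .advCore _ C _ => G.Admissible Cᶜ
  | .advSend j i r q _ => j ∈ K ∧ i ∉ K ∧ j ∈ G.S q ∧ i ∉ G.S q ∧ (st.loc i).msg r q j = none

def State.setLoc (st : State n h F) (i : Fin n) (L : Local n h F) : State n h F :=
  { st with loc := Function.update st.loc i L }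

def State.setMsg (st : State n h F) (i : Fin n) (r : RecId n h) (q : Fin h) (j : Fin n)
    (v : Option F) : State n h F :=
  st.setLoc i { st.loc i with
    msg := fun r' q' j' => if r' = r ∧ q' = q ∧ j' = j then v else (st.loc i).msg r' q' j' }

open Classical in
/-- The effect of an event, and what the adversary sees of it. The shares of an honest dealer are
uniformly random subject to their sum. Nothing happens if the event cannot take place. -/
noncomputable def exec [Fintype F] [NeZero h] (st : State n h F) (x : Action n h F) :
    PMF (State n h F × Obs h F) :=
  if Enabled G K st x then
    match x with
    | .deal i sid =>
        if hc : ∃ c, (st.loc i).Deals G c sid then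
          (PMF.uniformOfFinset (sharings h hc.choose) (sharings_nonempty _)).map fun v =>
            ({ st with vss := Function.update st.vss sid (some v) },
              some fun q => if Known G K q then some (v q) else none)
        else PMF.pure (st, none)
    | .vote i sid b => PMF.pure
        ({ st.setLoc i { st.loc i with voted := Function.update (st.loc i).voted sid true } with
            aba := Function.update st.aba sid ((st.aba sid).addVote K i b) },
          some fun _ => none)
    | .send i r q =>
        if hv : ∃ v, (st.loc i).Contributes G q v r then
          PMF.pure
            ({ st with sent := fun i' r' q' =>
                if i' = i ∧ r' = r ∧ q' = q then some hv.choose else st.sent i' r' q' },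
              some fun q' => if q' = q ∧ ∃ j ∈ K, j ∉ G.S q then some hv.choose else none)
        else PMF.pure (st, none)
    | .vssOut i sid => PMF.pure
        (st.setLoc i { st.loc i with
            vss := Function.update (st.loc i).vss sid
              ((st.vss sid).map fun v q => if i ∈ G.S q then v q else 0) },
          some fun _ => none)
    | .abaOut i sid => PMF.pure
        (st.setLoc i { st.loc i with
            aba := Function.update (st.loc i).aba sid (st.aba sid).out },
          some fun _ => none)
    | .deliver j i r q => PMF.pure (st.setMsg i r q j (st.sent j r q), some fun _ => none)
    | .advDeal sid v => PMF.pure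
        ({ st with vss := Function.update st.vss sid (some v) }, some fun _ => none)
    | .advVote j sid b => PMF.pure
        ({ st with aba := Function.update st.aba sid ((st.aba sid).addVote K j b) },
          some fun _ => none)
    | .advCore sid C tie => PMF.pure
        ({ st with aba := Function.update st.aba sid ((st.aba sid).addCore K C tie) },
          some fun _ => none)
    | .advSend j i r q v => PMF.pure (st.setMsg i r q j (some v), some fun _ => none)
  else PMF.pure (st, none)

/-- `st 0, st 1, …` is an infinite execution in which the events `x 0, x 1, …` are scheduled, for
some values of the random choices. -/
structure IsRun [Fintype F] [NeZero h] (a b : Fin h → F) (st : ℕ → State n h F)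
    (x : ℕ → Action n h F) : Prop where
  init : st 0 = initial G a b
  step : ∀ T, ∃ o, (st (T + 1), o) ∈ (exec G K (st T) (x T)).support

/-- Events that must not be delayed for ever. -/
def Action.Due : Action n h F → Prop
  | .deal _ _ | .vote _ _ _ | .send _ _ _ | .vssOut _ _ | .abaOut _ _ | .deliver _ _ _ _ => True
  | _ => False

/-- Eventual delivery: no step of an honest party, no output that an honest party requests, and no
message between honest parties is delayed for ever; and an ABA instance in which all honest parties
have voted eventually computes its output. -/
structure Fair (st : ℕ → State n h F) (x : ℕ → Action n h F) : Prop where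
  due : ∀ y : Action n h F, y.Due → ∀ T, ∃ T' ≥ T, x T' = y ∨ ¬ Enabled G K (st T') y
  aba : ∀ sid T, (∀ i ∉ K, (((st T).aba sid).vote i).isSome) →
    ∃ T', ((st T').aba sid).out.isSome

/-- The VSS instances called by honest parties. -/
def vssCalls (st : ℕ → State n h F) : Set (VssId n h) :=
  {sid | ∃ T, ∃ i ∉ K, (sid.dealer = i ∧ ((st T).vss sid).isSome) ∨
    ((st T).loc i).RequestsVss G sid}

/-- The ABA instances called by honest parties. -/
def abaCalls (st : ℕ → State n h F) : Set (AbaId n h) :=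
  {sid | ∃ T, ∃ i ∉ K, ((st T).loc i).voted sid = true ∨ ((st T).loc i).RequestsAba G sid}

/-- All messages sent by honest parties, as (sender, receiver, reconstruction, index of share). -/
def messages (st : ℕ → State n h F) : Set (Fin n × Fin n × RecId n h × Fin h) :=
  {m | m.1 ∉ K ∧ m.2.1 ∉ G.S m.2.2.2 ∧ ∃ T, ((st T).sent m.1 m.2.2.1 m.2.2.2).isSome}

/-- The number of bits sent by honest parties: every message consists of one field element. -/
noncomputable def bits [Fintype F] (st : ℕ → State n h F) : ℕ :=
  (messages G K st).ncard * Nat.clog 2 (Fintype.card F)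

/-! ### The view of the adversary -/

/-- The view: the events scheduled so far with what was seen of them. -/
abbrev View (n h : ℕ) (F : Type*) := List (Action n h F × Obs h F)

/-- The joint distribution of the state and the view after `T` steps, when the adversary chooses
the next event by the (randomized) strategy `adv`, given only its view. -/
noncomputable def execution [Fintype F] [NeZero h] (adv : View n h F → PMF (Action n h F))
    (a b : Fin h → F) : ℕ → PMF (State n h F × View n h F)
  | 0 => PMF.pure (initial G a b, [])
  | T + 1 => (execution adv a b T).bind fun s =>
      (adv s.2).bind fun x => (exec G K s.1 x).map fun r => (r.1, s.2 ++ [(x, r.2)])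

noncomputable def viewDist [Fintype F] [NeZero h] (adv : View n h F → PMF (Action n h F))
    (a b : Fin h → F) (T : ℕ) : PMF (View n h F) :=
  (execution G K adv a b T).map Prod.snd

end Executions

end AsyncMult

/-! The functionalities and the honest senders build up one global record that is never revised, and
every variable of an honest party is a function of the fragment received so far. Once such a
variable is determined (the state after a completed hop, a verdict, a reconstructed value), later
deliveries do not change it, and it equals what the full record `State.glob` yields. Agreement
between honest parties therefore follows from comparing each of them with the record. The necessary
facts form the invariant `Inv`, preserved by every possible step (`Inv.step`); the most important
one is that every ABA output was voted for by some honest party.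

Correctness. In an optimistic multiplication the pairs of the selected parties partition all index
pairs (`OptGood`), so honest summand-sums add up to the product. Some set of the structure contains
all corrupt parties, and in its instance only honest parties are selected. A successful iteration
equates the reference product with that one (`Inv.success`).

Number of iterations. Honest parties pass every test of the cheater identification
(`Inv.LD_subset`), so only corrupt parties are discarded, and never twice. After `t` complete blocks
all of them are gone, all products are right, and no iteration can fail (`Inv.conflict_le`).

Termination. While a pair `(p, q)` is unmarked, four sets of the structure (those of `p` and `q`,
the set of the instance, one covering the corrupt parties) leave a party uncovered. It is honest,
owns the pair, and hence has not been selected. It can collect all honest votes, so every hop ends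
(`IsRun.eventually_winner`, `IsRun.eventually_optAt`). After a failed block a cheater must be found
as well. An iteration yields no cheater only if some corrupt party withholds a part, but such a
party stays on all wait-lists and is never selected again; the block is longer than the number of
corrupt parties, so one of its iterations has all parts dealt (`IsRun.exists_allDealt`). There
either a summand-sum differs from the sum of its parts, or two corresponding parts differ and at
least one of them is wrong (`IsRun.exists_LD`).

Privacy. Suppose that no corrupt party holds the `q₀`-th shares. Changing the unknown input shares
changes the value shared in an instance by the `gap` of its summands; this change is put on the
`q₀`-th share. Honest dealings are uniform, so the translation preserves probabilities. Opened
differences are invariant since both terms move equally. Parts and inputs are opened only for a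
mismatched pair, which contains a corrupt party holding all shares involved, so that nothing moves
there. Hence one step of the execution commutes with the shift (`Inv.exec_shift`), and the views
have the same distribution.

Communication. There are `O(n ^ 3)` iterations. Only the comparison of products runs over all sets;
every other reconstruction concerns the two conflicting ones. -/

namespace AsyncMult

/-! ### Sums of optional values -/

section OptSum
variable {ι F : Type*} [AddCommMonoid F] {s : Finset ι} {f g : ι → Option F}

theorem optSum_eq_some {v : F} :
    optSum s f = some v ↔ (∀ i ∈ s, (f i).isSome) ∧ ∑ i ∈ s, (f i).getD 0 = v := by
  unfold optSum
  split_ifs with hs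
  · simp only [Option.some.injEq, iff_and_self]
    exact fun _ => hs
  · simp [hs]

theorem optSum_isSome : (optSum s f).isSome ↔ ∀ i ∈ s, (f i).isSome := by
  unfold optSum
  split_ifs with hs
  · simpa using hs
  · simpa using hs

theorem optSum_mono (hfg : ∀ i ∈ s, ∀ v, f i = some v → g i = some v) {v : F}
    (hv : optSum s f = some v) : optSum s g = some v := by
  rw [optSum_eq_some] at hv ⊢
  have hi : ∀ i ∈ s, g i = f i := fun i hi => by
    obtain ⟨w, hw⟩ := Option.isSome_iff_exists.1 (hv.1 i hi)
    rw [hfg i hi w hw, hw]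
  refine ⟨fun i his => by rw [hi i his]; exact hv.1 i his, ?_⟩
  rw [← hv.2]
  exact Finset.sum_congr rfl fun i his => by rw [hi i his]

theorem optSum_congr (hfg : ∀ i ∈ s, f i = g i) : optSum s f = optSum s g := by
  unfold optSum
  have : (∀ i ∈ s, (f i).isSome) ↔ ∀ i ∈ s, (g i).isSome :=
    forall₂_congr fun i hi => by rw [hfg i hi]
  simp only [this]
  rw [Finset.sum_congr rfl fun i hi => by rw [hfg i hi]]

end OptSum

theorem map₂_eq_some {α β γ : Type*} {f : α → β → γ} {x : Option α} {y : Option β} {c : γ} :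
    Option.map₂ f x y = some c ↔ ∃ a b, x = some a ∧ y = some b ∧ f a b = c := by
  cases x <;> cases y <;> simp

theorem map₂_mono {α β γ : Type*} {f : α → β → γ} {x x' : Option α} {y y' : Option β}
    (hx : ∀ a, x = some a → x' = some a) (hy : ∀ b, y = some b → y' = some b) {c : γ}
    (hc : Option.map₂ f x y = some c) : Option.map₂ f x' y' = some c := by
  obtain ⟨a, b, ha, hb, hc⟩ := map₂_eq_some.1 hc
  exact map₂_eq_some.2 ⟨a, b, hx a ha, hy b hb, hc⟩

/-! ### The hops of an optimistic multiplication -/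

section Hops
variable {n h : ℕ} {F : Type*} (G : Setup n h)

/-- `L'` has received all ABA outputs that `L` has received. -/
def Local.AbaLE (L L' : Local n h F) : Prop := ∀ sid b, L.aba sid = some b → L'.aba sid = some b

namespace Local
variable {L L' : Local n h F} {sid : Fin n → AbaId n h} {iter m m' : ℕ} {z : Fin h}

theorem winner_eq_some {j : Fin n} (hw : L.winner sid = some j) :
    (∀ k, (L.aba (sid k)).isSome) ∧ L.aba (sid j) = some true := by
  unfold winner at hw
  split_ifs at hw with hs
  refine ⟨hs, ?_⟩
  have := List.find?_some hw
  simpa using this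

theorem winner_isSome : (L.winner sid).isSome ↔
    (∀ k, (L.aba (sid k)).isSome) ∧ ∃ j, L.aba (sid j) = some true := by
  unfold winner
  split_ifs with hs
  · simp [hs, List.find?_isSome]
  · simp [hs]

theorem AbaLE.winner_eq (hL : L.AbaLE L') (hs : ∀ k, (L.aba (sid k)).isSome) :
    L'.winner sid = L.winner sid := by
  have : ∀ k, L'.aba (sid k) = L.aba (sid k) := fun k => by
    obtain ⟨b, hb⟩ := Option.isSome_iff_exists.1 (hs k)
    rw [hL _ _ hb, hb]
  unfold winner
  simp only [this]

theorem AbaLE.winner (hL : L.AbaLE L') {j : Fin n} (hw : L.winner sid = some j) :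
    L'.winner sid = some j := by
  rw [hL.winner_eq (winner_eq_some hw).1, hw]

variable (L) in
/-- The variables of the optimistic multiplication for `z` after (at most) `m` hops. -/
def optAt (iter : ℕ) (z : Fin h) (m : ℕ) : OptState n h :=
  (L.advance G iter z)^[m] (OptState.init G)

theorem optAt_succ : L.optAt G iter z (m + 1) = L.advance G iter z (L.optAt G iter z m) :=
  Function.iterate_succ_apply' _ _ _

theorem opt_eq_optAt : L.opt G iter z = L.optAt G iter z n := rfl

theorem advance_cases (o : OptState n h) : L.advance G iter z o = o ∨
    ∃ j, o.summands ≠ ∅ ∧ L.winner (AbaId.select iter z o.hop) = some j ∧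
      L.advance G iter z o = o.next G z j := by
  unfold advance
  split_ifs with hs
  · exact Or.inl rfl
  · cases hw : L.winner (AbaId.select iter z o.hop) with
    | none => exact Or.inl rfl
    | some j => exact Or.inr ⟨j, hs, rfl, rfl⟩

theorem advance_of_empty {o : OptState n h} (ho : o.summands = ∅) :
    L.advance G iter z o = o := by
  simp [advance, ho]

theorem advance_of_winner {o : OptState n h} (ho : o.summands ≠ ∅) {j : Fin n}
    (hw : L.winner (AbaId.select iter z o.hop) = some j) :
    L.advance G iter z o = o.next G z j := by
  simp [advance, ho, hw]

theorem optAt_succ_cases : L.optAt G iter z (m + 1) = L.optAt G iter z m ∨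
    ∃ j, (L.optAt G iter z m).summands ≠ ∅ ∧
      L.winner (AbaId.select iter z (L.optAt G iter z m).hop) = some j ∧
      L.optAt G iter z (m + 1) = (L.optAt G iter z m).next G z j := by
  rw [optAt_succ]
  exact advance_cases G _

theorem optAt_hop_le : (L.optAt G iter z m).hop ≤ m := by
  induction m with
  | zero => exact le_rfl
  | succ m ih =>
    rcases optAt_succ_cases G (L := L) (iter := iter) (z := z) (m := m) with e | ⟨j, _, _, e⟩
    · rw [e]; omega
    · rw [e]; simpa [OptState.next] using ih

theorem optAt_fixed (hf : L.advance G iter z (L.optAt G iter z m) = L.optAt G iter z m)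
    (hm : m ≤ m') : L.optAt G iter z m' = L.optAt G iter z m := by
  induction m', hm using Nat.le_induction with
  | base => rfl
  | succ k _ ih => rw [optAt_succ, ih, hf]

theorem optAt_hop_mono (hm : m ≤ m') :
    (L.optAt G iter z m).hop ≤ (L.optAt G iter z m').hop := by
  induction m', hm using Nat.le_induction with
  | base => rfl
  | succ k _ ih =>
    rcases optAt_succ_cases G (L := L) (iter := iter) (z := z) (m := k) with e | ⟨j, _, _, e⟩
    · rwa [e]
    · rw [e]; exact ih.trans (by simp [OptState.next])

/-- A hop counter below the number of updates means that some update did nothing. An update depends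
on the current state only, so all later ones do nothing either. -/
theorem optAt_stuck (hm : (L.optAt G iter z m).hop < m) :
    L.advance G iter z (L.optAt G iter z m) = L.optAt G iter z m := by
  induction m with
  | zero => omega
  | succ m ih =>
    rcases lt_or_ge (L.optAt G iter z m).hop m with hlt | hge
    · rw [optAt_succ, ih hlt, ih hlt]
    · have he : (L.optAt G iter z m).hop = m := le_antisymm (optAt_hop_le G) hge
      rcases optAt_succ_cases G (L := L) (iter := iter) (z := z) (m := m) with e | ⟨j, _, _, e⟩
      · rw [e, ← optAt_succ, e]
      · rw [e] at hm; simp [OptState.next, he] at hm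

theorem optAt_hop_eq (hm : m ≤ (L.optAt G iter z m').hop) : (L.optAt G iter z m).hop = m := by
  by_contra hne
  have hlt := lt_of_le_of_ne (optAt_hop_le G (L := L) (iter := iter) (z := z) (m := m)) hne
  rw [optAt_fixed G (optAt_stuck G hlt) (hm.trans (optAt_hop_le G))] at hm
  omega

/-- Idle updates occur only at the end. The state is thus determined by its hop counter, and `optAt`
at a hop that has been reached is the state at the start of that hop. -/
theorem optAt_hop_self : L.optAt G iter z (L.optAt G iter z m).hop = L.optAt G iter z m := by
  rcases (optAt_hop_le G (L := L) (iter := iter) (z := z) (m := m)).lt_or_eq with hlt | he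
  · have he := optAt_hop_eq G (L := L) (iter := iter) (z := z) (m := (L.optAt G iter z m).hop) le_rfl
    by_cases hf : L.advance G iter z (L.optAt G iter z (L.optAt G iter z m).hop)
        = L.optAt G iter z (L.optAt G iter z m).hop
    · exact (optAt_fixed G hf hlt.le).symm
    · exfalso
      rcases optAt_succ_cases G (L := L) (iter := iter) (z := z)
        (m := (L.optAt G iter z m).hop) with e | ⟨j, _, _, e⟩
      · exact hf (by rw [← optAt_succ, e])
      · have h1 := optAt_hop_mono G (L := L) (iter := iter) (z := z) (Nat.succ_le_of_lt hlt)
        rw [Nat.succ_eq_add_one, e] at h1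
        simp only [OptState.next, he] at h1
        omega
  · rw [he]

/-- Completed hops have used only ABA outputs that are already present, and outputs are final. The
hypothesis says that all `m` updates were genuine hops. -/
theorem AbaLE.optAt_of_hop (hL : L.AbaLE L') (hm : (L.optAt G iter z m).hop = m) :
    L'.optAt G iter z m = L.optAt G iter z m := by
  induction m with
  | zero => rfl
  | succ m ih =>
    have ih := ih (optAt_hop_eq G (m' := m + 1) (by omega))
    rcases optAt_succ_cases G (L := L) (iter := iter) (z := z) (m := m) with e | ⟨j, hs, hw, e⟩
    · have := optAt_hop_le G (L := L) (iter := iter) (z := z) (m := m)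
      rw [e] at hm; omega
    · rw [e, optAt_succ, ih]
      exact advance_of_winner G hs (hL.winner hw)

/-- The instance may have run out of summands in fewer than `m` hops; its state is then a fixed
point of all later updates, with any further outputs. -/
theorem AbaLE.optAt_of_empty (hL : L.AbaLE L') (hm : (L.optAt G iter z m).summands = ∅) :
    L'.optAt G iter z m = L.optAt G iter z m := by
  have hk := optAt_hop_self G (L := L) (iter := iter) (z := z) (m := m)
  have h1 := hL.optAt_of_hop G (iter := iter) (z := z) (m := (L.optAt G iter z m).hop) (by rw [hk])
  rw [hk] at h1
  rw [optAt_fixed G (m := (L.optAt G iter z m).hop) _ (optAt_hop_le G), h1]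
  rw [h1]
  exact advance_of_empty G hm

theorem AbaLE.opt_of_empty (hL : L.AbaLE L') (hm : (L.opt G iter z).summands = ∅) :
    L'.opt G iter z = L.opt G iter z := hL.optAt_of_empty G hm

variable (L) in
/-- Hop `hop` has been started. -/
def Visits (iter : ℕ) (z : Fin h) (hop : ℕ) : Prop :=
  hop ≤ n ∧ (L.optAt G iter z hop).hop = hop ∧ (L.optAt G iter z hop).summands ≠ ∅

theorem visits_iff {hop : ℕ} : L.Visits G iter z hop ↔
    hop < (L.opt G iter z).hop ∨ ((L.opt G iter z).hop = hop ∧ (L.opt G iter z).summands ≠ ∅) := by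
  rw [opt_eq_optAt]
  constructor
  · rintro ⟨hn, he, hs⟩
    have h1 := optAt_hop_mono G (L := L) (iter := iter) (z := z) hn
    rw [he] at h1
    rcases h1.lt_or_eq with hlt | heq
    · exact Or.inl hlt
    · have h2 := optAt_hop_self G (L := L) (iter := iter) (z := z) (m := n)
      rw [← heq] at h2
      rw [← h2]
      exact Or.inr ⟨he, hs⟩
  · rintro (hlt | ⟨rfl, hs⟩)
    · have hn := optAt_hop_le G (L := L) (iter := iter) (z := z) (m := n)
      refine ⟨by omega, optAt_hop_eq G hlt.le, fun hs => ?_⟩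
      have := optAt_fixed G (advance_of_empty G hs) (show hop ≤ n by omega)
      rw [this] at hlt
      exact absurd (optAt_hop_le G (L := L) (iter := iter) (z := z) (m := hop)) (by omega)
    · rw [Visits, optAt_hop_self]
      exact ⟨optAt_hop_le G, rfl, hs⟩

/-- A party leaves a hop, but a hop once started remains started. For this reason `Visits` replaces
`InHop` in everything that has to persist. -/
theorem AbaLE.visits (hL : L.AbaLE L') {hop : ℕ} (hv : L.Visits G iter z hop) :
    L'.Visits G iter z hop := by
  obtain ⟨hn, he, hs⟩ := hv
  rw [Visits, hL.optAt_of_hop G he]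
  exact ⟨hn, he, hs⟩

theorem optAt_own_subset (j : Fin n) :
    (L.optAt G iter z m).own j ⊆ (OptState.init G).own j := by
  induction m with
  | zero => exact subset_rfl
  | succ m ih =>
    rcases optAt_succ_cases G (L := L) (iter := iter) (z := z) (m := m) with e | ⟨k, _, _, e⟩
    · rwa [e]
    · rw [e]
      simp only [OptState.next]
      split_ifs
      · exact ih
      · exact Finset.sdiff_subset.trans ih

theorem mem_S_of_own {j : Fin n} {pq : Fin h × Fin h} (hpq : pq ∈ (L.optAt G iter z m).own j) :
    j ∈ G.S pq.1 ∧ j ∈ G.S pq.2 := by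
  simpa [OptState.init] using optAt_own_subset G j hpq

/-- What is recorded about a selected party goes back to the hop in which it was selected. -/
theorem optAt_hopOf {j : Fin n} {r : ℕ} (hr : (L.optAt G iter z m).hopOf j = some r) :
    L.winner (AbaId.select iter z r) = some j ∧ r < m ∧ (L.optAt G iter z r).hop = r ∧
      (L.optAt G iter z r).summands ≠ ∅ ∧
      (L.optAt G iter z r).own j = (L.optAt G iter z m).own j := by
  induction m with
  | zero => simp [optAt, OptState.init] at hr
  | succ m ih =>
    rcases optAt_succ_cases G (L := L) (iter := iter) (z := z) (m := m) with e | ⟨k, hs, hw, e⟩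
    · rw [e] at hr ⊢
      obtain ⟨h1, h2, h3⟩ := ih hr
      exact ⟨h1, h2.trans (Nat.lt_succ_self m), h3⟩
    · rw [e] at hr ⊢
      by_cases hjk : j = k
      · subst hjk
        simp only [OptState.next, Function.update_self, Option.some.injEq] at hr
        have h1 := optAt_hop_self G (L := L) (iter := iter) (z := z) (m := m)
        rw [← hr, h1]
        refine ⟨hw, Nat.lt_succ_of_le (optAt_hop_le G), rfl, hs, ?_⟩
        simp [OptState.next]
      · simp only [OptState.next, Function.update_of_ne hjk] at hr
        obtain ⟨h1, h2, h3, h4, h5⟩ := ih hr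
        refine ⟨h1, h2.trans (Nat.lt_succ_self m), h3, h4, h5.trans ?_⟩
        simp [OptState.next, OptState.selected, hr]

end Local
end Hops

/-! ### Monotonicity of the variables of a party -/

section Mono
variable {n h : ℕ} {F : Type*}

/-- The form in which the covering condition is used throughout. Repeating arguments gives the
conditions for fewer sets. -/
theorem QCond.exists_notMem {Z : Fin h → Finset (Fin n)} (hQ : QCond 4 Finset.univ Z)
    (w x y z : Fin h) : ∃ i, i ∉ Z w ∧ i ∉ Z x ∧ i ∉ Z y ∧ i ∉ Z z := by
  by_contra hc
  push Not at hc
  refine hQ ![w, x, y, z] fun i _ => ?_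
  rw [Finset.mem_biUnion]
  by_cases h1 : i ∈ Z w
  · exact ⟨0, Finset.mem_univ _, h1⟩
  by_cases h2 : i ∈ Z x
  · exact ⟨1, Finset.mem_univ _, h2⟩
  by_cases h3 : i ∈ Z y
  · exact ⟨2, Finset.mem_univ _, h3⟩
  · exact ⟨3, Finset.mem_univ _, hc i h1 h2 h3⟩

theorem Setup.mem_S {G : Setup n h} {i : Fin n} {q : Fin h} : i ∈ G.S q ↔ i ∉ G.Z q := by
  simp [Setup.S]

/-- `L'` has received all ABA outputs and all VSS outputs that `L` has received, up to shares other
than the `q`-th one. -/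
structure Local.ShareLE (q : Fin h) (L L' : Local n h F) : Prop where
  aba : L.AbaLE L'
  vss : ∀ sid w, L.vss sid = some w → ∃ w', L'.vss sid = some w' ∧ w' q = w q

/-- `L'` is a later state of the party than `L`. -/
structure Local.LE (L L' : Local n h F) : Prop where
  me : L'.me = L.me
  a : L'.a = L.a
  b : L'.b = L.b
  aba : L.AbaLE L'
  vss : ∀ sid w, L.vss sid = some w → L'.vss sid = some w
  msg : ∀ r q j v, L.msg r q j = some v → L'.msg r q j = some v

theorem Local.LE.refl (L : Local n h F) : L.LE L :=
  ⟨rfl, rfl, rfl, fun _ _ e => e, fun _ _ e => e, fun _ _ _ _ e => e⟩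

theorem Local.LE.trans {L L' L'' : Local n h F} (h1 : L.LE L') (h2 : L'.LE L'') : L.LE L'' :=
  ⟨h2.me.trans h1.me, h2.a.trans h1.a, h2.b.trans h1.b, fun _ _ e => h2.aba _ _ (h1.aba _ _ e),
    fun _ _ e => h2.vss _ _ (h1.vss _ _ e), fun _ _ _ _ e => h2.msg _ _ _ _ (h1.msg _ _ _ _ e)⟩

/-- Monotonicity is proved for one share index because it serves two purposes: the passage to a
later state of the same party, and the passage from a party to the global record, which agrees with
the party only on shares of its own groups. -/
theorem Local.LE.shareLE {L L' : Local n h F} (hL : L.LE L') (q : Fin h) : L.ShareLE q L' :=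
  ⟨hL.aba, fun sid w e => ⟨w, hL.vss sid w e, rfl⟩⟩

variable (G : Setup n h)

/-- All optimistic multiplications of the iteration are completed. -/
def Local.Complete (L : Local n h F) (iter : ℕ) : Prop := ∀ z, (L.opt G iter z).summands = ∅

variable {G} {L L' : Local n h F} {iter : ℕ} {z : Fin h} {q : Fin h}

theorem Local.AbaLE.complete (hL : L.AbaLE L') (hc : L.Complete G iter) : L'.Complete G iter :=
  fun z => by rw [hL.opt_of_empty G (hc z)]; exact hc z

theorem Local.AbaLE.sel_eq (hL : L.AbaLE L') (hc : L.Complete G iter) :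
    L'.sel G iter z = L.sel G iter z := by
  rw [Local.sel, Local.sel, hL.opt_of_empty G (hc z)]

theorem Local.AbaLE.summ_eq (hL : L.AbaLE L') (hc : L.Complete G iter) (j : Fin n) :
    L'.summ G iter z j = L.summ G iter z j := by
  rw [Local.summ, Local.summ, hL.opt_of_empty G (hc z)]

variable [Field F]

theorem Local.ShareLE.sumShare (hL : L.ShareLE q L') (hc : (L.opt G iter z).summands = ∅)
    {j : Fin n} {v : F} (hv : L.sumShare G iter z j q = some v) :
    L'.sumShare G iter z j q = some v := by
  unfold Local.sumShare at hv ⊢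
  rw [hL.aba.opt_of_empty G hc]
  cases hm : (L.opt G iter z).hopOf j with
  | none => simpa [hm] using hv
  | some m =>
    simp only [hm, Option.map_eq_some_iff] at hv ⊢
    obtain ⟨w, hw, rfl⟩ := hv
    exact hL.vss _ _ hw

theorem Local.ShareLE.prodShare (hL : L.ShareLE q L') {v : F}
    (hv : L.prodShare G iter z q = some v) : L'.prodShare G iter z q = some v := by
  unfold Local.prodShare at hv ⊢
  split_ifs at hv with hc
  rw [hL.aba.opt_of_empty G hc, if_pos hc]
  exact optSum_mono (fun j _ v hv => hL.sumShare hc hv) hv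

theorem Local.ShareLE.diffIn (hL : L.ShareLE q L') {v : F}
    (hv : L.diffIn G iter z q = some v) : L'.diffIn G iter z q = some v :=
  map₂_mono (fun _ => hL.prodShare) (fun _ => hL.prodShare) hv

omit [Field F] in
theorem Local.ShareLE.partShare (hL : L.ShareLE q L') {j k : Fin n} {v : F}
    (hv : L.partShare iter z j k q = some v) : L'.partShare iter z j k q = some v := by
  unfold Local.partShare at hv ⊢
  simp only [Option.map_eq_some_iff] at hv ⊢
  obtain ⟨w, hw, rfl⟩ := hv
  exact hL.vss _ _ hw

theorem Local.ShareLE.checkIn (hL : L.ShareLE q L') (hc : L.Complete G iter) {z₀ : Fin h}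
    {j : Fin n} {v : F} (hv : L.checkIn G iter z₀ z j q = some v) :
    L'.checkIn G iter z₀ z j q = some v := by
  refine map₂_mono (fun _ => hL.sumShare (hc z)) (fun w hw => ?_) hv
  rw [hL.aba.sel_eq hc]
  exact optSum_mono (fun k _ v hv => hL.partShare hv) hw

theorem Local.ShareLE.pairIn (hL : L.ShareLE q L') {j k : Fin n} {v : F}
    (hv : L.pairIn G iter z j k q = some v) : L'.pairIn G iter z j k q = some v :=
  map₂_mono (fun _ => hL.partShare) (fun _ => hL.partShare) hv

variable [DecidableEq F]

omit [Field F] in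
theorem Local.recShare_of_mem {r : RecId n h} {own : Fin h → Option F} (hq : L.me ∈ G.S q) :
    L.recShare G r own q = own q := by
  rw [Local.recShare, if_pos hq]

omit [Field F] in
theorem Local.recShare_of_notMem (hQ : QCond 4 Finset.univ G.Z) {r : RecId n h}
    {own : Fin h → Option F} (hq : L.me ∉ G.S q) {v : F} : L.recShare G r own q = some v ↔
      G.Admissible (G.S q \ (G.S q).filter fun j => L.msg r q j = some v) := by
  have huniq : ∀ v v' : F,
      G.Admissible (G.S q \ (G.S q).filter fun j => L.msg r q j = some v) →
      G.Admissible (G.S q \ (G.S q).filter fun j => L.msg r q j = some v') → v = v' := by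
    rintro v v' ⟨z, hz⟩ ⟨z', hz'⟩
    -- Uniqueness of the accepted value: some member of the group lies outside both exceptional
    -- sets, so its single recorded message equals both values.
    obtain ⟨i, h1, h2, h3, -⟩ := hQ.exists_notMem q z z' q
    have key : ∀ (z : Fin h) (v : F), i ∉ G.Z z →
        G.S q \ ((G.S q).filter fun j => L.msg r q j = some v) ⊆ G.Z z →
        L.msg r q i = some v := fun z v hi hz => by
      by_contra hne
      exact hi (hz (by simp [Setup.mem_S, h1, hne]))
    have := (key z v h2 hz).symm.trans (key z' v' h3 hz')
    exact Option.some_injective _ this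
  rw [Local.recShare, if_neg hq]
  split_ifs with hv
  · have hc := hv.choose_spec
    constructor
    · intro e
      rw [← Option.some_injective _ e]
      convert hc
    · intro hv'
      exact congrArg some (huniq _ _ (by convert hc) hv')
  · simp only [false_iff]
    intro hv'
    exact hv ⟨v, by convert hv'⟩

omit [Field F] in
theorem Local.LE.recShare (hL : L.LE L') (hQ : QCond 4 Finset.univ G.Z) {r : RecId n h}
    {own own' : Fin h → Option F}
    (hown : L.me ∈ G.S q → ∀ v, own q = some v → own' q = some v) {v : F}
    (hv : L.recShare G r own q = some v) : L'.recShare G r own' q = some v := by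
  by_cases hq : L.me ∈ G.S q
  · rw [Local.recShare_of_mem hq] at hv
    rw [Local.recShare_of_mem (by rwa [hL.me])]
    exact hown hq v hv
  · rw [Local.recShare_of_notMem hQ hq] at hv
    rw [Local.recShare_of_notMem hQ (by rwa [hL.me])]
    obtain ⟨z, hz⟩ := hv
    refine ⟨z, subset_trans (Finset.sdiff_subset_sdiff subset_rfl fun j hj => ?_) hz⟩
    rw [Finset.mem_filter] at hj ⊢
    exact ⟨hj.1, hL.msg _ _ _ _ hj.2⟩

theorem Local.LE.recValue (hL : L.LE L') (hQ : QCond 4 Finset.univ G.Z) {r : RecId n h}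
    {own own' : Fin h → Option F}
    (hown : ∀ q, L.me ∈ G.S q → ∀ v, own q = some v → own' q = some v) {v : F}
    (hv : L.recValue G r own = some v) : L'.recValue G r own' = some v :=
  optSum_mono (fun q _ _ => hL.recShare hQ (hown q)) hv

theorem Local.LE.diffVal (hL : L.LE L') (hQ : QCond 4 Finset.univ G.Z) {v : F}
    (hv : L.diffVal G iter z = some v) : L'.diffVal G iter z = some v :=
  hL.recValue hQ (fun q _ _ => (hL.shareLE q).diffIn) hv

theorem Local.verdict_isSome : (L.verdict G iter).isSome ↔
    L.Complete G iter ∧ ∀ z, (L.diffVal G iter z).isSome := by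
  unfold Local.verdict Local.Complete
  rw [← forall_and]
  split_ifs with hc
  · simpa using hc
  · simpa using hc

theorem Local.verdict_eq_of_isSome (hs : (L.verdict G iter).isSome) :
    L.verdict G iter =
      some ((List.finRange h).find? fun z => decide (L.diffVal G iter z ≠ some 0)) := by
  unfold Local.verdict at hs ⊢
  split_ifs at hs ⊢
  · rfl
  · simp at hs

theorem Local.verdict_congr (hs : (L.verdict G iter).isSome) (hs' : (L'.verdict G iter).isSome)
    (he : ∀ z, L'.diffVal G iter z = L.diffVal G iter z) :
    L'.verdict G iter = L.verdict G iter := by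
  rw [Local.verdict_eq_of_isSome hs, Local.verdict_eq_of_isSome hs']
  simp only [he]

/-- A verdict exists only when every difference is known, so later messages cannot alter any value
from which it was computed. -/
theorem Local.LE.verdict (hL : L.LE L') (hQ : QCond 4 Finset.univ G.Z) {x : Option (Fin h)}
    (hx : L.verdict G iter = some x) : L'.verdict G iter = some x := by
  have hs : (L.verdict G iter).isSome := by simp [hx]
  obtain ⟨hc, hd⟩ := Local.verdict_isSome.1 hs
  have he : ∀ z, L'.diffVal G iter z = L.diffVal G iter z := fun z => by
    obtain ⟨v, hv⟩ := Option.isSome_iff_exists.1 (hd z)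
    rw [hL.diffVal hQ hv, hv]
  rw [← hx]
  refine Local.verdict_congr hs (Local.verdict_isSome.2 ⟨hL.aba.complete hc, fun z => ?_⟩) he
  rw [he]; exact hd z

theorem Local.Conflict.complete {z₀ : Fin h} (hz : L.Conflict G iter z₀) : L.Complete G iter :=
  (Local.verdict_isSome.1 (by rw [show L.verdict G iter = some (some z₀) from hz]; rfl)).1

theorem Local.Conflict.unique {z₀ z₁ : Fin h} (h0 : L.Conflict G iter z₀)
    (h1 : L.Conflict G iter z₁) : z₀ = z₁ := by
  have := h0.symm.trans h1
  simpa using this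

theorem Local.LE.conflict (hL : L.LE L') (hQ : QCond 4 Finset.univ G.Z) {z₀ : Fin h}
    (hz : L.Conflict G iter z₀) : L'.Conflict G iter z₀ := hL.verdict hQ hz

theorem Local.LE.reached (hL : L.LE L') (hQ : QCond 4 Finset.univ G.Z)
    (hr : L.Reached G iter) : L'.Reached G iter := by
  refine ⟨hr.1, fun r h1 h2 => ?_⟩
  obtain ⟨⟨z, hz⟩, hw⟩ := hr.2 r h1 h2
  refine ⟨⟨z, hL.conflict hQ hz⟩, fun hb => ?_⟩
  obtain ⟨j, hj⟩ := Option.isSome_iff_exists.1 (hw hb)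
  rw [hL.aba.winner hj]; rfl

/-- Having reached the iteration includes knowing the outcome of every earlier discarding, so the
set is already final. -/
theorem Local.AbaLE.GD_eq (hL : L.AbaLE L') (hr : L.Reached G iter) :
    L'.GD G iter = L.GD G iter := by
  ext j
  constructor
  · rintro ⟨r, h1, h2, h3, h4⟩
    refine ⟨r, h1, h2, h3, ?_⟩
    obtain ⟨k, hk⟩ := Option.isSome_iff_exists.1 ((hr.2 r h1 h2).2 h3)
    rw [hk, ← hL.winner hk, h4]
  · rintro ⟨r, h1, h2, h3, h4⟩
    exact ⟨r, h1, h2, h3, hL.winner h4⟩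

theorem Local.LE.checkVal (hL : L.LE L') (hQ : QCond 4 Finset.univ G.Z)
    (hc : L.Complete G iter) {z₀ : Fin h} {j : Fin n} {v : F}
    (hv : L.checkVal G iter z₀ z j = some v) : L'.checkVal G iter z₀ z j = some v :=
  hL.recValue hQ (fun q _ _ => (hL.shareLE q).checkIn hc) hv

theorem Local.LE.pairVal (hL : L.LE L') (hQ : QCond 4 Finset.univ G.Z)
    {j k : Fin n} {v : F}
    (hv : L.pairVal G iter z j k = some v) : L'.pairVal G iter z j k = some v :=
  hL.recValue hQ (fun q _ _ => (hL.shareLE q).pairIn) hv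

theorem Local.LE.partVal (hL : L.LE L') (hQ : QCond 4 Finset.univ G.Z)
    {j k : Fin n} {v : F}
    (hv : L.partVal G iter z j k = some v) : L'.partVal G iter z j k = some v :=
  hL.recValue hQ (fun q _ _ => (hL.shareLE q).partShare) hv

omit [Field F] [DecidableEq F] in
theorem Local.LE.common_eq (hL : L.LE L') (hc : L.Complete G iter) (j k : Fin n) :
    L'.common G iter z j k = L.common G iter z j k := by
  rw [Local.common, Local.common, hL.aba.summ_eq hc, hL.aba.summ_eq hc]

theorem Local.LE.commonVal (hL : L.LE L') (hQ : QCond 4 Finset.univ G.Z)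
    (hc : L.Complete G iter) {j k : Fin n} {v : F}
    (hv : L.commonVal G iter z j k = some v) : L'.commonVal G iter z j k = some v := by
  unfold Local.commonVal at hv ⊢
  rw [hL.common_eq hc]
  refine optSum_mono (fun pq _ v hv => map₂_mono (fun v hv => ?_) (fun v hv => ?_) hv) hv
  · exact hL.recShare hQ (fun _ v hv => by rw [hL.a]; exact hv) hv
  · exact hL.recShare hQ (fun _ v hv => by rw [hL.b]; exact hv) hv

theorem Local.LE.mismatch (hL : L.LE L') (hQ : QCond 4 Finset.univ G.Z)
    (hc : L.Complete G iter) {j k : Fin n} (hm : L.Mismatch G iter z j k) :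
    L'.Mismatch G iter z j k := by
  obtain ⟨hj, hk, v, hv, h0⟩ := hm
  refine ⟨?_, ?_, v, hL.pairVal hQ hv, h0⟩
  · rwa [hL.aba.sel_eq hc]
  · rwa [hL.aba.sel_eq hc]

theorem Local.LE.LD_subset (hL : L.LE L') (hQ : QCond 4 Finset.univ G.Z) :
    L.LD G iter ⊆ L'.LD G iter := by
  rintro j ⟨z₀, hz, hj⟩
  have hc := hz.complete
  refine ⟨z₀, hL.conflict hQ hz, ?_⟩
  rcases hj with ⟨z, h1, h2, v, h3, h4⟩ | ⟨k, hm, d, s, hd, hs, hne⟩ | ⟨k, hm, d, s, hd, hs, hne⟩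
  · exact Or.inl ⟨z, h1, by rwa [hL.aba.sel_eq hc], v, hL.checkVal hQ hc h3, h4⟩
  · exact Or.inr <| Or.inl
      ⟨k, hL.mismatch hQ hc hm, d, s, hL.partVal hQ hd, hL.commonVal hQ hc hs, hne⟩
  · exact Or.inr <| Or.inr
      ⟨k, hL.mismatch hQ hc hm, d, s, hL.partVal hQ hd, hL.commonVal hQ hc hs, hne⟩

/-- Once the conflict is fixed, further deliveries can only shorten the wait-list. An honest vote
for an unlisted party therefore remains valid evidence that its parts have arrived. -/
theorem Local.LE.W_subset (hL : L.LE L') (hQ : QCond 4 Finset.univ G.Z) {z₀ : Fin h}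
    (hz : L.Conflict G iter z₀) : L'.W G iter ⊆ L.W G iter := by
  rintro j ⟨z₁, hz₁, z, h1, h2, k, hk, hn⟩
  obtain rfl := (hL.conflict hQ hz).unique hz₁
  have hc := hz.complete
  rw [hL.aba.sel_eq hc] at h2 hk
  refine ⟨z₀, hz, z, h1, h2, k, hk, ?_⟩
  by_contra hne
  obtain ⟨w, hw⟩ := Option.ne_none_iff_exists'.1 hne
  rw [hL.vss _ _ hw] at hn
  simp at hn

theorem Local.LE.contributes (hL : L.LE L') (hQ : QCond 4 Finset.univ G.Z) {v : F}
    {r : RecId n h} (hr : L.Contributes G q v r) : L'.Contributes G q v r := by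
  cases r with
  | diff iter z => exact ⟨hL.reached hQ hr.1, (hL.shareLE q).diffIn hr.2⟩
  | check iter z j =>
    obtain ⟨h1, z₀, h2, h3, h4, h5⟩ := hr
    have hc := h2.complete
    exact ⟨hL.reached hQ h1, z₀, hL.conflict hQ h2, h3, by rwa [hL.aba.sel_eq hc],
      (hL.shareLE q).checkIn hc h5⟩
  | pair iter j k =>
    obtain ⟨h1, z₀, h2, h3, h4, h5⟩ := hr
    have hc := h2.complete
    exact ⟨hL.reached hQ h1, z₀, hL.conflict hQ h2, by rwa [hL.aba.sel_eq hc],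
      by rwa [hL.aba.sel_eq hc], (hL.shareLE q).pairIn h5⟩
  | part iter z j k =>
    obtain ⟨h1, z₀, h2, h3, h4⟩ := hr
    have hc := h2.complete
    exact ⟨hL.reached hQ h1, z₀, hL.conflict hQ h2,
      h3.imp (fun h3 => ⟨h3.1, hL.mismatch hQ hc h3.2⟩) (fun h3 => ⟨h3.1, hL.mismatch hQ hc h3.2⟩),
      (hL.shareLE q).partShare h4⟩
  | inputA iter j k =>
    obtain ⟨h1, z₀, h2, h3, h4, h5⟩ := hr
    have hc := h2.complete
    exact ⟨hL.reached hQ h1, z₀, hL.conflict hQ h2, hL.mismatch hQ hc h3,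
      by rwa [hL.common_eq hc], by rw [hL.a]; exact h5⟩
  | inputB iter j k =>
    obtain ⟨h1, z₀, h2, h3, h4, h5⟩ := hr
    have hc := h2.complete
    exact ⟨hL.reached hQ h1, z₀, hL.conflict hQ h2, hL.mismatch hQ hc h3,
      by rwa [hL.common_eq hc], by rw [hL.b]; exact h5⟩

theorem Local.requestsAba_select {hop : ℕ} {j : Fin n} :
    L.RequestsAba G (.select iter z hop j) ↔ L.Reached G iter ∧ L.Visits G iter z hop := by
  simp only [Local.RequestsAba, Local.InHop, Local.visits_iff]
  tauto

theorem Local.requestsVss_sum {hop : ℕ} {j : Fin n} :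
    L.RequestsVss G (.sum iter z hop j) ↔ L.Reached G iter ∧ L.Visits G iter z hop := by
  simp only [Local.RequestsVss, Local.InHop, Local.visits_iff]
  tauto

theorem Local.LE.requestsAba (hL : L.LE L') (hQ : QCond 4 Finset.univ G.Z) {sid : AbaId n h}
    (hr : L.RequestsAba G sid) : L'.RequestsAba G sid := by
  cases sid with
  | select iter z hop j =>
    rw [Local.requestsAba_select] at hr ⊢
    exact ⟨hL.reached hQ hr.1, hL.aba.visits G hr.2⟩
  | discard iter j =>
    obtain ⟨h1, h2, z, h3⟩ := hr
    exact ⟨hL.reached hQ h1, h2, z, hL.conflict hQ h3⟩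

theorem Local.LE.requestsVss (hL : L.LE L') (hQ : QCond 4 Finset.univ G.Z) {sid : VssId n h}
    (hr : L.RequestsVss G sid) : L'.RequestsVss G sid := by
  cases sid with
  | sum iter z hop j =>
    rw [Local.requestsVss_sum] at hr ⊢
    exact ⟨hL.reached hQ hr.1, hL.aba.visits G hr.2⟩
  | part iter z j k =>
    obtain ⟨h1, z₀, h2, h3, h4, h5⟩ := hr
    have hc := h2.complete
    exact ⟨hL.reached hQ h1, z₀, hL.conflict hQ h2, h3, by rwa [hL.aba.sel_eq hc],
      by rwa [hL.aba.sel_eq hc]⟩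

variable (G L) in
/-- The summands whose sum an honest dealer shares. -/
noncomputable def Local.pairs : VssId n h → Finset (Fin h × Fin h)
  | .sum iter z hop j => (L.optAt G iter z hop).own j
  | .part iter z j k => match L.verdict G iter with
    | some (some z₀) => L.summ G iter z j ∩ L.summ G iter (G.opp iter z₀ z) k
    | _ => ∅

theorem Local.Conflict.pairs_part {z₀ : Fin h} (hz : L.Conflict G iter z₀) (j k : Fin n) :
    L.pairs G (.part iter z j k) =
      L.summ G iter z j ∩ L.summ G iter (G.opp iter z₀ z) k := by
  have : L.verdict G iter = some (some z₀) := hz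
  simp [Local.pairs, this]

/-- A request presupposes that the hop, or the conflict, to which the instance refers is already
determined, and with it the assigned pairs. -/
theorem Local.LE.pairs_eq (hL : L.LE L') (hQ : QCond 4 Finset.univ G.Z) {sid : VssId n h}
    (hr : L.RequestsVss G sid) : L'.pairs G sid = L.pairs G sid := by
  cases sid with
  | sum iter z hop j =>
    rw [Local.requestsVss_sum] at hr
    simp only [Local.pairs, hL.aba.optAt_of_hop G hr.2.2.1]
  | part iter z j k =>
    obtain ⟨h1, z₀, h2, -⟩ := hr
    have hc := h2.complete
    rw [h2.pairs_part, (hL.conflict hQ h2).pairs_part, hL.aba.summ_eq hc, hL.aba.summ_eq hc]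

theorem Local.mem_S_of_pairs {sid : VssId n h} {pq : Fin h × Fin h} (hp : pq ∈ L.pairs G sid) :
    sid.dealer ∈ G.S pq.1 ∧ sid.dealer ∈ G.S pq.2 := by
  cases sid with
  | sum iter z hop j => exact Local.mem_S_of_own G hp
  | part iter z j k =>
    simp only [Local.pairs] at hp
    split at hp
    · exact Local.mem_S_of_own G (Finset.mem_inter.1 hp).1
    · simp at hp

theorem Local.Deals.requests {c : F} {sid : VssId n h} (hd : L.Deals G c sid) :
    sid.dealer = L.me ∧ L.RequestsVss G sid ∧
      c = ∑ pq ∈ L.pairs G sid, L.a pq.1 * L.b pq.2 := by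
  cases sid with
  | sum iter z hop j =>
    obtain ⟨h1, h2, h3, h4, h5⟩ := hd
    refine ⟨h1, ⟨h2.1, Or.inr h2⟩, h5.trans ?_⟩
    have := Local.optAt_hop_self G (L := L) (iter := iter) (z := z) (m := n)
    rw [← Local.opt_eq_optAt, h2.2.1] at this
    simp only [Local.pairs, this, Local.summ]
  | part iter z j k =>
    obtain ⟨h1, h2, z₀, h3, h4, h5, h6, h7⟩ := hd
    refine ⟨h1, ⟨h2, z₀, h3, h4, h5, h6⟩, ?_⟩
    rw [h7, h3.pairs_part]

variable (G L) in
/-- What remains true after a vote. -/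
def Local.Votes : AbaId n h → Bool → Prop
  | .select iter z hop j, true => (L.Reached G iter ∧ L.Visits G iter z hop) ∧
      j ∉ L.GD G iter ∧ j ∉ G.Z z ∧ j ∉ (L.optAt G iter z hop).selected ∧
      (∀ r, 1 ≤ r → r < iter → j ∉ L.W G r) ∧ L.vss (.sum iter z hop j) ≠ none
  | .select iter z hop _, false => (L.Reached G iter ∧ L.Visits G iter z hop) ∧
      ∃ k, L.aba (.select iter z hop k) = some true
  | .discard iter j, true => L.InDiscard G iter ∧
      (∃ r, 1 ≤ r ∧ r ≤ iter ∧ j ∈ L.LD G r) ∧ j ∉ L.GD G iter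
  | .discard iter _, false => L.InDiscard G iter ∧ ∃ k, L.aba (.discard iter k) = some true

theorem Local.InHop.visits {hop : ℕ} (hi : L.InHop G iter z hop) : L.Visits G iter z hop :=
  (Local.visits_iff G).2 (Or.inr hi.2)

theorem Local.InHop.optAt_eq {hop : ℕ} (hi : L.InHop G iter z hop) :
    L.optAt G iter z hop = L.opt G iter z := by
  have := Local.optAt_hop_self G (L := L) (iter := iter) (z := z) (m := n)
  rwa [← Local.opt_eq_optAt, hi.2.1] at this

/-- Conditions that later events can falsify are weakened or dropped: being in a hop becomes having
started it, the selected parties are those at its start, and absence from `LD` and of a winner are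
forgotten. -/
theorem Local.MayVote.votes {sid : AbaId n h} {b : Bool} (hv : L.MayVote G sid b) :
    L.Votes G sid b := by
  cases sid with
  | select iter z hop j =>
    cases b with
    | true =>
      obtain ⟨h1, h2, h3, h4, h5, h6⟩ := hv
      exact ⟨⟨h1.1, h1.visits⟩, h2, h3, by rw [h1.optAt_eq]; exact h4,
        fun r hr hr' => (h5 r hr hr').1, h6⟩
    | false => exact ⟨⟨hv.1.1, hv.1.visits⟩, hv.2⟩
  | discard iter j =>
    cases b with
    | true => exact ⟨hv.1, hv.2.2⟩
    | false => exact ⟨hv.1, hv.2.2⟩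

theorem Local.Votes.requests {sid : AbaId n h} {b : Bool} (hv : L.Votes G sid b) :
    L.RequestsAba G sid := by
  cases sid with
  | select iter z hop j => cases b <;> exact Local.requestsAba_select.2 hv.1
  | discard iter j => cases b <;> exact hv.1

theorem Local.LE.votes (hL : L.LE L') (hQ : QCond 4 Finset.univ G.Z) {sid : AbaId n h} {b : Bool}
    (hv : L.Votes G sid b) : L'.Votes G sid b := by
  have hr := hL.requestsAba hQ hv.requests
  cases sid with
  | select iter z hop j =>
    rw [Local.requestsAba_select] at hr
    cases b with
    | true =>
      obtain ⟨h1, h2, h3, h4, h5, h6⟩ := hv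
      refine ⟨hr, by rwa [hL.aba.GD_eq h1.1], h3, by rwa [hL.aba.optAt_of_hop G h1.2.2.1],
        fun r hr hr' hj => ?_, ?_⟩
      · obtain ⟨z₀, hz⟩ := (h1.1.2 r hr hr').1
        exact h5 r hr hr' (hL.W_subset hQ hz hj)
      · obtain ⟨w, hw⟩ := Option.ne_none_iff_exists'.1 h6
        simp [hL.vss _ _ hw]
    | false =>
      obtain ⟨h1, k, hk⟩ := hv
      exact ⟨hr, k, hL.aba _ _ hk⟩
  | discard iter j =>
    cases b with
    | true =>
      obtain ⟨h1, ⟨r, h2, h3, h4⟩, h5⟩ := hv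
      exact ⟨hr, ⟨r, h2, h3, hL.LD_subset hQ h4⟩, by rwa [hL.aba.GD_eq h1.1]⟩
    | false =>
      obtain ⟨h1, k, hk⟩ := hv
      exact ⟨hr, k, hL.aba _ _ hk⟩

end Mono

/-! ### Steps of an execution -/

section Steps
variable {n h : ℕ} {F : Type*} [Field F] [DecidableEq F] (G : Setup n h) (K : Finset (Fin n))

/-- The possible changes of the state in one step. -/
inductive Step (st : State n h F) : State n h F → Prop
  | stay : Step st st
  | deal (i : Fin n) (sid : VssId n h) (v : Fin h → F) (hi : i ∉ K) (hs : st.vss sid = none)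
      (hd : (st.loc i).Deals G (∑ q, v q) sid) :
      Step st { st with vss := Function.update st.vss sid (some v) }
  | vote (i : Fin n) (sid : AbaId n h) (b : Bool) (hi : i ∉ K)
      (hv : (st.loc i).voted sid = false) (hm : (st.loc i).MayVote G sid b) :
      Step st
        { st.setLoc i { st.loc i with voted := Function.update (st.loc i).voted sid true } with
          aba := Function.update st.aba sid ((st.aba sid).addVote K i b) }
  | send (i : Fin n) (r : RecId n h) (q : Fin h) (v : F) (hi : i ∉ K) (hq : i ∈ G.S q)
      (hs : st.sent i r q = none) (hv : (st.loc i).Contributes G q v r) :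
      Step st { st with sent := fun i' r' q' =>
                if i' = i ∧ r' = r ∧ q' = q then some v else st.sent i' r' q' }
  | vssOut (i : Fin n) (sid : VssId n h) (v : Fin h → F) (hi : i ∉ K)
      (hv : st.vss sid = some v) (hl : (st.loc i).vss sid = none) :
      Step st (st.setLoc i { st.loc i with
        vss := Function.update (st.loc i).vss sid (some fun q => if i ∈ G.S q then v q else 0) })
  | abaOut (i : Fin n) (sid : AbaId n h) (b : Bool) (hi : i ∉ K)
      (hb : (st.aba sid).out = some b) (hl : (st.loc i).aba sid = none) :
      Step st (st.setLoc i { st.loc i with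
        aba := Function.update (st.loc i).aba sid (some b) })
  | msg (i j : Fin n) (r : RecId n h) (q : Fin h) (v : F) (hi : i ∉ K)
      (hl : (st.loc i).msg r q j = none) (hj : j ∉ K → st.sent j r q = some v) :
      Step st (st.setMsg i r q j (some v))
  | advDeal (sid : VssId n h) (v : Fin h → F) (hs : st.vss sid = none) (hd : sid.dealer ∈ K) :
      Step st { st with vss := Function.update st.vss sid (some v) }
  | advVote (j : Fin n) (sid : AbaId n h) (b : Bool) (hj : j ∈ K) :
      Step st { st with aba := Function.update st.aba sid ((st.aba sid).addVote K j b) }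
  | advCore (sid : AbaId n h) (C : Finset (Fin n)) (tie : Bool) (hC : G.Admissible Cᶜ) :
      Step st { st with aba := Function.update st.aba sid ((st.aba sid).addCore K C tie) }

variable {G K}

theorem mem_support_pure_fst {α β : Type*} {x y : α} {o p : β}
    (hs : (x, o) ∈ (PMF.pure (y, p)).support) : x = y := by
  rw [PMF.support_pure, Set.mem_singleton_iff, Prod.mk.injEq] at hs
  exact hs.1

/-- Correctness, termination and costs depend only on which transitions are possible, so
probabilities and observations are discarded here; a random sharing becomes an arbitrary one with
the right sum. -/
theorem Step.of_support [Fintype F] [NeZero h] {st st' : State n h F} {x : Action n h F}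
    {o : Obs h F} (hs : (st', o) ∈ (exec G K st x).support) : Step G K st st' := by
  unfold exec at hs
  split_ifs at hs with he
  swap
  · rw [mem_support_pure_fst hs]; exact .stay
  cases x with
  | deal i sid =>
    obtain ⟨h1, h2, h3⟩ := he
    simp only [h3, dite_true] at hs
    rw [PMF.support_map] at hs
    obtain ⟨v, hv, e⟩ := hs
    rw [PMF.mem_support_uniformOfFinset_iff] at hv
    obtain rfl := congrArg Prod.fst e
    refine .deal i sid v h1 h2 ?_
    rw [(Finset.mem_filter.1 hv).2]
    exact h3.choose_spec
  | vote i sid b => rw [mem_support_pure_fst hs]; exact .vote i sid b he.1 he.2.1 he.2.2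
  | send i r q =>
    obtain ⟨h1, h2, h3, h4⟩ := he
    simp only [h4, dite_true] at hs
    rw [mem_support_pure_fst hs]
    exact .send i r q _ h1 h2 h3 h4.choose_spec
  | vssOut i sid =>
    obtain ⟨h1, h2, h3, h4⟩ := he
    obtain ⟨v, hv⟩ := Option.isSome_iff_exists.1 h2
    rw [mem_support_pure_fst hs, hv]
    exact .vssOut i sid v h1 hv h3
  | abaOut i sid =>
    obtain ⟨h1, h2, h3, h4⟩ := he
    obtain ⟨b, hb⟩ := Option.isSome_iff_exists.1 h2
    rw [mem_support_pure_fst hs, hb]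
    exact .abaOut i sid b h1 hb h3
  | deliver j i r q =>
    obtain ⟨h1, h2, h3, h4, h5, h6⟩ := he
    obtain ⟨v, hv⟩ := Option.isSome_iff_exists.1 h5
    rw [mem_support_pure_fst hs, hv]
    exact .msg i j r q v h2 h6 fun _ => hv
  | advDeal sid v => rw [mem_support_pure_fst hs]; exact .advDeal sid v he.2 he.1
  | advVote j sid b => rw [mem_support_pure_fst hs]; exact .advVote j sid b he
  | advCore sid C tie => rw [mem_support_pure_fst hs]; exact .advCore sid C tie he
  | advSend j i r q v =>
    obtain ⟨h1, h2, h3, h4, h5⟩ := he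
    rw [mem_support_pure_fst hs]
    exact .msg i j r q v h2 h5 fun hj => absurd h1 hj

/-! #### The ABA functionality -/

namespace AbaState
variable {x : AbaState n}

theorem settle_cases (x : AbaState n) : x.settle K = x ∨ ∃ C tie, x.out = none ∧
    x.core = some (C, tie) ∧ (∀ i ∈ C, (x.vote i).isSome) ∧
    x.settle K = { x with out := some (x.decision K C tie) } := by
  unfold settle
  split
  · split_ifs with hC
    · rename_i C tie h1 h2
      exact Or.inr ⟨C, tie, h1, h2, hC, rfl⟩
    · exact Or.inl rfl
  · exact Or.inl rfl

/-- The adversary cannot produce a bit without honest support: if the honest members of the core are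
not unanimous, then both bits occur among their votes. -/
theorem decision_eq {C : Finset (Fin n)} {tie : Bool} (hC : (C \ K).Nonempty)
    (hv : ∀ i ∈ C, (x.vote i).isSome) :
    ∃ i ∈ C \ K, x.vote i = some (x.decision K C tie) := by
  unfold decision
  split_ifs with h1 h2
  · obtain ⟨i, hi⟩ := hC
    exact ⟨i, hi, h1 i hi⟩
  · obtain ⟨i, hi⟩ := hC
    exact ⟨i, hi, h2 i hi⟩
  · push Not at h1 h2
    obtain ⟨i, hi, hi'⟩ := h1
    obtain ⟨j, hj, hj'⟩ := h2
    have ei : x.vote i = some false := by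
      obtain ⟨b, hb⟩ := Option.isSome_iff_exists.1 (hv i (Finset.mem_sdiff.1 hi).1)
      cases b <;> simp_all
    have ej : x.vote j = some true := by
      obtain ⟨b, hb⟩ := Option.isSome_iff_exists.1 (hv j (Finset.mem_sdiff.1 hj).1)
      cases b <;> simp_all
    have hb : ∀ b : Bool, ∃ k ∈ C \ K, x.vote k = some b
      | false => ⟨i, hi, ei⟩
      | true => ⟨j, hj, ej⟩
    exact hb _

end AbaState

/-- Everything received and sent so far is kept. -/
structure State.LE (st st' : State n h F) : Prop where
  loc : ∀ i, (st.loc i).LE (st'.loc i)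
  vss : ∀ sid v, st.vss sid = some v → st'.vss sid = some v
  out : ∀ sid b, (st.aba sid).out = some b → (st'.aba sid).out = some b
  sent : ∀ i r q v, st.sent i r q = some v → st'.sent i r q = some v
  voted : ∀ i sid, (st.loc i).voted sid = true → (st'.loc i).voted sid = true

omit [Field F] [DecidableEq F] in
theorem State.LE.refl (st : State n h F) : st.LE st :=
  ⟨fun _ => .refl _, fun _ _ e => e, fun _ _ e => e, fun _ _ _ _ e => e, fun _ _ e => e⟩

omit [Field F] [DecidableEq F] in
theorem State.LE.trans {st st' st'' : State n h F} (h1 : st.LE st') (h2 : st'.LE st'') :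
    st.LE st'' :=
  ⟨fun i => (h1.loc i).trans (h2.loc i), fun _ _ e => h2.vss _ _ (h1.vss _ _ e),
    fun _ _ e => h2.out _ _ (h1.out _ _ e), fun _ _ _ _ e => h2.sent _ _ _ _ (h1.sent _ _ _ _ e),
    fun _ _ e => h2.voted _ _ (h1.voted _ _ e)⟩

omit [Field F] [DecidableEq F] in
theorem State.setLoc_LE {st : State n h F} {i : Fin n} {L : Local n h F} (hL : (st.loc i).LE L)
    (j : Fin n) : (st.loc j).LE ((st.setLoc i L).loc j) := by
  by_cases hj : j = i
  · subst hj; simpa [State.setLoc] using hL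
  · simpa [State.setLoc, hj] using Local.LE.refl _

theorem AbaState.addVote_out {x : AbaState n} {i : Fin n} {b b' : Bool} (hb : x.out = some b') :
    (x.addVote K i b).out = some b' := by
  simp [AbaState.addVote, hb]

theorem AbaState.addCore_out {x : AbaState n} {C : Finset (Fin n)} {b b' : Bool}
    (hb : x.out = some b') : (x.addCore K C b).out = some b' := by
  simp [AbaState.addCore, hb]

theorem update_out {aba : AbaId n h → AbaState n} {sid : AbaId n h} {y : AbaState n}
    (hy : ∀ b, (aba sid).out = some b → y.out = some b) (sid' : AbaId n h) (b : Bool)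
    (hb : (aba sid').out = some b) : (Function.update aba sid y sid').out = some b := by
  by_cases hs : sid' = sid
  · subst hs; simpa using hy b hb
  · simpa [hs] using hb

theorem update_some {α β : Type*} [DecidableEq α] {f : α → Option β} {x : α} {y : β}
    (hx : f x = none) (x' : α) (v : β) (hv : f x' = some v) :
    Function.update f x (some y) x' = some v := by
  by_cases hs : x' = x
  · subst hs; simp [hx] at hv
  · simpa [hs] using hv

theorem Step.le {st st' : State n h F} (hs : Step G K st st') : st.LE st' := by
  cases hs with
  | stay => exact .refl _
  | deal i sid v hi hs hd =>
    exact { State.LE.refl st with vss := update_some hs }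
  | advDeal sid v hs hd =>
    exact { State.LE.refl st with vss := update_some hs }
  | vote i sid b hi hv hm =>
    refine { State.LE.refl st with loc := ?_, out := ?_, voted := ?_ }
    · exact State.setLoc_LE (L := { st.loc i with
        voted := Function.update (st.loc i).voted sid true }) { Local.LE.refl (st.loc i) with }
    · exact update_out fun b hb => AbaState.addVote_out hb
    · intro j sid' hj
      by_cases hji : j = i
      · subst hji
        by_cases hsid : sid' = sid <;> simp [State.setLoc, hsid, hj]
      · simpa [State.setLoc, hji] using hj
  | send i r q v hi hq hs hv =>
    refine { State.LE.refl st with sent := fun i' r' q' v' hv' => ?_ }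
    dsimp only
    split_ifs with hc
    · obtain ⟨rfl, rfl, rfl⟩ := hc
      rw [hs] at hv'; simp at hv'
    · exact hv'
  | vssOut i sid v hi hv hl =>
    refine { State.LE.refl st with loc := ?_, voted := ?_ }
    · exact State.setLoc_LE { Local.LE.refl (st.loc i) with vss := update_some hl }
    · intro j sid' hj
      by_cases hji : j = i
      · subst hji; simpa [State.setLoc] using hj
      · simpa [State.setLoc, hji] using hj
  | abaOut i sid b hi hb hl =>
    refine { State.LE.refl st with loc := ?_, voted := ?_ }
    · exact State.setLoc_LE { Local.LE.refl (st.loc i) with aba := update_some hl }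
    · intro j sid' hj
      by_cases hji : j = i
      · subst hji; simpa [State.setLoc] using hj
      · simpa [State.setLoc, hji] using hj
  | msg i j r q v hi hl hj =>
    refine { State.LE.refl st with loc := ?_, voted := ?_ }
    · refine State.setLoc_LE { Local.LE.refl (st.loc i) with msg := fun r' q' j' v' hv' => ?_ }
      dsimp only
      split_ifs with hc
      · obtain ⟨rfl, rfl, rfl⟩ := hc
        rw [hl] at hv'; simp at hv'
      · exact hv'
    · intro j sid' hj
      by_cases hji : j = i
      · subst hji; simpa [State.setMsg, State.setLoc] using hj
      · simpa [State.setMsg, State.setLoc, hji] using hj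
  | advVote j sid b hj =>
    exact { State.LE.refl st with out := update_out fun b hb => AbaState.addVote_out hb }
  | advCore sid C tie hC =>
    exact { State.LE.refl st with out := update_out fun b hb => AbaState.addCore_out hb }

variable (G K)

/-- The invariant of an ABA instance: `V i b` holds for every honest party `i` that has voted `b`,
and so for some honest party that has voted for the output. -/
structure AbaInv (V : Fin n → Bool → Prop) (voted : Fin n → Prop) (x : AbaState n) : Prop where
  vote : ∀ i ∉ K, ∀ b, x.vote i = some b → V i b
  out : ∀ b, x.out = some b → ∃ i ∉ K, V i b
  core : ∀ C tie, x.core = some (C, tie) → G.Admissible Cᶜ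
  voted : ∀ i ∉ K, voted i → (x.vote i).isSome ∨ x.out.isSome

variable {G K}

theorem AbaInv.mono {V V' : Fin n → Bool → Prop} {p p' : Fin n → Prop} {x : AbaState n}
    (hx : AbaInv G K V p x) (hV : ∀ i b, V i b → V' i b) (hp : ∀ i ∉ K, p' i → p i) :
    AbaInv G K V' p' x :=
  ⟨fun i hi b hb => hV i b (hx.vote i hi b hb),
    fun b hb => (hx.out b hb).imp fun i hi => ⟨hi.1, hV i b hi.2⟩, hx.core,
    fun i hi hv => hx.voted i hi (hp i hi hv)⟩

/-- The corrupt set and the complement of the core each lie in one member of the structure, and two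
members do not cover the parties. -/
theorem Setup.Admissible.sdiff_nonempty (hQ : QCond 4 Finset.univ G.Z) (hK : G.Admissible K)
    {C : Finset (Fin n)} (hC : G.Admissible Cᶜ) : (C \ K).Nonempty := by
  obtain ⟨z, hz⟩ := hK
  obtain ⟨z', hz'⟩ := hC
  obtain ⟨i, h1, h2, -⟩ := hQ.exists_notMem z z' z z
  refine ⟨i, Finset.mem_sdiff.2 ⟨?_, fun hi => h1 (hz hi)⟩⟩
  by_contra hi
  exact h2 (hz' (Finset.mem_compl.2 hi))

theorem AbaInv.settle (hQ : QCond 4 Finset.univ G.Z) (hK : G.Admissible K)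
    {V : Fin n → Bool → Prop} {p : Fin n → Prop} {x : AbaState n}
    (hx : AbaInv G K V p x) : AbaInv G K V p (x.settle K) := by
  rcases AbaState.settle_cases (K := K) x with e | ⟨C, tie, h1, h2, h3, e⟩
  · rwa [e]
  · rw [e]
    refine ⟨hx.vote, fun b hb => ?_, hx.core, fun i _ _ => Or.inr rfl⟩
    obtain ⟨i, hi, hv⟩ := AbaState.decision_eq (tie := tie)
      (hK.sdiff_nonempty hQ (hx.core C tie h2)) h3
    obtain rfl : x.decision K C tie = b := by simpa using hb
    have hi := (Finset.mem_sdiff.1 hi).2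
    exact ⟨i, hi, hx.vote i hi _ hv⟩

/-- The functionality ignores votes after its output, although the voter's flag is set. Hence the
alternative of an existing output in the last field of `AbaInv`. -/
theorem AbaInv.addVote (hQ : QCond 4 Finset.univ G.Z) (hK : G.Admissible K)
    {V : Fin n → Bool → Prop} {p p' : Fin n → Prop} {x : AbaState n} {j : Fin n} {b : Bool}
    (hx : AbaInv G K V p x) (hj : j ∉ K → V j b) (hp : ∀ i ∉ K, p' i → i ≠ j → p i) :
    AbaInv G K V p' (x.addVote K j b) := by
  unfold AbaState.addVote
  split_ifs with ho
  · exact ⟨hx.vote, hx.out, hx.core, fun i _ _ => Or.inr ho⟩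
  · refine AbaInv.settle hQ hK ⟨fun i hi b' hb' => ?_, hx.out, hx.core, fun i hi hv => ?_⟩
    · by_cases hij : i = j
      · subst hij
        obtain rfl : b = b' := by simpa using hb'
        exact hj hi
      · exact hx.vote i hi b' (by simpa [hij] using hb')
    · by_cases hij : i = j
      · subst hij; simp
      · simpa [hij] using hx.voted i hi (hp i hi hv hij)

theorem AbaInv.addCore (hQ : QCond 4 Finset.univ G.Z) (hK : G.Admissible K)
    {V : Fin n → Bool → Prop} {p : Fin n → Prop} {x : AbaState n} {C : Finset (Fin n)} {tie : Bool}
    (hx : AbaInv G K V p x) (hC : G.Admissible Cᶜ) : AbaInv G K V p (x.addCore K C tie) := by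
  unfold AbaState.addCore
  split_ifs with ho
  · exact hx
  · refine AbaInv.settle hQ hK ⟨hx.vote, hx.out, fun C' tie' e => ?_, hx.voted⟩
    obtain ⟨rfl, rfl⟩ : C = C' ∧ tie = tie' := by simpa using e
    exact hC

/-! ### The invariant -/

variable (G K) in
/-- The facts about reachable states on which everything else is based. -/
structure Inv (a b : Fin h → F) (st : State n h F) : Prop where
  me : ∀ i, (st.loc i).me = i
  inputA : ∀ i, (st.loc i).a = fun q => if i ∈ G.S q then a q else 0
  inputB : ∀ i, (st.loc i).b = fun q => if i ∈ G.S q then b q else 0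
  vss : ∀ i sid w, (st.loc i).vss sid = some w →
    ∃ v, st.vss sid = some v ∧ w = fun q => if i ∈ G.S q then v q else 0
  loc_aba : ∀ i sid b, (st.loc i).aba sid = some b → (st.aba sid).out = some b
  msg : ∀ i r q j v, j ∉ K → (st.loc i).msg r q j = some v → st.sent j r q = some v
  sent : ∀ j r q v, st.sent j r q = some v →
    j ∉ K ∧ j ∈ G.S q ∧ (st.loc j).Contributes G q v r
  dealt : ∀ sid v, st.vss sid = some v → sid.dealer ∉ K →
    (st.loc sid.dealer).RequestsVss G sid ∧
      ∑ q, v q = ∑ pq ∈ (st.loc sid.dealer).pairs G sid, a pq.1 * b pq.2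
  aba : ∀ sid, AbaInv G K (fun i => (st.loc i).Votes G sid)
    (fun i => (st.loc i).voted sid = true) (st.aba sid)

theorem inv_initial (a b : Fin h → F) : Inv G K a b (initial G a b) := by
  refine ⟨fun _ => rfl, fun _ => rfl, fun _ => rfl, ?_, ?_, ?_, ?_, ?_, fun sid => ⟨?_, ?_, ?_, ?_⟩⟩
  all_goals simp [initial]

/-- The default `0` for missing input shares never enters: a dealer belongs to both groups of every
pair assigned to it. -/
theorem Inv.sum_pairs {a b : Fin h → F} {st : State n h F} (hI : Inv G K a b st) {i : Fin n}
    {sid : VssId n h} (hi : sid.dealer = i) :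
    ∑ pq ∈ (st.loc i).pairs G sid, (st.loc i).a pq.1 * (st.loc i).b pq.2 =
      ∑ pq ∈ (st.loc i).pairs G sid, a pq.1 * b pq.2 := by
  refine Finset.sum_congr rfl fun pq hpq => ?_
  obtain ⟨h1, h2⟩ := Local.mem_S_of_pairs hpq
  rw [hi] at h1 h2
  simp [hI.inputA, hI.inputB, h1, h2]

/-- Everything asserted about existing entries persists under `State.LE` and is transported first.
What remains for each event is the entry that it creates. -/
theorem Inv.step (hQ : QCond 4 Finset.univ G.Z) (hK : G.Admissible K) {a b : Fin h → F}
    {st st' : State n h F} (hI : Inv G K a b st) (hs : Step G K st st') : Inv G K a b st' := by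
  have hle := hs.le
  have hme : ∀ i, (st'.loc i).me = i := fun i => (hle.loc i).me.trans (hI.me i)
  have hA : ∀ i, (st'.loc i).a = fun q => if i ∈ G.S q then a q else 0 :=
    fun i => (hle.loc i).a.trans (hI.inputA i)
  have hB : ∀ i, (st'.loc i).b = fun q => if i ∈ G.S q then b q else 0 :=
    fun i => (hle.loc i).b.trans (hI.inputB i)
  have hvss : ∀ i sid w, (st.loc i).vss sid = some w →
      ∃ v, st'.vss sid = some v ∧ w = fun q => if i ∈ G.S q then v q else 0 := fun i sid w hw => by
    obtain ⟨v, hv, e⟩ := hI.vss i sid w hw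
    exact ⟨v, hle.vss _ _ hv, e⟩
  have haba : ∀ i sid b, (st.loc i).aba sid = some b → (st'.aba sid).out = some b :=
    fun i sid b hb => hle.out _ _ (hI.loc_aba i sid b hb)
  have hmsg : ∀ i r q j v, j ∉ K → (st.loc i).msg r q j = some v → st'.sent j r q = some v :=
    fun i r q j v hj hv => hle.sent _ _ _ _ (hI.msg i r q j v hj hv)
  have hsent : ∀ j r q v, st.sent j r q = some v →
      j ∉ K ∧ j ∈ G.S q ∧ (st'.loc j).Contributes G q v r := fun j r q v hv => by
    obtain ⟨h1, h2, h3⟩ := hI.sent j r q v hv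
    exact ⟨h1, h2, (hle.loc j).contributes hQ h3⟩
  have hdealt : ∀ sid v, st.vss sid = some v → sid.dealer ∉ K →
      (st'.loc sid.dealer).RequestsVss G sid ∧
        ∑ q, v q = ∑ pq ∈ (st'.loc sid.dealer).pairs G sid, a pq.1 * b pq.2 :=
    fun sid v hv hd => by
      obtain ⟨h1, h2⟩ := hI.dealt sid v hv hd
      exact ⟨(hle.loc _).requestsVss hQ h1, by rw [(hle.loc _).pairs_eq hQ h1]; exact h2⟩
  have hst : ∀ sid, (∀ i ∉ K, (st'.loc i).voted sid = true → (st.loc i).voted sid = true) →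
      AbaInv G K (fun i => (st'.loc i).Votes G sid)
        (fun i => (st'.loc i).voted sid = true) (st.aba sid) := fun sid hv =>
    (hI.aba sid).mono (fun i b hb => (hle.loc i).votes hQ hb) hv
  -- For an instance modified in this step the flags are kept at their old values; `AbaInv.addVote`
  -- accounts for a newly set one.
  have hst0 : ∀ sid, AbaInv G K (fun i => (st'.loc i).Votes G sid)
        (fun i => (st.loc i).voted sid = true) (st.aba sid) := fun sid =>
    (hI.aba sid).mono (fun i b hb => (hle.loc i).votes hQ hb) fun _ _ hv => hv
  cases hs with
  | stay => exact hI
  | deal i sid v hi hs hd =>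
    refine ⟨hme, hA, hB, hvss, haba, hmsg, hsent, fun sid' v' hv' hd' => ?_,
      fun sid => hst sid fun _ _ hv => hv⟩
    by_cases he : sid' = sid
    · subst he
      obtain ⟨h1, h2, h3⟩ := hd.requests
      rw [hI.me] at h1
      obtain rfl : v = v' := by simpa using hv'
      rw [h1]
      exact ⟨h2, h3.trans (hI.sum_pairs h1)⟩
    · exact hdealt sid' v' (by simpa [he] using hv') hd'
  | advDeal sid v hs hd =>
    refine ⟨hme, hA, hB, hvss, haba, hmsg, hsent, fun sid' v' hv' hd' => ?_,
      fun sid => hst sid fun _ _ hv => hv⟩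
    by_cases he : sid' = sid
    · subst he; exact absurd hd hd'
    · exact hdealt sid' v' (by simpa [he] using hv') hd'
  | vote i sid b hi hv hm =>
    refine ⟨hme, hA, hB, fun j sid' w hw => hvss j sid' w ?_, fun j sid' b' hb' => haba j sid' b' ?_,
      fun j r q k v hk hv => hmsg j r q k v hk ?_, hsent, hdealt, fun sid' => ?_⟩
    · by_cases hj : j = i
      · subst hj; simpa [State.setLoc] using hw
      · simpa [State.setLoc, hj] using hw
    · by_cases hj : j = i
      · subst hj; simpa [State.setLoc] using hb'
      · simpa [State.setLoc, hj] using hb'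
    · by_cases hj : j = i
      · subst hj; simpa [State.setLoc] using hv
      · simpa [State.setLoc, hj] using hv
    · by_cases he : sid' = sid
      · subst he
        simp only [Function.update_self]
        refine (hst0 sid').addVote hQ hK (fun _ => (hle.loc i).votes hQ hm.votes) fun j _ hv hj => ?_
        simpa [State.setLoc, hj] using hv
      · simp only [Function.update_of_ne he]
        refine hst sid' fun j _ hv => ?_
        by_cases hj : j = i
        · subst hj; simpa [State.setLoc, he] using hv
        · simpa [State.setLoc, hj] using hv
  | send i r q v hi hq hs hv =>
    refine ⟨hme, hA, hB, hvss, haba, hmsg, fun j r' q' v' hv' => ?_, hdealt,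
      fun sid => hst sid fun _ _ hv => hv⟩
    dsimp only at hv'
    split_ifs at hv' with hc
    · obtain ⟨rfl, rfl, rfl⟩ := hc
      obtain rfl : v = v' := by simpa using hv'
      exact ⟨hi, hq, hv⟩
    · exact hsent j r' q' v' hv'
  | vssOut i sid v hi hv hl =>
    refine ⟨hme, hA, hB, fun j sid' w hw => ?_, fun j sid' b' hb' => haba j sid' b' ?_,
      fun j r q k v hk hv => hmsg j r q k v hk ?_, hsent, hdealt, fun sid' => hst sid' fun j _ hv => ?_⟩
    · by_cases hj : j = i
      · subst hj
        by_cases he : sid' = sid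
        · subst he
          refine ⟨v, hv, ?_⟩
          simpa [State.setLoc] using hw.symm
        · exact hvss j sid' w (by simpa [State.setLoc, he] using hw)
      · exact hvss j sid' w (by simpa [State.setLoc, hj] using hw)
    · by_cases hj : j = i
      · subst hj; simpa [State.setLoc] using hb'
      · simpa [State.setLoc, hj] using hb'
    · by_cases hj : j = i
      · subst hj; simpa [State.setLoc] using hv
      · simpa [State.setLoc, hj] using hv
    · by_cases hj : j = i
      · subst hj; simpa [State.setLoc] using hv
      · simpa [State.setLoc, hj] using hv
  | abaOut i sid b hi hb hl =>
    refine ⟨hme, hA, hB, fun j sid' w hw => hvss j sid' w ?_, fun j sid' b' hb' => ?_,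
      fun j r q k v hk hv => hmsg j r q k v hk ?_, hsent, hdealt, fun sid' => hst sid' fun j _ hv => ?_⟩
    · by_cases hj : j = i
      · subst hj; simpa [State.setLoc] using hw
      · simpa [State.setLoc, hj] using hw
    · by_cases hj : j = i
      · subst hj
        by_cases he : sid' = sid
        · subst he
          obtain rfl : b = b' := by simpa [State.setLoc] using hb'
          exact hb
        · exact haba j sid' b' (by simpa [State.setLoc, he] using hb')
      · exact haba j sid' b' (by simpa [State.setLoc, hj] using hb')
    · by_cases hj : j = i
      · subst hj; simpa [State.setLoc] using hv
      · simpa [State.setLoc, hj] using hv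
    · by_cases hj : j = i
      · subst hj; simpa [State.setLoc] using hv
      · simpa [State.setLoc, hj] using hv
  | msg i j r q v hi hl hj =>
    refine ⟨hme, hA, hB, fun j sid' w hw => hvss j sid' w ?_, fun j sid' b' hb' => haba j sid' b' ?_,
      fun i' r' q' k v' hk hv' => ?_, hsent, hdealt, fun sid' => hst sid' fun j _ hv => ?_⟩
    · by_cases hj : j = i
      · subst hj; simpa [State.setMsg, State.setLoc] using hw
      · simpa [State.setMsg, State.setLoc, hj] using hw
    · by_cases hj : j = i
      · subst hj; simpa [State.setMsg, State.setLoc] using hb'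
      · simpa [State.setMsg, State.setLoc, hj] using hb'
    · by_cases hii : i' = i
      · subst hii
        simp only [State.setMsg, State.setLoc, Function.update_self] at hv'
        split_ifs at hv' with hc
        · obtain ⟨rfl, rfl, rfl⟩ := hc
          obtain rfl : v = v' := by simpa using hv'
          exact hj hk
        · exact hmsg i' r' q' k v' hk hv'
      · exact hmsg i' r' q' k v' hk (by simpa [State.setMsg, State.setLoc, hii] using hv')
    · by_cases hj : j = i
      · subst hj; simpa [State.setMsg, State.setLoc] using hv
      · simpa [State.setMsg, State.setLoc, hj] using hv
  | advVote j sid b hj =>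
    refine ⟨hme, hA, hB, hvss, haba, hmsg, hsent, hdealt, fun sid' => ?_⟩
    by_cases he : sid' = sid
    · subst he
      simp only [Function.update_self]
      exact (hst0 sid').addVote hQ hK (fun h => absurd hj h) fun _ _ hv _ => hv
    · simp only [Function.update_of_ne he]
      exact hst sid' fun _ _ hv => hv
  | advCore sid C tie hC =>
    refine ⟨hme, hA, hB, hvss, haba, hmsg, hsent, hdealt, fun sid' => ?_⟩
    by_cases he : sid' = sid
    · subst he
      simp only [Function.update_self]
      exact (hst0 sid').addCore hQ hK hC
    · simp only [Function.update_of_ne he]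
      exact hst sid' fun _ _ hv => hv

end Steps

/-! ### Selected parties and their summands -/

section OptGood
variable {n h : ℕ} (F : Type*) [Field F] (G : Setup n h)

/-- The variables of an optimistic multiplication when every selected party was not selected before
and does not belong to the set of the instance. -/
structure OptGood (z : Fin h) (o : OptState n h) : Prop where
  notMem : ∀ j ∈ o.selected, j ∉ G.Z z
  card : o.selected.card = o.hop
  own_subset : ∀ j, j ∉ G.Z z → j ∉ o.selected → o.own j ⊆ o.summands
  subset_own : ∀ j, j ∉ G.Z z → j ∉ o.selected →
    ∀ pq ∈ o.summands, pq ∈ (OptState.init G).own j → pq ∈ o.own j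
  marked : ∀ j ∈ o.selected, ∀ pq ∈ (OptState.init G).own j, pq ∉ o.summands
  sum : ∀ f : Fin h × Fin h → F,
    ∑ j ∈ o.selected, ∑ pq ∈ o.own j, f pq + ∑ pq ∈ o.summands, f pq = ∑ pq, f pq

variable {F G} {z : Fin h} {o : OptState n h} {j : Fin n}

theorem OptState.mem_selected : j ∈ o.selected ↔ (o.hopOf j).isSome := by
  simp [OptState.selected]

theorem OptState.selected_init : (OptState.init G).selected = ∅ := by
  simp [OptState.init, OptState.selected]

theorem OptState.selected_next : (o.next G z j).selected = insert j o.selected := by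
  ext k
  by_cases hk : k = j
  · subst hk; simp [OptState.mem_selected, OptState.next]
  · simp [OptState.mem_selected, OptState.next, hk]

theorem OptState.own_next {k : Fin n} (hk : k ∈ insert j o.selected) :
    (o.next G z j).own k = o.own k := by
  simp only [OptState.next]
  rw [if_pos (Finset.mem_union_right _ hk)]

theorem OptState.own_next' {k : Fin n} (hz : k ∉ G.Z z) (hk : k ∉ insert j o.selected) :
    (o.next G z j).own k = o.own k \ o.own j := by
  simp only [OptState.next]
  rw [if_neg]
  rw [Finset.mem_union]
  tauto

theorem OptGood.init : OptGood F G z (OptState.init G) := by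
  refine ⟨?_, ?_, ?_, ?_, ?_, ?_⟩
  · simp [OptState.selected_init]
  · rw [OptState.selected_init]; rfl
  · intro j _ _; exact Finset.subset_univ _
  · intro j _ _ pq _ hpq; exact hpq
  · simp [OptState.selected_init]
  · intro f; simp only [OptState.selected_init, Finset.sum_empty, zero_add]; rfl

/-- The pairs of the new party are removed from the unmarked ones and from every remaining
candidate, so the sets of the selected parties stay disjoint and exhaust all pairs together with the
unmarked ones. The field `sum` encodes this partition through sums over arbitrary functions. -/
theorem OptGood.next (ho : OptGood F G z o) (hz : j ∉ G.Z z) (hj : j ∉ o.selected) :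
    OptGood F G z (o.next G z j) := by
  have hs : (o.next G z j).summands = o.summands \ o.own j := rfl
  refine ⟨?_, ?_, ?_, ?_, ?_, ?_⟩
  · rw [OptState.selected_next]
    intro k hk
    rcases Finset.mem_insert.1 hk with rfl | hk
    · exact hz
    · exact ho.notMem k hk
  · rw [OptState.selected_next, Finset.card_insert_of_notMem hj, ho.card]; rfl
  · intro k hkz hk
    rw [OptState.selected_next] at hk
    rw [OptState.own_next' hkz hk, hs]
    exact Finset.sdiff_subset_sdiff
      (ho.own_subset k hkz fun h => hk (Finset.mem_insert_of_mem h)) subset_rfl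
  · intro k hkz hk pq hpq hi
    rw [OptState.selected_next] at hk
    rw [OptState.own_next' hkz hk]
    rw [hs, Finset.mem_sdiff] at hpq
    exact Finset.mem_sdiff.2
      ⟨ho.subset_own k hkz (fun h => hk (Finset.mem_insert_of_mem h)) pq hpq.1 hi, hpq.2⟩
  · intro k hk pq hi hpq
    rw [OptState.selected_next] at hk
    rw [hs, Finset.mem_sdiff] at hpq
    rcases Finset.mem_insert.1 hk with rfl | hk
    · exact hpq.2 (ho.subset_own k hz hj pq hpq.1 hi)
    · exact ho.marked k hk pq hi hpq.1
  · intro f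
    have he : ∑ k ∈ o.selected, ∑ pq ∈ (o.next G z j).own k, f pq =
        ∑ k ∈ o.selected, ∑ pq ∈ o.own k, f pq := Finset.sum_congr rfl fun k hk => by
      rw [OptState.own_next (Finset.mem_insert_of_mem hk)]
    rw [OptState.selected_next, Finset.sum_insert hj, hs, ← ho.sum f, he,
      OptState.own_next (Finset.mem_insert_self _ _), ← Finset.sum_sdiff (ho.own_subset j hz hj)]
    ring

/-- The partition property applied to the function that vanishes off `P`. It shows that honest parts
add up, and also that the changes of the parts add up in the privacy argument. -/
theorem OptGood.sum_inter (ho : OptGood F G z o) (hs : o.summands = ∅)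
    (P : Finset (Fin h × Fin h)) (f : Fin h × Fin h → F) :
    ∑ j ∈ o.selected, ∑ pq ∈ P ∩ o.own j, f pq = ∑ pq ∈ P, f pq := by
  have := ho.sum fun pq => if pq ∈ P then f pq else 0
  rw [hs, Finset.sum_empty, add_zero, Finset.sum_ite_mem, Finset.univ_inter] at this
  rw [← this]
  refine Finset.sum_congr rfl fun j _ => ?_
  rw [Finset.sum_ite_mem, Finset.inter_comm]

theorem OptGood.notMem_selected (ho : OptGood F G z o) {pq : Fin h × Fin h}
    (hpq : pq ∈ o.summands) (h1 : j ∈ G.S pq.1) (h2 : j ∈ G.S pq.2) : j ∉ o.selected :=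
  fun hj => ho.marked j hj pq (by simp [OptState.init, h1, h2]) hpq

end OptGood

/-! ### Consequences of the invariant -/

section Safety
variable {n h : ℕ} {F : Type*}

/-- The view of a party that knows everything the functionalities have received and computed. -/
def State.glob (st : State n h F) (i : Fin n) : Local n h F :=
  { st.loc i with aba := fun sid => (st.aba sid).out, vss := st.vss }

variable [Field F] [DecidableEq F] {G : Setup n h} {K : Finset (Fin n)}
  {a b : Fin h → F} {st : State n h F} {iter : ℕ} {z z₀ : Fin h} {i j k i₀ : Fin n} {q : Fin h}
  {L : Local n h F}

theorem Inv.abaLE (hI : Inv G K a b st) (i i₀ : Fin n) : (st.loc i).AbaLE (st.glob i₀) :=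
  fun sid b hb => hI.loc_aba i sid b hb

omit [Field F] [DecidableEq F] in
theorem State.glob_abaLE (st : State n h F) (i i₀ : Fin n) :
    (st.glob i).AbaLE (st.glob i₀) := fun _ _ e => e

theorem Inv.shareLE (hI : Inv G K a b st) (hi : i ∈ G.S q) (i₀ : Fin n) :
    (st.loc i).ShareLE q (st.glob i₀) := by
  refine ⟨hI.abaLE i i₀, fun sid w hw => ?_⟩
  obtain ⟨v, hv, rfl⟩ := hI.vss i sid w hw
  exact ⟨v, hv, by simp [hi]⟩

theorem Inv.exists_voter (hI : Inv G K a b st) (hL : L.AbaLE (st.glob i₀))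
    {sid : Fin n → AbaId n h} (hw : L.winner sid = some j) :
    ∃ i ∉ K, (st.loc i).Votes G (sid j) true :=
  (hI.aba (sid j)).out true (hL _ _ (Local.winner_eq_some hw).2)

/-- An honest supporter of the winner checked these conditions in its own copy of the hop, and that
copy agrees with any other that has reached the hop. -/
theorem Inv.fresh (hI : Inv G K a b st) (hL : L.AbaLE (st.glob i₀)) {m : ℕ}
    (hm : (L.optAt G iter z m).hop = m) (hw : L.winner (AbaId.select iter z m) = some j) :
    j ∉ G.Z z ∧ j ∉ (L.optAt G iter z m).selected ∧
      ∃ i ∉ K, (st.loc i).Votes G (.select iter z m j) true := by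
  obtain ⟨i, hi, hv⟩ := hI.exists_voter hL hw
  have hv' := hv
  obtain ⟨h1, h2, h3, h4, h5, h6⟩ := hv'
  refine ⟨h3, ?_, i, hi, hv⟩
  rwa [← hL.optAt_of_hop G hm, (hI.abaLE i i₀).optAt_of_hop G h1.2.2.1]

theorem Inv.optGood (hI : Inv G K a b st) (hL : L.AbaLE (st.glob i₀)) (iter : ℕ) (z : Fin h)
    (m : ℕ) : OptGood F G z (L.optAt G iter z m) := by
  induction m with
  | zero => exact OptGood.init
  | succ m ih =>
    rcases Local.optAt_succ_cases G (L := L) (iter := iter) (z := z) (m := m) with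
      e | ⟨j, hs, hw, e⟩
    · rwa [e]
    · rw [e]
      have he := Local.optAt_hop_self G (L := L) (iter := iter) (z := z) (m := m)
      have := hI.fresh hL (by rw [he]) hw
      rw [he] at this
      exact ih.next this.1 this.2.1

omit [DecidableEq F] in
/-- There are unselected honest parties as long as summands are left. -/
theorem OptGood.exists_unselected (hQ : QCond 4 Finset.univ G.Z) (hK : G.Admissible K)
    {o : OptState n h} (ho : OptGood F G z o) (hs : o.summands ≠ ∅) :
    ∃ j, j ∉ K ∧ j ∉ G.Z z ∧ j ∉ o.selected := by
  obtain ⟨pq, hpq⟩ := Finset.nonempty_iff_ne_empty.2 hs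
  obtain ⟨y, hy⟩ := hK
  -- The place where the condition is needed for four sets: the two of an unmarked pair, that of the
  -- instance, and one containing the corrupt parties.
  obtain ⟨j, h1, h2, h3, h4⟩ := hQ.exists_notMem pq.1 pq.2 z y
  exact ⟨j, fun hj => h4 (hy hj), h3,
    ho.notMem_selected hpq (Setup.mem_S.2 h1) (Setup.mem_S.2 h2)⟩

omit [DecidableEq F] in
theorem OptGood.hop_lt (hQ : QCond 4 Finset.univ G.Z) (hK : G.Admissible K)
    {o : OptState n h} (ho : OptGood F G z o) (hs : o.summands ≠ ∅) : o.hop < n := by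
  obtain ⟨j, -, -, hj⟩ := ho.exists_unselected hQ hK hs
  rw [← ho.card]
  calc o.selected.card < (Finset.univ : Finset (Fin n)).card :=
        Finset.card_lt_card ⟨Finset.subset_univ _, fun hc => hj (hc (Finset.mem_univ _))⟩
    _ = n := by simp

omit [Field F] [DecidableEq F] in
theorem Local.AbaLE.opt_congr {L' M : Local n h F} (hL : L.AbaLE M) (hL' : L'.AbaLE M)
    (hc : (L.opt G iter z).summands = ∅) (hc' : (L'.opt G iter z).summands = ∅) :
    L'.opt G iter z = L.opt G iter z := by
  rw [← hL.opt_of_empty G hc, hL'.opt_of_empty G hc']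

/-- Reconstructed shares are correct. -/
theorem Inv.recShare_sound (hI : Inv G K a b st) (hQ : QCond 4 Finset.univ G.Z)
    (hK : G.Admissible K) {r : RecId n h} {own gown : Fin h → Option F}
    (hown : i ∈ G.S q → ∀ v, own q = some v → gown q = some v)
    (hcon : ∀ j ∉ K, j ∈ G.S q → ∀ v, (st.loc j).Contributes G q v r → gown q = some v)
    {v : F} (hv : (st.loc i).recShare G r own q = some v) : gown q = some v := by
  by_cases hq : i ∈ G.S q
  · rw [Local.recShare_of_mem (by rwa [hI.me])] at hv
    exact hown hq v hv
  · rw [Local.recShare_of_notMem hQ (by rwa [hI.me])] at hv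
    obtain ⟨z, hz⟩ := hv
    obtain ⟨y, hy⟩ := hK
    -- An honest member of the group outside the exceptional set must have sent the accepted value,
    -- and honest senders send what the record prescribes.
    obtain ⟨j, h1, h2, h3, -⟩ := hQ.exists_notMem z y q q
    have hm : (st.loc i).msg r q j = some v := by
      by_contra hne
      exact h1 (hz (by simp [Setup.mem_S, h3, hne]))
    have hj : j ∉ K := fun hj => h2 (hy hj)
    obtain ⟨-, h5, h6⟩ := hI.sent j r q v (hI.msg i r q j v hj hm)
    exact hcon j hj h5 v h6

theorem Inv.recValue_sound (hI : Inv G K a b st) (hQ : QCond 4 Finset.univ G.Z)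
    (hK : G.Admissible K) {r : RecId n h} {own gown : Fin h → Option F}
    (hown : ∀ q, i ∈ G.S q → ∀ v, own q = some v → gown q = some v)
    (hcon : ∀ q, ∀ j ∉ K, j ∈ G.S q → ∀ v, (st.loc j).Contributes G q v r → gown q = some v)
    {v : F} (hv : (st.loc i).recValue G r own = some v) : optSum Finset.univ gown = some v :=
  optSum_mono (fun q _ _ => hI.recShare_sound hQ hK (hown q) (hcon q)) hv

theorem Inv.diffVal_sound (hI : Inv G K a b st) (hQ : QCond 4 Finset.univ G.Z)
    (hK : G.Admissible K) (i₀ : Fin n) {v : F} (hv : (st.loc i).diffVal G iter z = some v) :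
    optSum Finset.univ ((st.glob i₀).diffIn G iter z) = some v := by
  refine hI.recValue_sound hQ hK (fun _ hq _ => (hI.shareLE hq i₀).diffIn)
    (fun q j _ hq v hr => ?_) hv
  exact (hI.shareLE hq i₀).diffIn hr.2

/-- Every difference that either party has reconstructed is the total of one and the same vector of
the global record. -/
theorem Inv.verdict_agree (hI : Inv G K a b st) (hQ : QCond 4 Finset.univ G.Z)
    (hK : G.Admissible K) {x y : Option (Fin h)} (hi : (st.loc i).verdict G iter = some x)
    (hj : (st.loc j).verdict G iter = some y) : x = y := by
  have hi' : ((st.loc i).verdict G iter).isSome := by simp [hi]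
  have hj' : ((st.loc j).verdict G iter).isSome := by simp [hj]
  have := Local.verdict_congr hi' hj' fun z => by
    obtain ⟨v, hv⟩ := Option.isSome_iff_exists.1 ((Local.verdict_isSome.1 hi').2 z)
    obtain ⟨w, hw⟩ := Option.isSome_iff_exists.1 ((Local.verdict_isSome.1 hj').2 z)
    rw [hv, hw, ← hI.diffVal_sound hQ hK i hv, ← hI.diffVal_sound hQ hK i hw]
  rw [hi, hj] at this
  exact (Option.some_injective _ this).symm

theorem Inv.conflict_agree (hI : Inv G K a b st) (hQ : QCond 4 Finset.univ G.Z)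
    (hK : G.Admissible K) {z₁ : Fin h} (hi : (st.loc i).Conflict G iter z₀)
    (hj : (st.loc j).Conflict G iter z₁) : z₀ = z₁ := by
  have := hI.verdict_agree hQ hK hi hj
  simpa using this

theorem Local.Conflict.diffVal (hz : L.Conflict G iter z₀) :
    ∃ v, L.diffVal G iter z₀ = some v ∧ v ≠ 0 := by
  have hz : L.verdict G iter = some (some z₀) := hz
  have hs : (L.verdict G iter).isSome := by simp [hz]
  obtain ⟨v, hv⟩ := Option.isSome_iff_exists.1 ((Local.verdict_isSome.1 hs).2 z₀)
  rw [Local.verdict_eq_of_isSome hs, Option.some_inj] at hz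
  have := List.find?_some hz
  simp only [ne_eq, decide_eq_true_eq, hv, Option.some_inj] at this
  exact ⟨v, hv, this⟩

theorem Local.diffVal_of_verdict (hz : L.verdict G iter = some none) (z : Fin h) :
    L.diffVal G iter z = some 0 := by
  have hs : (L.verdict G iter).isSome := by simp [hz]
  rw [Local.verdict_eq_of_isSome hs, Option.some_inj, List.find?_eq_none] at hz
  simpa using hz z (List.mem_finRange z)

theorem Inv.ne_ref (hI : Inv G K a b st) (hQ : QCond 4 Finset.univ G.Z)
    (hK : G.Admissible K) (hz : (st.loc i).Conflict G iter z₀) : z₀ ≠ G.ref iter := by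
  rintro rfl
  obtain ⟨v, hv, h0⟩ := hz.diffVal
  have := hI.diffVal_sound hQ hK i hv
  rw [optSum_eq_some] at this
  refine h0 (this.2.symm.trans (Finset.sum_eq_zero fun q _ => ?_))
  unfold Local.diffIn
  cases (st.glob i).prodShare G iter (G.ref iter) q <;> simp

theorem Setup.opp_left : G.opp iter z₀ z₀ = G.ref iter := by simp [Setup.opp]

theorem Setup.opp_ref (hne : z₀ ≠ G.ref iter) : G.opp iter z₀ (G.ref iter) = z₀ := by
  simp [Setup.opp, hne.symm]

/-- A sender computes its contribution relative to the conflicting set that it has found itself, so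
agreement on the conflict is needed before the shares can be combined. -/
theorem Inv.checkVal_sound (hI : Inv G K a b st) (hQ : QCond 4 Finset.univ G.Z)
    (hK : G.Admissible K) (hz : (st.loc i).Conflict G iter z₀) (i₀ : Fin n) {v : F}
    (hv : (st.loc i).checkVal G iter z₀ z j = some v) :
    optSum Finset.univ ((st.glob i₀).checkIn G iter z₀ z j) = some v := by
  refine hI.recValue_sound hQ hK (fun _ hq _ => (hI.shareLE hq i₀).checkIn hz.complete)
    (fun q j' _ hq v hr => ?_) hv
  obtain ⟨-, z₁, h2, -, -, h5⟩ := hr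
  rw [hI.conflict_agree hQ hK hz h2]
  exact (hI.shareLE hq i₀).checkIn h2.complete h5

theorem Inv.pairVal_sound (hI : Inv G K a b st) (hQ : QCond 4 Finset.univ G.Z)
    (hK : G.Admissible K) (hz : (st.loc i).Conflict G iter z₀) (i₀ : Fin n) {v : F}
    (hv : (st.loc i).pairVal G iter z₀ j k = some v) :
    optSum Finset.univ ((st.glob i₀).pairIn G iter z₀ j k) = some v := by
  refine hI.recValue_sound hQ hK (fun _ hq _ => (hI.shareLE hq i₀).pairIn)
    (fun q j' _ hq v hr => ?_) hv
  obtain ⟨-, z₁, h2, -, -, h5⟩ := hr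
  rw [hI.conflict_agree hQ hK hz h2]
  exact (hI.shareLE hq i₀).pairIn h5

theorem Inv.partVal_sound (hI : Inv G K a b st) (hQ : QCond 4 Finset.univ G.Z)
    (hK : G.Admissible K) (i₀ : Fin n) {v : F}
    (hv : (st.loc i).partVal G iter z j k = some v) :
    optSum Finset.univ ((st.glob i₀).partShare iter z j k) = some v := by
  refine hI.recValue_sound hQ hK (fun _ hq _ => (hI.shareLE hq i₀).partShare)
    (fun q j' _ hq v hr => ?_) hv
  obtain ⟨-, z₁, -, -, h⟩ := hr
  exact (hI.shareLE hq i₀).partShare h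

theorem Inv.inputA_sound (hI : Inv G K a b st) (hQ : QCond 4 Finset.univ G.Z)
    (hK : G.Admissible K) {v : F}
    (hv : (st.loc i).recShare G (.inputA iter j k) (fun p => some ((st.loc i).a p)) q = some v) :
    v = a q := by
  have := hI.recShare_sound hQ hK (gown := fun q => some (a q)) (fun hq v e => ?_)
    (fun j _ hq v hr => ?_) hv
  · exact (Option.some_injective _ this).symm
  · rw [← e, hI.inputA]; simp [hq]
  · obtain ⟨-, -, -, -, -, e⟩ := hr
    rw [e, hI.inputA]; simp [hq]

theorem Inv.inputB_sound (hI : Inv G K a b st) (hQ : QCond 4 Finset.univ G.Z)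
    (hK : G.Admissible K) {v : F}
    (hv : (st.loc i).recShare G (.inputB iter j k) (fun p => some ((st.loc i).b p)) q = some v) :
    v = b q := by
  have := hI.recShare_sound hQ hK (gown := fun q => some (b q)) (fun hq v e => ?_)
    (fun j _ hq v hr => ?_) hv
  · exact (Option.some_injective _ this).symm
  · rw [← e, hI.inputB]; simp [hq]
  · obtain ⟨-, -, -, -, -, e⟩ := hr
    rw [e, hI.inputB]; simp [hq]

theorem Inv.commonVal_sound (hI : Inv G K a b st) (hQ : QCond 4 Finset.univ G.Z)
    (hK : G.Admissible K) {v : F} (hv : (st.loc i).commonVal G iter z₀ j k = some v) :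
    v = ∑ pq ∈ (st.loc i).common G iter z₀ j k, a pq.1 * b pq.2 := by
  unfold Local.commonVal at hv
  rw [optSum_eq_some] at hv
  rw [← hv.2]
  refine Finset.sum_congr rfl fun pq hpq => ?_
  obtain ⟨w, hw⟩ := Option.isSome_iff_exists.1 (hv.1 pq hpq)
  rw [hw]
  obtain ⟨x, y, hx, hy, rfl⟩ := map₂_eq_some.1 hw
  rw [hI.inputA_sound hQ hK hx, hI.inputB_sound hQ hK hy]
  rfl

/-! #### What honest dealers have shared -/

/-- The dealer fixed its pairs in its own view of hop `m`. That view is the common one, and the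
pairs of a party do not change after its selection. -/
theorem Inv.pairs_sum (hI : Inv G K a b st) (hL : L.AbaLE (st.glob i₀)) (hj : j ∉ K) {m : ℕ}
    (hm : (L.opt G iter z).hopOf j = some m) (hs : (st.vss (.sum iter z m j)).isSome) :
    (st.loc j).pairs G (.sum iter z m j) = L.summ G iter z j := by
  obtain ⟨v, hv⟩ := Option.isSome_iff_exists.1 hs
  have hr := (hI.dealt _ v hv hj).1
  rw [Local.requestsVss_sum] at hr
  obtain ⟨-, -, h3, -, h5⟩ := Local.optAt_hopOf G hm
  have h6 := (hI.abaLE j i₀).optAt_of_hop G hr.2.2.1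
  have h7 := hL.optAt_of_hop G h3
  simp only [Local.pairs, Local.summ, ← h6, h7, h5, Local.opt_eq_optAt]

theorem Inv.pairs_part (hI : Inv G K a b st) (hQ : QCond 4 Finset.univ G.Z)
    (hK : G.Admissible K) (hL : L.AbaLE (st.glob i₀)) (hc : L.Complete G iter)
    (hz : (st.loc i).Conflict G iter z₀) (hj : j ∉ K)
    (hs : (st.vss (.part iter z j k)).isSome) :
    (st.loc j).pairs G (.part iter z j k) =
      L.summ G iter z j ∩ L.summ G iter (G.opp iter z₀ z) k := by
  obtain ⟨v, hv⟩ := Option.isSome_iff_exists.1 hs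
  obtain ⟨-, z₁, h2, -⟩ := (hI.dealt _ v hv hj).1
  simp only [VssId.dealer] at h2
  obtain rfl := hI.conflict_agree hQ hK hz h2
  rw [h2.pairs_part, Local.summ, Local.summ, ← (hI.abaLE j i₀).opt_congr hL (h2.complete _) (hc _),
    ← (hI.abaLE j i₀).opt_congr hL (h2.complete _) (hc _)]
  rfl

theorem Inv.sum_sumShare (hI : Inv G K a b st) (hj : j ∉ K)
    (hs : j ∈ (st.glob i₀).sel G iter z) {x : Fin h → F}
    (hx : ∀ q, (st.glob i₀).sumShare G iter z j q = some (x q)) :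
    ∑ q, x q = ∑ pq ∈ (st.glob i₀).summ G iter z j, a pq.1 * b pq.2 := by
  obtain ⟨m, hm⟩ := Option.isSome_iff_exists.1 (OptState.mem_selected.1 hs)
  simp only [Local.sumShare, hm, Option.map_eq_some_iff] at hx
  obtain ⟨v, hv, -⟩ := hx z
  have hxv : x = v := funext fun q => by
    obtain ⟨w, hw, e⟩ := hx q
    rw [hv, Option.some_inj] at hw
    rw [← e, hw]
  have hv' : st.vss (.sum iter z m j) = some v := hv
  rw [hxv, (hI.dealt _ v hv hj).2,
    ← hI.pairs_sum (State.glob_abaLE st i₀ i₀) hj hm (by rw [hv']; rfl)]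
  rfl

theorem Inv.sum_partShare (hI : Inv G K a b st) (hQ : QCond 4 Finset.univ G.Z)
    (hK : G.Admissible K) (hz : (st.loc i).Conflict G iter z₀) (hj : j ∉ K) {x : Fin h → F}
    (hx : ∀ q, (st.glob i₀).partShare iter z j k q = some (x q)) :
    ∑ q, x q = ∑ pq ∈ (st.glob i₀).summ G iter z j ∩
      (st.glob i₀).summ G iter (G.opp iter z₀ z) k, a pq.1 * b pq.2 := by
  simp only [Local.partShare, Option.map_eq_some_iff] at hx
  obtain ⟨v, hv, -⟩ := hx z
  have hxv : x = v := funext fun q => by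
    obtain ⟨w, hw, e⟩ := hx q
    rw [hv, Option.some_inj] at hw
    rw [← e, hw]
  have hv' : st.vss (.part iter z j k) = some v := hv
  rw [hxv, (hI.dealt _ v hv hj).2, ← hI.pairs_part hQ hK (State.glob_abaLE st i₀ i₀)
    ((hI.abaLE i i₀).complete hz.complete) hz hj (by rw [hv']; rfl)]
  rfl

/-! #### Local discarding is sound -/

theorem forall_isSome_choose {ι α : Type*} {f : ι → Option α} (hf : ∀ i, (f i).isSome) :
    ∃ x : ι → α, ∀ i, f i = some (x i) :=
  ⟨fun i => (f i).get (hf i), fun _ => by simp⟩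

omit [DecidableEq F] in
theorem optSum_univ_eq_some {ι : Type*} [Fintype ι] {f : ι → Option F} {v : F}
    (hv : optSum Finset.univ f = some v) :
    ∃ x : ι → F, (∀ i, f i = some (x i)) ∧ ∑ i, x i = v := by
  obtain ⟨h1, h2⟩ := optSum_eq_some.1 hv
  obtain ⟨x, hx⟩ := forall_isSome_choose fun i => h1 i (Finset.mem_univ i)
  refine ⟨x, hx, ?_⟩
  rw [← h2]
  exact Finset.sum_congr rfl fun i _ => by rw [hx]; rfl

omit [DecidableEq F] in
/-- The total of the shares of a check value. -/
theorem sum_checkIn {v : F} (hv : optSum Finset.univ (L.checkIn G iter z₀ z j) = some v) :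
    ∃ (x : Fin h → F) (y : Fin n → Fin h → F),
      (∀ q, L.sumShare G iter z j q = some (x q)) ∧
      (∀ k ∈ L.sel G iter (G.opp iter z₀ z), ∀ q, L.partShare iter z j k q = some (y k q)) ∧
      v = ∑ q, x q - ∑ k ∈ L.sel G iter (G.opp iter z₀ z), ∑ q, y k q := by
  obtain ⟨w, hw, rfl⟩ := optSum_univ_eq_some hv
  have hw' := fun q => map₂_eq_some.1 (hw q)
  choose x s hx hs e using hw'
  refine ⟨x, fun k q => (L.partShare iter z j k q).getD 0, hx, fun k hk q => ?_, ?_⟩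
  · obtain ⟨u, hu⟩ := Option.isSome_iff_exists.1 ((optSum_eq_some.1 (hs q)).1 k hk)
    simp [hu]
  · rw [Finset.sum_comm, ← Finset.sum_sub_distrib]
    refine Finset.sum_congr rfl fun q _ => ?_
    rw [← e q, (optSum_eq_some.1 (hs q)).2]

/-- The pairs of the parties selected in the opposite instance cut the summands of an honest party
into pieces without overlap or loss, so its parts add up to its summand-sum. -/
theorem Inv.mem_of_checkVal (hI : Inv G K a b st) (hQ : QCond 4 Finset.univ G.Z)
    (hK : G.Admissible K) (hz : (st.loc i).Conflict G iter z₀) {v : F}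
    (hj : j ∈ (st.loc i).sel G iter z)
    (hv : (st.loc i).checkVal G iter z₀ z j = some v) (h0 : v ≠ 0) : j ∈ K := by
  by_contra hjK
  refine h0 ?_
  obtain ⟨x, y, hx, hy, rfl⟩ := sum_checkIn (hI.checkVal_sound hQ hK hz i hv)
  have hc := (hI.abaLE i i).complete hz.complete
  rw [hI.sum_sumShare hjK (by rwa [(hI.abaLE i i).sel_eq hz.complete]) hx,
    Finset.sum_congr rfl fun k hk => hI.sum_partShare hQ hK hz hjK (hy k hk), sub_eq_zero]
  exact ((hI.optGood (State.glob_abaLE st i i) iter _ n).sum_inter (hc _) _ _).symm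

/-- An honest party survives all three tests: its check value is zero, and in either role of a
mismatched pair its part equals the sum recomputed from correct input shares. -/
theorem Inv.LD_subset (hI : Inv G K a b st) (hQ : QCond 4 Finset.univ G.Z)
    (hK : G.Admissible K) (hj : j ∈ (st.loc i).LD G iter) : j ∈ K := by
  obtain ⟨z₀, hz, hj⟩ := hj
  have hc := hz.complete
  have hle := hI.abaLE i i
  rcases hj with ⟨z, h1, h2, v, h3, h4⟩ | ⟨k, hm, d, s, hd, hs, hne⟩ | ⟨k, hm, d, s, hd, hs, hne⟩
  · exact hI.mem_of_checkVal hQ hK hz h2 h3 h4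
  · by_contra hjK
    obtain ⟨x, hx, rfl⟩ := optSum_univ_eq_some (hI.partVal_sound hQ hK i hd)
    refine hne ?_
    rw [hI.sum_partShare hQ hK hz hjK hx, hI.commonVal_sound hQ hK hs, Setup.opp_left,
      hle.summ_eq hc, hle.summ_eq hc]
    rfl
  · by_contra hjK
    obtain ⟨x, hx, rfl⟩ := optSum_univ_eq_some (hI.partVal_sound hQ hK i hd)
    refine hne ?_
    rw [hI.sum_partShare hQ hK hz hjK hx, hI.commonVal_sound hQ hK hs,
      Setup.opp_ref (hI.ne_ref hQ hK hz), hle.summ_eq hc, hle.summ_eq hc, Finset.inter_comm]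
    rfl

/-! #### Products of honestly computed summands -/

/-- The partition of all pairs turns the honest summand-sums into the expansion of the product of
the two sums; unselected parties contribute the zero sharing. -/
theorem Inv.sum_prodShare (hI : Inv G K a b st) (hK' : ∀ j ∈ (st.glob i₀).sel G iter z, j ∉ K)
    {x : Fin h → F} (hx : ∀ q, (st.glob i₀).prodShare G iter z q = some (x q)) :
    ∑ q, x q = (∑ q, a q) * ∑ q, b q := by
  have hc : ((st.glob i₀).opt G iter z).summands = ∅ := by
    have := hx z
    unfold Local.prodShare at this
    by_contra hne
    simp [hne] at this
  have hsum : ∀ q, optSum Finset.univ (fun j => (st.glob i₀).sumShare G iter z j q)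
      = some (x q) := fun q => by
    have := hx q
    unfold Local.prodShare at this
    rwa [if_pos hc] at this
  choose y hy hye using fun q => optSum_univ_eq_some (hsum q)
  have hgood := hI.optGood (State.glob_abaLE st i₀ i₀) iter z n
  have hall := hgood.sum fun pq => a pq.1 * b pq.2
  rw [← Local.opt_eq_optAt, hc, Finset.sum_empty, add_zero] at hall
  rw [Finset.sum_mul_sum, ← Finset.sum_product', Finset.univ_product_univ, ← hall,
    ← Finset.sum_congr rfl fun q _ => hye q, Finset.sum_comm]
  symm
  refine Finset.sum_subset_zero_on_sdiff (Finset.subset_univ _) (fun j hj => ?_) fun j hj => ?_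
  · have hn : ((st.glob i₀).opt G iter z).hopOf j = none := by
      simpa [OptState.mem_selected] using hj
    refine Finset.sum_eq_zero fun q _ => ?_
    have := hy q j
    simp only [Local.sumShare, hn, Option.some_inj] at this
    exact this.symm
  · exact (hI.sum_sumShare (hK' j hj) hj fun q => hy q j).symm

omit [DecidableEq F] in
theorem sum_diffIn {v : F} (hv : optSum Finset.univ (L.diffIn G iter z) = some v) :
    ∃ x y : Fin h → F, (∀ q, L.prodShare G iter z q = some (x q)) ∧
      (∀ q, L.prodShare G iter (G.ref iter) q = some (y q)) ∧ v = ∑ q, x q - ∑ q, y q := by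
  obtain ⟨w, hw, rfl⟩ := optSum_univ_eq_some hv
  choose x y hx hy e using fun q => map₂_eq_some.1 (hw q)
  refine ⟨x, y, hx, hy, ?_⟩
  rw [← Finset.sum_sub_distrib]
  exact Finset.sum_congr rfl fun q _ => (e q).symm

/-- The output of a successful iteration is a sharing of the product. -/
theorem Inv.success (hI : Inv G K a b st) (hQ : QCond 4 Finset.univ G.Z)
    (hK : G.Admissible K) (hv : (st.loc i).verdict G iter = some none) (i₀ : Fin n) :
    ∃ c : Fin h → F, ∑ q, c q = (∑ q, a q) * ∑ q, b q ∧
      ∀ q, (st.glob i₀).prodShare G iter (G.ref iter) q = some (c q) := by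
  -- In the instance for a set containing all corrupt parties only honest parties are selected.
  -- Success identifies the reference product with this one, whoever was selected for the reference.
  obtain ⟨y, hy⟩ := hK
  obtain ⟨x, c, hx, hc, e⟩ := sum_diffIn
    (hI.diffVal_sound hQ ⟨y, hy⟩ i₀ (Local.diffVal_of_verdict hv y))
  refine ⟨c, ?_, hc⟩
  rw [← sub_eq_zero.1 e.symm]
  refine hI.sum_prodShare (i₀ := i₀) (z := y) (fun j hj hjK => ?_) hx
  exact (hI.optGood (State.glob_abaLE st i₀ i₀) iter y n).notMem j hj (hy hjK)

theorem Inv.not_conflict (hI : Inv G K a b st) (hQ : QCond 4 Finset.univ G.Z)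
    (hK : G.Admissible K) (hs : ∀ z, ∀ j ∈ (st.glob i).sel G iter z, j ∉ K) :
    ¬ (st.loc i).Conflict G iter z₀ := by
  intro hz
  obtain ⟨v, hv, h0⟩ := hz.diffVal
  obtain ⟨x, y, hx, hy, e⟩ := sum_diffIn (hI.diffVal_sound hQ hK i hv)
  rw [hI.sum_prodShare (hs _) hx, hI.sum_prodShare (hs _) hy, sub_self] at e
  exact h0 e

/-! #### Globally discarded parties and the number of iterations -/

theorem Inv.GD_agree (hI : Inv G K a b st) (hi : (st.loc i).Reached G iter)
    (hj : (st.loc j).Reached G iter) : (st.loc j).GD G iter = (st.loc i).GD G iter := by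
  rw [← (hI.abaLE i i).GD_eq hi, ← (hI.abaLE j i).GD_eq hj]

/-- Selection requires an honest vote, honest voters reject discarded parties, and the discarded set
is the same for all who have reached the iteration. -/
theorem Inv.notMem_GD_of_sel (hI : Inv G K a b st) (hi : (st.loc i).Reached G iter)
    (hL : L.AbaLE (st.glob i₀)) (hj : j ∈ L.sel G iter z) : j ∉ (st.loc i).GD G iter := by
  obtain ⟨m, hm⟩ := Option.isSome_iff_exists.1 (OptState.mem_selected.1 hj)
  obtain ⟨h1, -, h3, -⟩ := Local.optAt_hopOf G hm
  obtain ⟨-, -, i', hi', hv⟩ := hI.fresh hL h3 h1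
  rw [← hI.GD_agree hi hv.1.1]
  exact hv.2.1

theorem Inv.discard (hI : Inv G K a b st) (hQ : QCond 4 Finset.univ G.Z)
    (hK : G.Admissible K) (hi : (st.loc i).Reached G iter)
    (hw : (st.loc i).winner (AbaId.discard iter) = some j) :
    j ∈ K ∧ j ∉ (st.loc i).GD G iter := by
  obtain ⟨i', -, hv⟩ := hI.exists_voter (hI.abaLE i i) hw
  obtain ⟨h1, ⟨r, -, -, hr⟩, h3⟩ := hv
  exact ⟨hI.LD_subset hQ hK hr, by rwa [← hI.GD_agree hi h1.1]⟩

theorem Setup.Admissible.card_le (hK : G.Admissible K) : K.card ≤ G.t := by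
  obtain ⟨z, hz⟩ := hK
  exact (Finset.card_le_card hz).trans (Finset.le_sup (f := fun z => (G.Z z).card) (Finset.mem_univ z))

theorem Setup.block_pos : 0 < G.block := Nat.succ_pos _

theorem Local.Reached.of_le {iter' : ℕ} (hr : L.Reached G iter) (h1 : 1 ≤ iter')
    (hle : iter' ≤ iter) : L.Reached G iter' :=
  ⟨h1, fun r h2 h3 => hr.2 r h2 (h3.trans_le hle)⟩

/-- Every completed block discards a corrupt party not discarded before. There are at most `t`
corrupt parties, so `t` blocks exhaust them. -/
theorem Inv.subset_GD (hI : Inv G K a b st) (hQ : QCond 4 Finset.univ G.Z)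
    (hK : G.Admissible K) (hi : (st.loc i).Reached G iter) (ht : G.t * G.block < iter) :
    ∀ j ∈ K, j ∈ (st.loc i).GD G iter := by
  have hlt : ∀ s : Fin G.t, (s + 1) * G.block < iter := fun s =>
    (Nat.mul_le_mul_right _ s.2).trans_lt ht
  have hpos : ∀ s : Fin G.t, 1 ≤ (s + 1) * G.block := fun s =>
    Nat.mul_pos (Nat.succ_pos _) Setup.block_pos
  have hw : ∀ s : Fin G.t, ∃ j, (st.loc i).winner (AbaId.discard ((s + 1) * G.block)) = some j :=
    fun s => Option.isSome_iff_exists.1 ((hi.2 _ (hpos s) (hlt s)).2 (Dvd.intro_left _ rfl))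
  choose w hw using hw
  have hd := fun s => hI.discard hQ hK (hi.of_le (hpos s) (hlt s).le) (hw s)
  have hinj : Function.Injective w := by
    have key : ∀ s s' : Fin G.t, s < s' → w s ≠ w s' := fun s s' hss he => by
      refine (hd s').2 ⟨_, hpos s, ?_, Dvd.intro_left _ rfl, (hw s).trans (by rw [he])⟩
      exact Nat.mul_lt_mul_of_pos_right (by simpa using hss) Setup.block_pos
    intro s s' he
    rcases lt_trichotomy s s' with hlt | heq | hgt
    · exact absurd he (key s s' hlt)
    · exact heq
    · exact absurd he.symm (key s' s hgt)
  have himg : Finset.univ.image w = K := by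
    refine Finset.eq_of_subset_of_card_le (fun j hj => ?_) ?_
    · obtain ⟨s, -, rfl⟩ := Finset.mem_image.1 hj
      exact (hd s).1
    · rw [Finset.card_image_of_injective _ hinj, Finset.card_univ, Fintype.card_fin]
      exact hK.card_le
  intro j hj
  rw [← himg] at hj
  obtain ⟨s, -, rfl⟩ := Finset.mem_image.1 hj
  exact ⟨_, hpos s, hlt s, Dvd.intro_left _ rfl, hw s⟩

/-- Beyond this point all corrupt parties have been discarded, so only honest ones are selected, all
instances yield the same product, and no difference is non-zero. -/
theorem Inv.conflict_le (hI : Inv G K a b st) (hQ : QCond 4 Finset.univ G.Z)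
    (hK : G.Admissible K) (hi : (st.loc i).Reached G iter)
    (hz : (st.loc i).Conflict G iter z₀) : iter ≤ G.t * G.block := by
  by_contra hlt
  push Not at hlt
  exact hI.not_conflict hQ hK (fun z j hj hjK =>
    hI.notMem_GD_of_sel hi (State.glob_abaLE st i i) hj (hI.subset_GD hQ hK hi hlt j hjK)) hz

theorem Inv.reached_le (hI : Inv G K a b st) (hQ : QCond 4 Finset.univ G.Z)
    (hK : G.Admissible K) (hi : (st.loc i).Reached G iter) : iter ≤ G.t * G.block + 1 := by
  rcases hi.1.eq_or_lt with h1 | h1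
  · omega
  · obtain ⟨⟨z, hz⟩, -⟩ := hi.2 (iter - 1) (by omega) (by omega)
    have := hI.conflict_le hQ hK (hi.of_le (by omega) (by omega)) hz
    omega

/-- Successful iterations agree. -/
theorem Inv.success_agree (hI : Inv G K a b st) (hQ : QCond 4 Finset.univ G.Z)
    (hK : G.Admissible K) {iter' : ℕ} (hi : (st.loc i).Reached G iter)
    (hv : (st.loc i).verdict G iter = some none) (hj : (st.loc j).Reached G iter')
    (hv' : (st.loc j).verdict G iter' = some none) : iter = iter' := by
  have key : ∀ {i j : Fin n} {r r' : ℕ}, (st.loc i).Reached G r →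
      (st.loc i).verdict G r = some none → (st.loc j).Reached G r' → ¬ r < r' := by
    intro i j r r' h1 h2 h3 hlt
    obtain ⟨⟨z, hz⟩, -⟩ := h3.2 r h1.1 hlt
    simpa using hI.verdict_agree hQ hK h2 hz
  exact le_antisymm (not_lt.1 (key hj hv' hi)) (not_lt.1 (key hi hv hj))

end Safety

/-! ### Shifting the unknown shares -/

section Shift
variable {n h : ℕ} {F : Type*} [Field F] [DecidableEq F] {G : Setup n h} {K : Finset (Fin n)}

omit [DecidableEq F] in
theorem optSum_map_add {ι : Type*} (s : Finset ι) (f : ι → Option F) (c : ι → F) :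
    optSum s (fun i => (f i).map (· + c i)) = (optSum s f).map (· + ∑ i ∈ s, c i) := by
  unfold optSum
  simp only [Option.isSome_map]
  split_ifs with hs
  · rw [Option.map_some, ← Finset.sum_add_distrib]
    refine congrArg some (Finset.sum_congr rfl fun i hi => ?_)
    obtain ⟨v, hv⟩ := Option.isSome_iff_exists.1 (hs i hi)
    simp [hv]
  · rfl

omit [DecidableEq F] in
theorem map₂_sub_map_add (x y : Option F) (c : F) :
    Option.map₂ (· - ·) (x.map (· + c)) (y.map (· + c)) = Option.map₂ (· - ·) x y := by
  cases x <;> cases y <;> simp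

/-- The change of the sum of the given summands when the inputs change. -/
def gap (a b a' b' : Fin h → F) (P : Finset (Fin h × Fin h)) : F :=
  ∑ pq ∈ P, (a' pq.1 * b' pq.2 - a pq.1 * b pq.2)

variable (G) in
/-- The local state after a change of the inputs to `a'`, `b'` and of the `q₀`-th shares. -/
def Local.shift (a' b' : Fin h → F) (q₀ : Fin h) (δ : VssId n h → F) (L : Local n h F) :
    Local n h F :=
  { L with
    a := fun q => if L.me ∈ G.S q then a' q else 0
    b := fun q => if L.me ∈ G.S q then b' q else 0
    vss := fun sid => (L.vss sid).map fun w q =>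
      w q + if q = q₀ ∧ L.me ∈ G.S q then δ sid else 0 }

variable (G) in
/-- The properties of a local state that make the change of the shares invisible. -/
structure Local.Fits (a b a' b' : Fin h → F) (δ : VssId n h → F) (L : Local n h F) : Prop where
  inputA : L.a = fun q => if L.me ∈ G.S q then a q else 0
  inputB : L.b = fun q => if L.me ∈ G.S q then b q else 0
  sum : ∀ iter z j m, (L.opt G iter z).hopOf j = some m → (L.vss (.sum iter z m j)).isSome →
    δ (.sum iter z m j) = gap a b a' b' (L.summ G iter z j)
  part : ∀ iter z₀, L.Conflict G iter z₀ → ∀ z j k, (L.vss (.part iter z j k)).isSome →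
    δ (.part iter z j k) =
      gap a b a' b' (L.summ G iter z j ∩ L.summ G iter (G.opp iter z₀ z) k)
  inter : ∀ iter z, (L.opt G iter z).summands = ∅ → ∀ P,
    ∑ k ∈ L.sel G iter z, gap a b a' b' (P ∩ L.summ G iter z k) = gap a b a' b' P
  ne_ref : ∀ iter z₀, L.Conflict G iter z₀ → z₀ ≠ G.ref iter
  known : ∀ iter z₀, L.Conflict G iter z₀ → ∀ j k, L.Mismatch G iter z₀ j k →
    ∀ pq ∈ L.common G iter z₀ j k, (a' pq.1 = a pq.1 ∧ b' pq.1 = b pq.1) ∧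
      (a' pq.2 = a pq.2 ∧ b' pq.2 = b pq.2)

/-- Whether a party deals is a matter of control flow, independent of the value dealt; this is what
stays the same when the inputs change. -/
theorem Local.deals_exists_iff {L : Local n h F} {sid : VssId n h} :
    (∃ c, L.Deals G c sid) ↔ match sid with
      | .sum iter z hop j => j = L.me ∧ L.InHop G iter z hop ∧ j ∉ G.Z z ∧ j ∉ L.sel G iter z
      | .part iter z j k => j = L.me ∧ L.Reached G iter ∧ ∃ z₀, L.Conflict G iter z₀ ∧
          (z = z₀ ∨ z = G.ref iter) ∧ j ∈ L.sel G iter z ∧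
            k ∈ L.sel G iter (G.opp iter z₀ z) := by
  cases sid with
  | sum iter z hop j =>
    exact ⟨fun ⟨c, h1, h2, h3, h4, h5⟩ => ⟨h1, h2, h3, h4⟩,
      fun ⟨h1, h2, h3, h4⟩ => ⟨_, h1, h2, h3, h4, rfl⟩⟩
  | part iter z j k =>
    exact ⟨fun ⟨c, h1, h2, z₀, h3, h4, h5, h6, h7⟩ => ⟨h1, h2, z₀, h3, h4, h5, h6⟩,
      fun ⟨h1, h2, z₀, h3, h4, h5, h6⟩ => ⟨_, h1, h2, z₀, h3, h4, h5, h6, rfl⟩⟩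

namespace Local.Fits
variable {a b a' b' : Fin h → F} {q₀ : Fin h} {δ : VssId n h → F} {L : Local n h F}
  {iter : ℕ} {z z₀ : Fin h} {j k : Fin n} {q : Fin h}

omit [DecidableEq F] in
theorem shift_opt : (L.shift G a' b' q₀ δ).opt G iter z = L.opt G iter z := rfl

omit [DecidableEq F] in
theorem shift_vss_eq_none {sid : VssId n h} :
    (L.shift G a' b' q₀ δ).vss sid = none ↔ L.vss sid = none := Option.map_eq_none_iff

theorem shift_sumShare (hL : L.Fits G a b a' b' δ) :
    (L.shift G a' b' q₀ δ).sumShare G iter z j q = (L.sumShare G iter z j q).map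
      (· + if q = q₀ ∧ L.me ∈ G.S q then
        (if j ∈ L.sel G iter z then gap a b a' b' (L.summ G iter z j) else 0) else 0) := by
  unfold Local.sumShare
  rw [shift_opt]
  cases hm : (L.opt G iter z).hopOf j with
  | none =>
    have : j ∉ L.sel G iter z := by simp [Local.sel, OptState.mem_selected, hm]
    simp [this]
  | some m =>
    have : j ∈ L.sel G iter z := by simp [Local.sel, OptState.mem_selected, hm]
    simp only [this, if_true]
    cases hv : L.vss (.sum iter z m j) with
    | none => simp [Local.shift, hv]
    | some w =>
      rw [← hL.sum iter z j m hm (by simp [hv])]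
      simp [Local.shift, hv]

/-- The change is the gap of all pairs, whichever set the instance belongs to and whoever was
selected. It therefore cancels in the differences of products. -/
theorem shift_prodShare (hL : L.Fits G a b a' b' δ) :
    (L.shift G a' b' q₀ δ).prodShare G iter z q = (L.prodShare G iter z q).map
      (· + if q = q₀ ∧ L.me ∈ G.S q then gap a b a' b' Finset.univ else 0) := by
  unfold Local.prodShare
  rw [shift_opt]
  split_ifs with hs hq
  · simp only [hL.shift_sumShare, if_pos hq]
    rw [optSum_map_add, Finset.sum_ite_mem, Finset.univ_inter]
    have := hL.inter iter z hs Finset.univ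
    simp only [Finset.univ_inter] at this
    rw [this]
  · simp only [hL.shift_sumShare, if_neg hq]
    rw [optSum_map_add, Finset.sum_const_zero]
  · rfl
  · rfl

theorem shift_diffIn (hL : L.Fits G a b a' b' δ) :
    (L.shift G a' b' q₀ δ).diffIn G iter z = L.diffIn G iter z := by
  ext1 q
  unfold Local.diffIn
  rw [hL.shift_prodShare, hL.shift_prodShare, map₂_sub_map_add]

theorem shift_partShare (hL : L.Fits G a b a' b' δ) (hz : L.Conflict G iter z₀) :
    (L.shift G a' b' q₀ δ).partShare iter z j k q = (L.partShare iter z j k q).map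
      (· + if q = q₀ ∧ L.me ∈ G.S q then
        gap a b a' b' (L.summ G iter z j ∩ L.summ G iter (G.opp iter z₀ z) k) else 0) := by
  unfold Local.partShare
  cases hv : L.vss (.part iter z j k) with
  | none => simp [Local.shift, hv]
  | some w =>
    rw [← hL.part iter z₀ hz z j k (by simp [hv])]
    simp [Local.shift, hv]

/-- The changes of the parts are gaps of pieces that partition the summands of `j`, so their total
cancels the change of the summand-sum. -/
theorem shift_checkIn (hL : L.Fits G a b a' b' δ) (hz : L.Conflict G iter z₀)
    (hj : j ∈ L.sel G iter z) :
    (L.shift G a' b' q₀ δ).checkIn G iter z₀ z j = L.checkIn G iter z₀ z j := by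
  ext1 q
  unfold Local.checkIn
  rw [hL.shift_sumShare]
  simp only [hL.shift_partShare hz, if_pos hj]
  rw [show (L.shift G a' b' q₀ δ).sel G iter (G.opp iter z₀ z) = L.sel G iter (G.opp iter z₀ z)
    from rfl, optSum_map_add]
  by_cases hq : q = q₀ ∧ L.me ∈ G.S q
  · simp only [if_pos hq]
    rw [hL.inter iter _ (hz.complete _), map₂_sub_map_add]
  · simp only [if_neg hq, Finset.sum_const_zero]
    rw [map₂_sub_map_add]

/-- Both parts concern the same intersection of summands and move equally. The conflicting sets must
differ for `Setup.opp` to exchange them. -/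
theorem shift_pairIn (hL : L.Fits G a b a' b' δ) (hz : L.Conflict G iter z₀) :
    (L.shift G a' b' q₀ δ).pairIn G iter z₀ j k = L.pairIn G iter z₀ j k := by
  ext1 q
  unfold Local.pairIn
  rw [hL.shift_partShare hz, hL.shift_partShare hz, Setup.opp_left,
    Setup.opp_ref (hL.ne_ref iter z₀ hz), Finset.inter_comm (L.summ G iter (G.ref iter) k),
    map₂_sub_map_add]

/-- Parts and inputs are opened only after a mismatch, and by `Fits.known` the inputs do not change
on the common summands of a mismatched pair. -/
theorem gap_common (hL : L.Fits G a b a' b' δ) (hz : L.Conflict G iter z₀)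
    (hm : L.Mismatch G iter z₀ j k) : gap a b a' b' (L.common G iter z₀ j k) = 0 := by
  refine Finset.sum_eq_zero fun pq hpq => ?_
  obtain ⟨⟨h1, -⟩, -, h4⟩ := hL.known iter z₀ hz j k hm pq hpq
  rw [h1, h4, sub_self]

theorem shift_partShare_left (hL : L.Fits G a b a' b' δ) (hz : L.Conflict G iter z₀)
    (hm : L.Mismatch G iter z₀ j k) :
    (L.shift G a' b' q₀ δ).partShare iter z₀ j k = L.partShare iter z₀ j k := by
  ext1 q
  rw [hL.shift_partShare hz, Setup.opp_left]
  have := hL.gap_common hz hm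
  unfold Local.common at this
  simp [this]

theorem shift_partShare_right (hL : L.Fits G a b a' b' δ) (hz : L.Conflict G iter z₀)
    (hm : L.Mismatch G iter z₀ k j) :
    (L.shift G a' b' q₀ δ).partShare iter (G.ref iter) j k = L.partShare iter (G.ref iter) j k := by
  ext1 q
  rw [hL.shift_partShare hz, Setup.opp_ref (hL.ne_ref iter z₀ hz), Finset.inter_comm]
  have := hL.gap_common hz hm
  unfold Local.common at this
  simp [this]

theorem shift_recValue {own own' : Fin h → Option F} {r : RecId n h} (ho : own' = own) :
    (L.shift G a' b' q₀ δ).recValue G r own' = L.recValue G r own := by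
  rw [ho]; rfl

theorem shift_diffVal (hL : L.Fits G a b a' b' δ) :
    (L.shift G a' b' q₀ δ).diffVal G iter z = L.diffVal G iter z :=
  shift_recValue hL.shift_diffIn

theorem shift_verdict (hL : L.Fits G a b a' b' δ) :
    (L.shift G a' b' q₀ δ).verdict G iter = L.verdict G iter := by
  unfold Local.verdict
  simp only [hL.shift_diffVal, shift_opt]

theorem shift_conflict (hL : L.Fits G a b a' b' δ) :
    (L.shift G a' b' q₀ δ).Conflict G iter z₀ ↔ L.Conflict G iter z₀ := by
  unfold Local.Conflict
  rw [hL.shift_verdict]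

theorem shift_checkVal (hL : L.Fits G a b a' b' δ) (hz : L.Conflict G iter z₀)
    (hj : j ∈ L.sel G iter z) :
    (L.shift G a' b' q₀ δ).checkVal G iter z₀ z j = L.checkVal G iter z₀ z j :=
  shift_recValue (hL.shift_checkIn hz hj)

theorem shift_mismatch (hL : L.Fits G a b a' b' δ) (hz : L.Conflict G iter z₀) :
    (L.shift G a' b' q₀ δ).Mismatch G iter z₀ j k ↔ L.Mismatch G iter z₀ j k := by
  unfold Local.Mismatch
  rw [show (L.shift G a' b' q₀ δ).pairVal G iter z₀ j k = L.pairVal G iter z₀ j k from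
    shift_recValue (hL.shift_pairIn hz)]
  rfl

theorem shift_commonVal (hL : L.Fits G a b a' b' δ) (hz : L.Conflict G iter z₀)
    (hm : L.Mismatch G iter z₀ j k) :
    (L.shift G a' b' q₀ δ).commonVal G iter z₀ j k = L.commonVal G iter z₀ j k := by
  unfold Local.commonVal
  rw [show (L.shift G a' b' q₀ δ).common G iter z₀ j k = L.common G iter z₀ j k from rfl]
  refine optSum_congr fun pq hpq => ?_
  obtain ⟨⟨h1, -⟩, -, h4⟩ := hL.known iter z₀ hz j k hm pq hpq
  congr 1
  · unfold Local.recShare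
    rw [hL.inputA]
    simp only [Local.shift, h1]
    rfl
  · unfold Local.recShare
    rw [hL.inputB]
    simp only [Local.shift, h4]
    rfl

theorem shift_W (hL : L.Fits G a b a' b' δ) :
    (L.shift G a' b' q₀ δ).W G iter = L.W G iter := by
  unfold Local.W
  simp only [hL.shift_conflict, shift_vss_eq_none]
  rfl

theorem shift_LD (hL : L.Fits G a b a' b' δ) :
    (L.shift G a' b' q₀ δ).LD G iter = L.LD G iter := by
  ext j
  unfold Local.LD
  simp only [Set.mem_ofPred_eq, hL.shift_conflict]
  refine exists_congr fun z₀ => and_congr_right fun hz => or_congr ?_ (or_congr ?_ ?_)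
  · refine exists_congr fun z => and_congr_right fun _ => and_congr_right fun hj => ?_
    rw [hL.shift_checkVal hz hj]
  · refine exists_congr fun k => ?_
    rw [hL.shift_mismatch hz]
    refine and_congr_right fun hm => ?_
    rw [hL.shift_commonVal hz hm, show (L.shift G a' b' q₀ δ).partVal G iter z₀ j k =
      L.partVal G iter z₀ j k from shift_recValue (hL.shift_partShare_left hz hm)]
  · refine exists_congr fun k => ?_
    rw [hL.shift_mismatch hz]
    refine and_congr_right fun hm => ?_
    rw [hL.shift_commonVal hz hm, show (L.shift G a' b' q₀ δ).partVal G iter (G.ref iter) j k =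
      L.partVal G iter (G.ref iter) j k from shift_recValue (hL.shift_partShare_right hz hm)]

theorem shift_reached (hL : L.Fits G a b a' b' δ) :
    (L.shift G a' b' q₀ δ).Reached G iter ↔ L.Reached G iter := by
  unfold Local.Reached
  simp only [hL.shift_conflict]
  rfl

theorem shift_inHop (hL : L.Fits G a b a' b' δ) {hop : ℕ} :
    (L.shift G a' b' q₀ δ).InHop G iter z hop ↔ L.InHop G iter z hop := by
  unfold Local.InHop
  rw [hL.shift_reached]
  rfl

theorem shift_inDiscard (hL : L.Fits G a b a' b' δ) :
    (L.shift G a' b' q₀ δ).InDiscard G iter ↔ L.InDiscard G iter := by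
  unfold Local.InDiscard
  simp only [hL.shift_reached, hL.shift_conflict]

theorem shift_deals (hL : L.Fits G a b a' b' δ) {sid : VssId n h} :
    (∃ c, (L.shift G a' b' q₀ δ).Deals G c sid) ↔ ∃ c, L.Deals G c sid := by
  rw [Local.deals_exists_iff, Local.deals_exists_iff]
  cases sid with
  | sum iter z hop j => simp only [hL.shift_inHop]; rfl
  | part iter z j k => simp only [hL.shift_reached, hL.shift_conflict]; rfl

theorem shift_requestsVss (hL : L.Fits G a b a' b' δ) {sid : VssId n h} :
    (L.shift G a' b' q₀ δ).RequestsVss G sid ↔ L.RequestsVss G sid := by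
  cases sid with
  | sum iter z hop j => simp only [Local.RequestsVss, hL.shift_reached, hL.shift_inHop]; rfl
  | part iter z j k => simp only [Local.RequestsVss, hL.shift_reached, hL.shift_conflict]; rfl

theorem shift_requestsAba (hL : L.Fits G a b a' b' δ) {sid : AbaId n h} :
    (L.shift G a' b' q₀ δ).RequestsAba G sid ↔ L.RequestsAba G sid := by
  cases sid with
  | select iter z hop j => simp only [Local.RequestsAba, hL.shift_reached, hL.shift_inHop]; rfl
  | discard iter j => simp only [Local.RequestsAba, hL.shift_inDiscard]

theorem shift_mayVote (hL : L.Fits G a b a' b' δ) {sid : AbaId n h} {v : Bool} :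
    (L.shift G a' b' q₀ δ).MayVote G sid v ↔ L.MayVote G sid v := by
  cases sid with
  | select iter z hop j =>
    cases v with
    | true =>
      simp only [Local.MayVote, hL.shift_inHop, hL.shift_W, hL.shift_LD, ne_eq, shift_vss_eq_none]
      rfl
    | false => simp only [Local.MayVote, hL.shift_inHop]; rfl
  | discard iter j =>
    cases v with
    | true => simp only [Local.MayVote, hL.shift_inDiscard, hL.shift_LD]; rfl
    | false => simp only [Local.MayVote, hL.shift_inDiscard]; rfl

theorem shift_contributes (hL : L.Fits G a b a' b' δ) {v : F} {r : RecId n h} :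
    (L.shift G a' b' q₀ δ).Contributes G q v r ↔ L.Contributes G q v r := by
  cases r with
  | diff iter z => simp only [Local.Contributes, hL.shift_reached, hL.shift_diffIn]
  | check iter z j =>
    simp only [Local.Contributes, hL.shift_reached, hL.shift_conflict]
    refine and_congr_right fun _ => exists_congr fun z₀ => and_congr_right fun hz =>
      and_congr_right fun _ => and_congr_right fun hj => ?_
    rw [hL.shift_checkIn hz hj]
  | pair iter j k =>
    simp only [Local.Contributes, hL.shift_reached, hL.shift_conflict]
    refine and_congr_right fun _ => exists_congr fun z₀ => and_congr_right fun hz => ?_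
    rw [hL.shift_pairIn hz]
    rfl
  | part iter z j k =>
    simp only [Local.Contributes, hL.shift_reached, hL.shift_conflict]
    refine and_congr_right fun _ => exists_congr fun z₀ => and_congr_right fun hz => ?_
    rw [hL.shift_mismatch hz, hL.shift_mismatch hz]
    refine and_congr_right fun hm => ?_
    rcases hm with ⟨rfl, hm⟩ | ⟨rfl, hm⟩
    · rw [hL.shift_partShare_left hz hm]
    · rw [hL.shift_partShare_right hz hm]
  | inputA iter j k =>
    simp only [Local.Contributes, hL.shift_reached, hL.shift_conflict]
    refine and_congr_right fun _ => exists_congr fun z₀ => and_congr_right fun hz => ?_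
    rw [hL.shift_mismatch hz]
    refine and_congr_right fun hm => and_congr_right fun ⟨p, hp⟩ => ?_
    obtain ⟨⟨h1, -⟩, -⟩ := hL.known iter z₀ hz j k hm _ hp
    rw [hL.inputA]
    dsimp only at h1
    simp only [Local.shift, h1]
  | inputB iter j k =>
    simp only [Local.Contributes, hL.shift_reached, hL.shift_conflict]
    refine and_congr_right fun _ => exists_congr fun z₀ => and_congr_right fun hz => ?_
    rw [hL.shift_mismatch hz]
    refine and_congr_right fun hm => and_congr_right fun ⟨p, hp⟩ => ?_
    obtain ⟨-, -, h1⟩ := hL.known iter z₀ hz j k hm _ hp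
    rw [hL.inputB]
    dsimp only at h1
    simp only [Local.shift, h1]

theorem shift_pairs (hL : L.Fits G a b a' b' δ) {sid : VssId n h} :
    (L.shift G a' b' q₀ δ).pairs G sid = L.pairs G sid := by
  cases sid with
  | sum iter z hop j => rfl
  | part iter z j k => simp only [Local.pairs, hL.shift_verdict]; rfl

end Local.Fits
end Shift

/-! ### Privacy -/

section Privacy
variable {n h : ℕ} {F : Type*} [Field F] [DecidableEq F] {G : Setup n h} {K : Finset (Fin n)}
  {a b a' b' : Fin h → F} {q₀ : Fin h} {st : State n h F}

variable (G) in
/-- The change of the value shared in an instance when the inputs change. -/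
noncomputable def State.gap (a b a' b' : Fin h → F) (st : State n h F) (sid : VssId n h) : F :=
  AsyncMult.gap a b a' b' ((st.loc sid.dealer).pairs G sid)

omit [Field F] [DecidableEq F] in
theorem Local.mem_S_of_summ {L : Local n h F} {iter : ℕ} {z : Fin h} {j : Fin n}
    {pq : Fin h × Fin h} (hpq : pq ∈ L.summ G iter z j) : j ∈ G.S pq.1 ∧ j ∈ G.S pq.2 :=
  Local.mem_S_of_own G hpq

omit [DecidableEq F] in
-- A corrupt owner of the pairs holds all the shares involved, and on these the two inputs agree.
theorem gap_eq_zero (hkn : ∀ q, Known G K q → a q = a' q ∧ b q = b' q)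
    {P : Finset (Fin h × Fin h)} {j : Fin n} (hj : j ∈ K)
    (hP : ∀ pq ∈ P, j ∈ G.S pq.1 ∧ j ∈ G.S pq.2) : gap a b a' b' P = 0 := by
  refine Finset.sum_eq_zero fun pq hpq => ?_
  rw [(hkn pq.1 ⟨j, hj, (hP pq hpq).1⟩).1, (hkn pq.2 ⟨j, hj, (hP pq hpq).2⟩).2, sub_self]

/-- Two honest parties share the same sum over their common pairs, so a non-zero difference
implicates at least one corrupt party. -/
theorem Inv.mismatch (hI : Inv G K a b st) (hQ : QCond 4 Finset.univ G.Z) (hK : G.Admissible K)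
    {i j k : Fin n} {iter : ℕ} {z₀ : Fin h} (hz : (st.loc i).Conflict G iter z₀)
    (hm : (st.loc i).Mismatch G iter z₀ j k) : j ∈ K ∨ k ∈ K := by
  by_contra hc
  push Not at hc
  obtain ⟨-, -, v, hv, h0⟩ := hm
  obtain ⟨w, hw, rfl⟩ := optSum_univ_eq_some (hI.pairVal_sound hQ hK hz i hv)
  choose x y hx hy e using fun q => map₂_eq_some.1 (hw q)
  refine h0 ?_
  rw [Finset.sum_congr rfl fun q _ => (e q).symm, Finset.sum_sub_distrib,
    hI.sum_partShare hQ hK hz hc.1 hx, hI.sum_partShare hQ hK hz hc.2 hy, Setup.opp_left,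
    Setup.opp_ref (hI.ne_ref hQ hK hz), Finset.inter_comm, sub_self]

/-- Nothing is known about the values of corrupt dealers, but their pairs involve only known shares,
so all their gaps vanish. For honest dealers the pairs actually used are those that every party
attributes to them. -/
theorem Inv.fits (hI : Inv G K a b st) (hQ : QCond 4 Finset.univ G.Z) (hK : G.Admissible K)
    (hkn : ∀ q, Known G K q → a q = a' q ∧ b q = b' q) (i : Fin n) :
    (st.loc i).Fits G a b a' b' (st.gap G a b a' b') := by
  have hs : ∀ sid, ((st.loc i).vss sid).isSome → (st.vss sid).isSome := fun sid hs => by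
    obtain ⟨w, hw⟩ := Option.isSome_iff_exists.1 hs
    obtain ⟨v, hv, -⟩ := hI.vss i sid w hw
    simp [hv]
  refine ⟨?_, ?_, ?_, ?_, ?_, ?_, ?_⟩
  · rw [hI.me]; exact hI.inputA i
  · rw [hI.me]; exact hI.inputB i
  · intro iter z j m hm hv
    by_cases hj : j ∈ K
    · rw [State.gap, gap_eq_zero hkn hj fun pq hpq => Local.mem_S_of_pairs hpq,
        gap_eq_zero hkn hj fun pq hpq => Local.mem_S_of_summ hpq]
    · rw [State.gap, ← hI.pairs_sum (hI.abaLE i i) hj hm (hs _ hv)]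
      rfl
  · intro iter z₀ hz z j k hv
    by_cases hj : j ∈ K
    · rw [State.gap, gap_eq_zero hkn hj fun pq hpq => Local.mem_S_of_pairs hpq,
        gap_eq_zero hkn hj fun pq hpq => Local.mem_S_of_summ (Finset.mem_inter.1 hpq).1]
    · rw [State.gap, ← hI.pairs_part hQ hK (hI.abaLE i i) hz.complete hz hj (hs _ hv)]
      rfl
  · intro iter z hc P
    exact (hI.optGood (hI.abaLE i i) iter z n).sum_inter hc P _
  · exact fun iter z₀ hz => hI.ne_ref hQ hK hz
  · intro iter z₀ hz j k hm pq hpq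
    have hpq := Finset.mem_inter.1 hpq
    have key : ∀ j ∈ K, j ∈ G.S pq.1 ∧ j ∈ G.S pq.2 → (a' pq.1 = a pq.1 ∧ b' pq.1 = b pq.1) ∧
        (a' pq.2 = a pq.2 ∧ b' pq.2 = b pq.2) := fun j hj hS => by
      have h1 := hkn pq.1 ⟨j, hj, hS.1⟩
      have h2 := hkn pq.2 ⟨j, hj, hS.2⟩
      exact ⟨⟨h1.1.symm, h1.2.symm⟩, h2.1.symm, h2.2.symm⟩
    rcases hI.mismatch hQ hK hz hm with hj | hk
    · exact key j hj (Local.mem_S_of_own G hpq.1)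
    · exact key k hk (Local.mem_S_of_own G hpq.2)

variable (G) in
/-- The state after a change of the inputs to `a'`, `b'` and of the `q₀`-th shares. -/
def State.shift (a' b' : Fin h → F) (q₀ : Fin h) (δ : VssId n h → F) (st : State n h F) :
    State n h F where
  loc := fun i => (st.loc i).shift G a' b' q₀ δ
  vss := fun sid => (st.vss sid).map (· + Pi.single q₀ (δ sid))
  aba := st.aba
  sent := st.sent

omit [DecidableEq F] in
theorem State.shift_setLoc {δ : VssId n h → F} {i : Fin n} {L : Local n h F} :
    (st.setLoc i L).shift G a' b' q₀ δ =
      (st.shift G a' b' q₀ δ).setLoc i (L.shift G a' b' q₀ δ) := by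
  unfold State.shift State.setLoc
  congr 1
  ext1 j
  by_cases hj : j = i
  · subst hj; simp
  · simp [hj]

omit [DecidableEq F] in
theorem State.shift_update {δ : VssId n h → F} {sid : VssId n h} {v : Fin h → F} :
    ({ st with vss := Function.update st.vss sid (some v) } : State n h F).shift G a' b' q₀ δ =
      { st.shift G a' b' q₀ δ with
        vss := Function.update (st.shift G a' b' q₀ δ).vss sid (some (v + Pi.single q₀ (δ sid))) } := by
  unfold State.shift
  congr 1
  ext1 s
  by_cases hs : s = sid
  · subst hs; simp
  · simp [hs]

theorem State.shift_congr (hI : Inv G K a b st) {δ δ' : VssId n h → F}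
    (hδ : ∀ sid, (st.vss sid).isSome → δ sid = δ' sid) :
    st.shift G a' b' q₀ δ = st.shift G a' b' q₀ δ' := by
  unfold State.shift
  congr 1
  · ext1 i
    unfold Local.shift
    congr 1
    ext1 sid
    cases hw : (st.loc i).vss sid with
    | none => rfl
    | some w =>
      obtain ⟨v, hv, -⟩ := hI.vss i sid w hw
      rw [hδ sid (by simp [hv])]
  · ext1 sid
    cases hv : st.vss sid with
    | none => rfl
    | some v => rw [hδ sid (by simp [hv])]

/-- The amount of the shift is read off the current state, so it must not drift after the dealing.
It is fixed because an honest dealer's pairs are determined when it deals. -/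
theorem Step.gap_eq {st' : State n h F} (hI : Inv G K a b st) (hQ : QCond 4 Finset.univ G.Z)
    (hkn : ∀ q, Known G K q → a q = a' q ∧ b q = b' q)
    (hs : Step G K st st') {sid : VssId n h} (hsid : (st'.vss sid).isSome) :
    st.gap G a b a' b' sid = st'.gap G a b a' b' sid := by
  by_cases hd : sid.dealer ∈ K
  · rw [State.gap, State.gap, gap_eq_zero hkn hd fun pq hpq => Local.mem_S_of_pairs hpq,
        gap_eq_zero hkn hd fun pq hpq => Local.mem_S_of_pairs hpq]
  by_cases hv : (st.vss sid).isSome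
  · obtain ⟨v, hv⟩ := Option.isSome_iff_exists.1 hv
    rw [State.gap, State.gap, (hs.le.loc _).pairs_eq hQ (hI.dealt sid v hv hd).1]
  · cases hs with
    -- A dealing changes no local state, so the two gaps are literally equal; no other event can
    -- fill an instance that was empty.
    | deal | advDeal => rfl
    | _ => exact absurd hsid hv

theorem pmf_map_congr {α β : Type*} {p : PMF α} {f g : α → β} (hfg : ∀ x ∈ p.support, f x = g x) :
    p.map f = p.map g := by
  ext y
  rw [PMF.map_apply, PMF.map_apply]
  refine tsum_congr fun x => ?_
  by_cases hx : x ∈ p.support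
  · rw [hfg x hx]
  · rw [PMF.mem_support_iff, not_not] at hx
    simp [hx]

theorem pmf_bind_congr {α β : Type*} {p : PMF α} {f g : α → PMF β}
    (hfg : ∀ x ∈ p.support, f x = g x) : p.bind f = p.bind g := by
  ext y
  rw [PMF.bind_apply, PMF.bind_apply]
  refine tsum_congr fun x => ?_
  by_cases hx : x ∈ p.support
  · rw [hfg x hx]
  · rw [PMF.mem_support_iff, not_not] at hx
    simp [hx]

variable [Fintype F] [NeZero h]

/-- Translation is a bijection between the sharings of the two values. It is the only probabilistic
fact in the privacy argument. -/
theorem uniform_sharings_translate (c : F) (s : Fin h → F) :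
    PMF.uniformOfFinset (sharings h (c + ∑ q, s q)) (sharings_nonempty _) =
      (PMF.uniformOfFinset (sharings h c) (sharings_nonempty _)).map (· + s) := by
  have hcard : (sharings h (c + ∑ q, s q)).card = (sharings h c).card := by
    refine Finset.card_bij' (fun v _ => v - s) (fun v _ => v + s) ?_ ?_ ?_ ?_
    · intro v hv
      simp only [sharings, Finset.mem_filter, Finset.mem_univ, true_and] at hv ⊢
      simp [Finset.sum_sub_distrib, hv]
    · intro v hv
      simp only [sharings, Finset.mem_filter, Finset.mem_univ, true_and] at hv ⊢
      simp [Finset.sum_add_distrib, hv]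
    · intro v _; simp
    · intro v _; simp
  ext w
  rw [PMF.map_apply, tsum_eq_single (w - s)]
  · simp only [sub_add_cancel, if_true, PMF.uniformOfFinset_apply, hcard]
    have : w ∈ sharings h (c + ∑ q, s q) ↔ w - s ∈ sharings h c := by
      simp only [sharings, Finset.mem_filter, Finset.mem_univ, true_and, Pi.sub_apply,
        Finset.sum_sub_distrib]
      exact sub_eq_iff_eq_add.symm
    simp only [this]
    congr
  · intro v hv
    rw [if_neg]
    rintro rfl
    simp at hv

omit [Fintype F] [NeZero h] in
theorem Inv.enabled_shift (hI : Inv G K a b st) (hQ : QCond 4 Finset.univ G.Z)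
    (hK : G.Admissible K) (hkn : ∀ q, Known G K q → a q = a' q ∧ b q = b' q)
    (x : Action n h F) :
    Enabled G K (st.shift G a' b' q₀ (st.gap G a b a' b')) x ↔ Enabled G K st x := by
  have hf := hI.fits hQ hK hkn
  cases x with
  | deal i sid =>
    simp only [Enabled, State.shift, (hf i).shift_deals, Option.map_eq_none_iff]
  | vote i sid v => simp only [Enabled, State.shift, (hf i).shift_mayVote]; rfl
  | send i r q => simp only [Enabled, State.shift, (hf i).shift_contributes]
  | vssOut i sid =>
    simp only [Enabled, State.shift, (hf i).shift_requestsVss, Option.isSome_map,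
      Local.Fits.shift_vss_eq_none]
  | abaOut i sid => simp only [Enabled, State.shift, (hf i).shift_requestsAba]; rfl
  | deliver j i r q => rfl
  | advDeal sid v => simp only [Enabled, State.shift, Option.map_eq_none_iff]
  | advVote j sid v => rfl
  | advCore sid C tie => rfl
  | advSend j i r q v => rfl

/-- The observation is unchanged since index `q₀` belongs to no corrupt party and all sent values
are invariant. Dealings of the adversary are not shifted because their gaps are zero. -/
theorem Inv.exec_shift (hI : Inv G K a b st) (hQ : QCond 4 Finset.univ G.Z)
    (hK : G.Admissible K) (hkn : ∀ q, Known G K q → a q = a' q ∧ b q = b' q)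
    (hq₀ : ¬ Known G K q₀) (x : Action n h F) :
    exec G K (st.shift G a' b' q₀ (st.gap G a b a' b')) x =
      (exec G K st x).map
        (Prod.map (State.shift G a' b' q₀ (st.gap G a b a' b')) id) := by
  have hf := hI.fits (a' := a') (b' := b') hQ hK hkn
  set δ := st.gap G a b a' b' with hδ
  by_cases he : Enabled G K st x
  swap
  · have he' : ¬ Enabled G K (st.shift G a' b' q₀ δ) x :=
      fun hc => he ((hI.enabled_shift hQ hK hkn x).1 hc)
    unfold exec
    rw [if_neg he', if_neg he, PMF.pure_map]
    rfl
  have he' : Enabled G K (st.shift G a' b' q₀ δ) x := (hI.enabled_shift hQ hK hkn x).2 he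
  unfold exec
  rw [if_pos he', if_pos he]
  cases x with
  | deal i sid =>
    have hc := he.2.2
    have hc' := he'.2.2
    simp only [hc, hc', dite_true]
    have e1 := hc.choose_spec.requests
    have e2 := hc'.choose_spec.requests
    rw [hI.me] at e1
    -- The new value of an honest dealer is the old one plus the gap, which is placed entirely on
    -- the `q₀`-th share.
    have hsum : hc'.choose = hc.choose + ∑ q, (Pi.single q₀ (δ sid) : Fin h → F) q := by
      rw [Finset.sum_pi_single', if_pos (Finset.mem_univ _), e1.2.2, e2.2.2, hI.sum_pairs e1.1]
      have hp : ((st.shift G a' b' q₀ δ).loc i).pairs G sid = (st.loc i).pairs G sid :=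
        (hf i).shift_pairs
      rw [hp, hδ, State.gap, AsyncMult.gap, e1.1, ← Finset.sum_add_distrib]
      refine Finset.sum_congr rfl fun pq hpq => ?_
      obtain ⟨h1, h2⟩ := Local.mem_S_of_pairs hpq
      rw [e1.1] at h1 h2
      simp [State.shift, Local.shift, hI.me, h1, h2]
    have hu : PMF.uniformOfFinset (sharings h hc'.choose) (sharings_nonempty _) =
        (PMF.uniformOfFinset (sharings h hc.choose) (sharings_nonempty _)).map
          (· + Pi.single q₀ (δ sid)) := by
      rw [← uniform_sharings_translate]
      simp only [hsum]
    rw [hu, PMF.map_comp, PMF.map_comp]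
    congr 1
    ext1 v
    simp only [Function.comp_apply, Prod.map_apply, id_eq, Prod.mk.injEq, Option.some_inj]
    refine ⟨State.shift_update.symm, ?_⟩
    ext1 q
    split_ifs with hq
    · have : q ≠ q₀ := fun e => hq₀ (e ▸ hq)
      simp [this]
    · rfl
  | vote i sid v =>
    simp only [PMF.pure_map, Prod.map_apply, id_eq]
    have := State.shift_setLoc (G := G) (a' := a') (b' := b') (q₀ := q₀) (δ := δ) (st := st) (i := i)
      (L := { st.loc i with voted := Function.update (st.loc i).voted sid true })
    refine congrArg PMF.pure (Prod.ext ?_ rfl)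
    simp only [State.shift, State.setLoc, State.mk.injEq] at this ⊢
    exact ⟨this.1.symm, by simp⟩
  | send i r q =>
    have hc := he.2.2.2
    -- Equality of the predicates, beyond pointwise equivalence, makes the two chosen values the
    -- same.
    have hP : (fun v => ((st.shift G a' b' q₀ δ).loc i).Contributes G q v r) =
        fun v => (st.loc i).Contributes G q v r :=
      funext fun v => propext (hf i).shift_contributes
    simp only [hP, hc, dite_true, PMF.pure_map]
    rfl
  | vssOut i sid =>
    simp only [PMF.pure_map, Prod.map_apply, id_eq]
    refine congrArg PMF.pure (Prod.ext ?_ rfl)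
    rw [State.shift_setLoc]
    dsimp only
    congr 1
    simp only [State.shift, Local.shift, Local.mk.injEq, true_and, and_true]
    ext1 s
    by_cases hs : s = sid
    · subst hs
      simp only [Function.update_self, Option.map_map]
      congr 1
      ext1 v
      ext1 q
      simp only [Function.comp_apply, hI.me, Pi.add_apply]
      by_cases h2 : q = q₀
      · subst h2
        by_cases h1 : i ∈ G.S q <;> simp [h1]
      · simp [h2]
    · simp [hs]
  | abaOut i sid =>
    simp only [PMF.pure_map, Prod.map_apply, id_eq]
    rw [State.shift_setLoc]
    rfl
  | deliver j i r q =>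
    simp only [PMF.pure_map, Prod.map_apply, id_eq, State.setMsg]
    rw [State.shift_setLoc]
    rfl
  | advDeal sid v =>
    simp only [PMF.pure_map, Prod.map_apply, id_eq]
    rw [State.shift_update]
    have : δ sid = 0 := gap_eq_zero hkn he.1 fun pq hpq => Local.mem_S_of_pairs hpq
    simp [this]
  | advVote j sid v => simp only [PMF.pure_map]; rfl
  | advCore sid C tie => simp only [PMF.pure_map]; rfl
  | advSend j i r q v =>
    simp only [PMF.pure_map, Prod.map_apply, id_eq, State.setMsg]
    rw [State.shift_setLoc]
    rfl

theorem inv_of_execution (hQ : QCond 4 Finset.univ G.Z) (hK : G.Admissible K)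
    (adv : View n h F → PMF (Action n h F)) (T : ℕ) :
    ∀ s ∈ (execution G K adv a b T).support, Inv G K a b s.1 := by
  induction T with
  | zero =>
    intro s hs
    rw [execution, PMF.support_pure, Set.mem_singleton_iff] at hs
    rw [hs]
    exact inv_initial a b
  | succ T ih =>
    intro s hs
    rw [execution, PMF.mem_support_bind_iff] at hs
    obtain ⟨s₀, hs₀, hs⟩ := hs
    rw [PMF.mem_support_bind_iff] at hs
    obtain ⟨x, -, hs⟩ := hs
    rw [PMF.support_map] at hs
    obtain ⟨r, hr, rfl⟩ := hs
    exact (ih s₀ hs₀).step hQ hK (Step.of_support (o := r.2) hr)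

/-- The two executions correspond to each other under the shift of the unknown shares. -/
theorem execution_shift (hQ : QCond 4 Finset.univ G.Z) (hK : G.Admissible K)
    (hkn : ∀ q, Known G K q → a q = a' q ∧ b q = b' q) (hq₀ : ¬ Known G K q₀)
    (adv : View n h F → PMF (Action n h F)) (T : ℕ) :
    execution G K adv a' b' T = (execution G K adv a b T).map
      (Prod.map (fun st => st.shift G a' b' q₀ (st.gap G a b a' b')) id) := by
  induction T with
  | zero => rw [execution, execution, PMF.pure_map]; rfl
  | succ T ih =>
    rw [execution, ih, PMF.bind_map, execution, PMF.map_bind]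
    refine pmf_bind_congr fun s hs => ?_
    have hI := inv_of_execution hQ hK adv T s hs
    rw [PMF.map_bind]
    refine pmf_bind_congr fun x _ => ?_
    simp only [Prod.map_fst, Prod.map_snd, id_eq]
    rw [hI.exec_shift hQ hK hkn hq₀, PMF.map_comp, PMF.map_comp]
    refine pmf_map_congr fun r hr => ?_
    have hstep := Step.of_support (st' := r.1) (o := r.2) hr
    simp only [Function.comp_apply, Prod.map_apply, id_eq, Prod.mk.injEq]
    refine ⟨?_, rfl⟩
    -- One side is shifted by the gaps before the step, the other by those after it. They agree on
    -- instances already dealt, and the shift affects no others.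
    exact State.shift_congr (hI.step hQ hK hstep) fun sid hsid => hstep.gap_eq hI hQ hkn hsid

theorem viewDist_eq (hQ : QCond 4 Finset.univ G.Z) (hK : G.Admissible K)
    (hkn : ∀ q, Known G K q → a q = a' q ∧ b q = b' q)
    (adv : View n h F → PMF (Action n h F)) (T : ℕ) :
    viewDist G K adv a b T = viewDist G K adv a' b' T := by
  -- If every share is known then the inputs coincide; otherwise one unknown index absorbs all
  -- changes.
  by_cases hall : ∀ q, Known G K q
  · rw [funext fun q => (hkn q (hall q)).1, funext fun q => (hkn q (hall q)).2]
  · push Not at hall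
    obtain ⟨q₀, hq₀⟩ := hall
    rw [viewDist, viewDist, execution_shift hQ hK hkn hq₀, PMF.map_comp]
    rfl

end Privacy

/-! ### Runs: iterations, outputs, communication -/

section Runs
variable {n h : ℕ} {F : Type*} [Field F] [DecidableEq F] {G : Setup n h} {K : Finset (Fin n)}
  {a b : Fin h → F} {st : ℕ → State n h F} {x : ℕ → Action n h F}

omit [Field F] [DecidableEq F] in
theorem State.LE.glob_shareLE {s s' : State n h F} (hs : s.LE s') (i : Fin n) (q : Fin h) :
    (s.glob i).ShareLE q (s'.glob i) :=
  ⟨fun sid b hb => hs.out sid b hb, fun sid w hw => ⟨w, hs.vss sid w hw, rfl⟩⟩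

variable [Fintype F] [NeZero h]

theorem IsRun.toStep (hr : IsRun G K a b st x) (T : ℕ) : Step G K (st T) (st (T + 1)) := by
  obtain ⟨o, ho⟩ := hr.step T
  exact Step.of_support ho

theorem IsRun.le (hr : IsRun G K a b st x) {T T' : ℕ} (hT : T ≤ T') : (st T).LE (st T') := by
  induction T', hT using Nat.le_induction with
  | base => exact .refl _
  | succ k _ ih => exact ih.trans (hr.toStep k).le

theorem IsRun.inv (hr : IsRun G K a b st x) (hQ : QCond 4 Finset.univ G.Z) (hK : G.Admissible K)
    (T : ℕ) : Inv G K a b (st T) := by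
  induction T with
  | zero => rw [hr.init]; exact inv_initial a b
  | succ T ih => exact ih.step hQ hK (hr.toStep T)

/-- All outputs of honest parties are shares of one sharing of the product. -/
theorem IsRun.exists_output (hr : IsRun G K a b st x) (hQ : QCond 4 Finset.univ G.Z)
    (hK : G.Admissible K) : ∃ c : Fin h → F, ∑ q, c q = (∑ q, a q) * (∑ q, b q) ∧
      ∀ T, ∀ i ∉ K, ∀ q, i ∈ G.S q → ∀ v, ((st T).loc i).Outputs G q v → v = c q := by
  by_cases hex : ∃ T i iter, ((st T).loc i).Reached G iter ∧
      ((st T).loc i).verdict G iter = some none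
  · obtain ⟨T, i, iter, h1, h2⟩ := hex
    obtain ⟨c, hc, hp⟩ := (hr.inv hQ hK T).success hQ hK h2 i
    refine ⟨c, hc, fun T' i' hi' q hq v ⟨iter', h3, h4, h5⟩ => ?_⟩
    have hle := hr.le (le_max_left T T')
    have hle' := hr.le (le_max_right T T')
    have hI := hr.inv hQ hK (max T T')
    obtain rfl := hI.success_agree hQ hK ((hle.loc i).reached hQ h1) ((hle.loc i).verdict hQ h2)
      ((hle'.loc i').reached hQ h3) ((hle'.loc i').verdict hQ h4)
    have e1 := (hle.glob_shareLE i q).prodShare (hp q)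
    have e2 := (hI.shareLE hq i).prodShare (((hle'.loc i').shareLE q).prodShare h5)
    exact Option.some_injective _ (e2.symm.trans e1)
  -- If no party ever finishes there are no outputs, and any sharing of the product will do.
  · refine ⟨Pi.single 0 ((∑ q, a q) * ∑ q, b q), by simp, ?_⟩
    rintro T i - q - v ⟨iter, h1, h2, -⟩
    exact absurd ⟨T, i, iter, h1, h2⟩ hex

omit [Fintype F] [NeZero h] in
-- A success verdict includes reconstructed differences, which a member of the group can only have
-- after computing its own share of the reference product.
theorem Inv.outputs_of_finished {s : State n h F} (hI : Inv G K a b s) {i : Fin n} {q : Fin h}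
    (hf : (s.loc i).Finished G) (hq : i ∈ G.S q) : ∃ v, (s.loc i).Outputs G q v := by
  obtain ⟨iter, h1, h2⟩ := hf
  obtain ⟨w, hw, -⟩ := optSum_univ_eq_some (Local.diffVal_of_verdict h2 (G.ref iter))
  have := hw q
  rw [Local.recShare_of_mem (by rwa [hI.me])] at this
  obtain ⟨v, -, hv, -⟩ := map₂_eq_some.1 this
  exact ⟨v, iter, h1, h2, hv⟩

/-! #### Communication -/

omit [Field F] [DecidableEq F] [Fintype F] [NeZero h] in
theorem Setup.t_le : G.t ≤ n := by
  refine Finset.sup_le fun z _ => ?_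
  simpa using Finset.card_le_univ (G.Z z)

theorem finite_and_ncard_le {α : Type*} {s : Set α} (t : Finset α) (hs : s ⊆ t) :
    s.Finite ∧ s.ncard ≤ t.card := by
  refine ⟨t.finite_toSet.subset hs, ?_⟩
  rw [← Set.ncard_coe_finset]
  exact Set.ncard_le_ncard hs t.finite_toSet

omit [NeZero h] in
theorem QCond.pos (hQ : QCond 4 Finset.univ G.Z) (hK : G.Admissible K) : 0 < n := by
  obtain ⟨z, -⟩ := hK
  obtain ⟨i, -⟩ := hQ.exists_notMem z z z z
  exact i.pos

omit [NeZero h] in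
-- The last reachable iteration is `G.t * G.block + 1`, and `Finset.range` excludes its end; hence
-- the `2`.
theorem iterations_le (hn : 0 < n) : G.t * G.block + 2 ≤ 4 * n ^ 3 := by
  have ht : G.t ≤ n := Setup.t_le
  have h1 : G.t * G.block ≤ n * (n * n + 1) := by
    unfold Setup.block
    gcongr
  have h2 : n ≤ n ^ 3 := Nat.le_self_pow (by norm_num) n
  have h3 : 1 ≤ n ^ 3 := Nat.one_le_pow _ _ hn
  have h4 : n * (n * n + 1) = n ^ 3 + n := by ring
  omega

theorem IsRun.vssCalls_le (hr : IsRun G K a b st x) (hQ : QCond 4 Finset.univ G.Z)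
    (hK : G.Admissible K) :
    (vssCalls G K st).Finite ∧ (vssCalls G K st).ncard ≤ 56 * (h * n ^ 5) := by
  have hn : 0 < n := hQ.pos hK
  set N := G.t * G.block + 2 with hN
  let A : Finset (VssId n h) :=
    (Finset.range N ×ˢ (Finset.univ : Finset (Fin h)) ×ˢ Finset.range (n + 1) ×ˢ
      (Finset.univ : Finset (Fin n))).image fun y => .sum y.1 y.2.1 y.2.2.1 y.2.2.2
  let B : Finset (VssId n h) :=
    (Finset.range N ×ˢ (Finset.univ : Finset (Fin h)) ×ˢ (Finset.univ : Finset (Fin n)) ×ˢ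
      (Finset.univ : Finset (Fin n))).image fun y => .part y.1 y.2.1 y.2.2.1 y.2.2.2
  have hsub : vssCalls G K st ⊆ ((A ∪ B : Finset (VssId n h)) : Set (VssId n h)) := by
    rintro sid ⟨T, i, hi, hs⟩
    have hI := hr.inv hQ hK T
    have hreq : ∃ i, ((st T).loc i).RequestsVss G sid := by
      rcases hs with ⟨rfl, hs⟩ | hs
      · obtain ⟨v, hv⟩ := Option.isSome_iff_exists.1 hs
        exact ⟨_, (hI.dealt sid v hv hi).1⟩
      · exact ⟨i, hs⟩
    obtain ⟨i, hreq⟩ := hreq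
    rw [Finset.mem_coe, Finset.mem_union]
    cases sid with
    | sum iter z hop j =>
      rw [Local.requestsVss_sum] at hreq
      have h1 := hI.reached_le hQ hK hreq.1
      have h2 := hreq.2.1
      exact Or.inl (Finset.mem_image.2 ⟨(iter, z, hop, j), by simp; omega, rfl⟩)
    | part iter z j k =>
      have h1 := hI.reached_le hQ hK hreq.1
      exact Or.inr (Finset.mem_image.2 ⟨(iter, z, j, k), by simp; omega, rfl⟩)
  obtain ⟨h1, h2⟩ := finite_and_ncard_le _ hsub
  refine ⟨h1, h2.trans ((Finset.card_union_le _ _).trans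
    ((Nat.add_le_add Finset.card_image_le Finset.card_image_le).trans ?_))⟩
  simp only [Finset.card_product, Finset.card_range, Finset.card_univ, Fintype.card_fin]
  have h3 : N ≤ 4 * n ^ 3 := iterations_le hn
  calc N * (h * ((n + 1) * n)) + N * (h * (n * n))
      ≤ 4 * n ^ 3 * (h * ((n + n) * n)) + 4 * n ^ 3 * (h * (n * n)) := by gcongr; omega
    _ = 12 * (h * n ^ 5) := by ring
    -- The constant is shared with the bit count; `12` suffices here.
    _ ≤ 56 * (h * n ^ 5) := by gcongr; norm_num

theorem IsRun.abaCalls_le (hr : IsRun G K a b st x) (hQ : QCond 4 Finset.univ G.Z)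
    (hK : G.Admissible K) :
    (abaCalls G K st).Finite ∧ (abaCalls G K st).ncard ≤ 56 * (h * n ^ 5) := by
  have hn : 0 < n := hQ.pos hK
  set N := G.t * G.block + 2 with hN
  let A : Finset (AbaId n h) :=
    (Finset.range N ×ˢ (Finset.univ : Finset (Fin h)) ×ˢ Finset.range (n + 1) ×ˢ
      (Finset.univ : Finset (Fin n))).image fun y => .select y.1 y.2.1 y.2.2.1 y.2.2.2
  let B : Finset (AbaId n h) :=
    (Finset.range N ×ˢ (Finset.univ : Finset (Fin n))).image fun y => .discard y.1 y.2
  have hsub : abaCalls G K st ⊆ ((A ∪ B : Finset (AbaId n h)) : Set (AbaId n h)) := by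
    rintro sid ⟨T, i, hi, hs⟩
    have hI := hr.inv hQ hK T
    have hreq : ∃ i, ((st T).loc i).RequestsAba G sid := by
      rcases hs with hs | hs
      -- A late vote may leave no record, but then the instance has an output, hence an honest
      -- supporter who requested it.
      · rcases (hI.aba sid).voted i hi hs with hv | ho
        · obtain ⟨v, hv⟩ := Option.isSome_iff_exists.1 hv
          exact ⟨i, ((hI.aba sid).vote i hi v hv).requests⟩
        · obtain ⟨v, hv⟩ := Option.isSome_iff_exists.1 ho
          obtain ⟨j, -, hj⟩ := (hI.aba sid).out v hv
          exact ⟨j, hj.requests⟩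
      · exact ⟨i, hs⟩
    obtain ⟨i, hreq⟩ := hreq
    rw [Finset.mem_coe, Finset.mem_union]
    cases sid with
    | select iter z hop j =>
      rw [Local.requestsAba_select] at hreq
      have h1 := hI.reached_le hQ hK hreq.1
      have h2 := hreq.2.1
      exact Or.inl (Finset.mem_image.2 ⟨(iter, z, hop, j), by simp; omega, rfl⟩)
    | discard iter j =>
      have h1 := hI.reached_le hQ hK hreq.1
      exact Or.inr (Finset.mem_image.2 ⟨(iter, j), by simp; omega, rfl⟩)
  obtain ⟨h1, h2⟩ := finite_and_ncard_le _ hsub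
  refine ⟨h1, h2.trans ((Finset.card_union_le _ _).trans
    ((Nat.add_le_add Finset.card_image_le Finset.card_image_le).trans ?_))⟩
  simp only [Finset.card_product, Finset.card_range, Finset.card_univ, Fintype.card_fin]
  have h3 : N ≤ 4 * n ^ 3 := iterations_le hn
  have hh : 1 ≤ h := Nat.one_le_iff_ne_zero.2 (NeZero.ne h)
  have h4 : n ^ 4 ≤ h * n ^ 5 := by
    calc n ^ 4 ≤ n ^ 5 := Nat.pow_le_pow_right hn (by norm_num)
      _ ≤ h * n ^ 5 := Nat.le_mul_of_pos_left _ hh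
  calc N * (h * ((n + 1) * n)) + N * n
      ≤ 4 * n ^ 3 * (h * ((n + n) * n)) + 4 * n ^ 3 * n := by gcongr; omega
    _ = 8 * (h * n ^ 5) + 4 * n ^ 4 := by ring
    _ ≤ 56 * (h * n ^ 5) := by omega

/-- A party finds at most one conflicting set per iteration, at whatever time. In the message count
this replaces a factor `h` by a choice between two sets for all reconstructions except the
differences of products. -/
theorem IsRun.exists_conflict (hr : IsRun G K a b st x) (hQ : QCond 4 Finset.univ G.Z) :
    ∃ ζ : Fin n → ℕ → Fin h, ∀ T i iter z, ((st T).loc i).Conflict G iter z → z = ζ i iter := by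
  classical
  refine ⟨fun i iter => if hz : ∃ T z, ((st T).loc i).Conflict G iter z
    then hz.choose_spec.choose else 0, fun T i iter z hz => ?_⟩
  have hex : ∃ T z, ((st T).loc i).Conflict G iter z := ⟨T, z, hz⟩
  dsimp only
  rw [dif_pos hex]
  have h1 := hex.choose_spec.choose_spec
  exact (((hr.le (le_max_left T hex.choose)).loc i).conflict hQ hz).unique
    (((hr.le (le_max_right T hex.choose)).loc i).conflict hQ h1)

theorem IsRun.messages_le (hr : IsRun G K a b st x) (hQ : QCond 4 Finset.univ G.Z)
    (hK : G.Admissible K) : (messages G K st).Finite ∧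
      (messages G K st).ncard ≤ 28 * (h ^ 2 * n ^ 5 + h * n ^ 7) := by
  have hn : 0 < n := hQ.pos hK
  obtain ⟨ζ, hζ⟩ := hr.exists_conflict hQ
  set N := G.t * G.block + 2 with hN
  let P : Finset (Fin n) := Finset.univ
  let H : Finset (Fin h) := Finset.univ
  let R : Finset ℕ := Finset.range N
  let D : Finset Bool := Finset.univ
  let w : Fin n → ℕ → Bool → Fin h := fun i iter β => if β then ζ i iter else G.ref iter
  let A1 : Finset (Fin n × Fin n × RecId n h × Fin h) :=
    (P ×ˢ P ×ˢ H ×ˢ R ×ˢ H).image fun y => (y.1, y.2.1, .diff y.2.2.2.1 y.2.2.2.2, y.2.2.1)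
  let A2 : Finset (Fin n × Fin n × RecId n h × Fin h) :=
    (P ×ˢ P ×ˢ H ×ˢ R ×ˢ D ×ˢ P).image fun y =>
      (y.1, y.2.1, .check y.2.2.2.1 (w y.1 y.2.2.2.1 y.2.2.2.2.1) y.2.2.2.2.2, y.2.2.1)
  let A3 : Finset (Fin n × Fin n × RecId n h × Fin h) :=
    (P ×ˢ P ×ˢ H ×ˢ R ×ˢ P ×ˢ P).image fun y =>
      (y.1, y.2.1, .pair y.2.2.2.1 y.2.2.2.2.1 y.2.2.2.2.2, y.2.2.1)
  let A4 : Finset (Fin n × Fin n × RecId n h × Fin h) :=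
    (P ×ˢ P ×ˢ H ×ˢ R ×ˢ D ×ˢ P ×ˢ P).image fun y =>
      (y.1, y.2.1, .part y.2.2.2.1 (w y.1 y.2.2.2.1 y.2.2.2.2.1) y.2.2.2.2.2.1 y.2.2.2.2.2.2,
        y.2.2.1)
  let A5 : Finset (Fin n × Fin n × RecId n h × Fin h) :=
    (P ×ˢ P ×ˢ H ×ˢ R ×ˢ P ×ˢ P).image fun y =>
      (y.1, y.2.1, .inputA y.2.2.2.1 y.2.2.2.2.1 y.2.2.2.2.2, y.2.2.1)
  let A6 : Finset (Fin n × Fin n × RecId n h × Fin h) :=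
    (P ×ˢ P ×ˢ H ×ˢ R ×ˢ P ×ˢ P).image fun y =>
      (y.1, y.2.1, .inputB y.2.2.2.1 y.2.2.2.2.1 y.2.2.2.2.2, y.2.2.1)
  have hw : ∀ T i iter z z₀, ((st T).loc i).Conflict G iter z₀ → (z = z₀ ∨ z = G.ref iter) →
      ∃ β, w i iter β = z := by
    rintro T i iter z z₀ hz (rfl | rfl)
    · exact ⟨true, (hζ T i iter _ hz).symm⟩
    · exact ⟨false, rfl⟩
  have hsub : messages G K st ⊆ ((A1 ∪ (A2 ∪ (A3 ∪ (A4 ∪ (A5 ∪ A6)))) : Finset _) : Set _) := by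
    rintro ⟨i, i', r, q⟩ ⟨hi, -, T, hs⟩
    have hI := hr.inv hQ hK T
    obtain ⟨v, hv⟩ := Option.isSome_iff_exists.1 hs
    have hc := (hI.sent i r q v hv).2.2
    simp only [Finset.coe_union, Set.mem_union, Finset.mem_coe]
    cases r with
    | diff iter z =>
      have hR : iter ∈ R := Finset.mem_range.2 (by have := hI.reached_le hQ hK hc.1; omega)
      exact Or.inl (Finset.mem_image.2 ⟨(i, i', q, iter, z), by simp [P, H, hR], rfl⟩)
    | check iter z j =>
      have hR : iter ∈ R := Finset.mem_range.2 (by have := hI.reached_le hQ hK hc.1; omega)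
      obtain ⟨-, z₀, h1, h2, -⟩ := hc
      obtain ⟨β, rfl⟩ := hw T i iter z z₀ h1 h2
      exact Or.inr <| Or.inl (Finset.mem_image.2 ⟨(i, i', q, iter, β, j), by simp [P, H, D, hR], rfl⟩)
    | pair iter j k =>
      have hR : iter ∈ R := Finset.mem_range.2 (by have := hI.reached_le hQ hK hc.1; omega)
      exact Or.inr <| Or.inr <| Or.inl
        (Finset.mem_image.2 ⟨(i, i', q, iter, j, k), by simp [P, H, hR], rfl⟩)
    | part iter z j k =>
      have hR : iter ∈ R := Finset.mem_range.2 (by have := hI.reached_le hQ hK hc.1; omega)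
      obtain ⟨-, z₀, h1, h2, -⟩ := hc
      obtain ⟨β, rfl⟩ := hw T i iter z z₀ h1 (h2.imp And.left And.left)
      exact Or.inr <| Or.inr <| Or.inr <| Or.inl
        (Finset.mem_image.2 ⟨(i, i', q, iter, β, j, k), by simp [P, H, D, hR], rfl⟩)
    | inputA iter j k =>
      have hR : iter ∈ R := Finset.mem_range.2 (by have := hI.reached_le hQ hK hc.1; omega)
      exact Or.inr <| Or.inr <| Or.inr <| Or.inr <| Or.inl
        (Finset.mem_image.2 ⟨(i, i', q, iter, j, k), by simp [P, H, hR], rfl⟩)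
    | inputB iter j k =>
      have hR : iter ∈ R := Finset.mem_range.2 (by have := hI.reached_le hQ hK hc.1; omega)
      exact Or.inr <| Or.inr <| Or.inr <| Or.inr <| Or.inr
        (Finset.mem_image.2 ⟨(i, i', q, iter, j, k), by simp [P, H, hR], rfl⟩)
  obtain ⟨h1, h2⟩ := finite_and_ncard_le _ hsub
  refine ⟨h1, h2.trans ?_⟩
  have hN' : N ≤ 4 * n ^ 3 := iterations_le hn
  have e1 : A1.card ≤ 4 * (h ^ 2 * n ^ 5) := by
    refine Finset.card_image_le.trans ?_
    simp only [Finset.card_product, P, H, R, Finset.card_univ, Fintype.card_fin, Finset.card_range]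
    calc n * (n * (h * (N * h))) ≤ n * (n * (h * (4 * n ^ 3 * h))) := by gcongr
      _ = 4 * (h ^ 2 * n ^ 5) := by ring
  have e2 : A2.card ≤ 8 * (h * n ^ 7) := by
    refine Finset.card_image_le.trans ?_
    simp only [Finset.card_product, P, H, R, D, Finset.card_univ, Fintype.card_fin,
      Finset.card_range, Fintype.card_bool]
    calc n * (n * (h * (N * (2 * n)))) ≤ n * (n * (h * (4 * n ^ 3 * (2 * n)))) := by gcongr
      _ = 8 * (h * n ^ 6) := by ring
      _ ≤ 8 * (h * n ^ 7) := by
        have := Nat.pow_le_pow_right hn (show 6 ≤ 7 by norm_num)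
        gcongr
  have e3 : n * (n * (h * (N * (n * n)))) ≤ 4 * (h * n ^ 7) := by
    calc n * (n * (h * (N * (n * n)))) ≤ n * (n * (h * (4 * n ^ 3 * (n * n)))) := by gcongr
      _ = 4 * (h * n ^ 7) := by ring
  have c3 : A3.card ≤ 4 * (h * n ^ 7) := by
    refine Finset.card_image_le.trans ?_
    simpa only [Finset.card_product, P, H, R, Finset.card_univ, Fintype.card_fin,
      Finset.card_range] using e3
  have c5 : A5.card ≤ 4 * (h * n ^ 7) := by
    refine Finset.card_image_le.trans ?_
    simpa only [Finset.card_product, P, H, R, Finset.card_univ, Fintype.card_fin,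
      Finset.card_range] using e3
  have c6 : A6.card ≤ 4 * (h * n ^ 7) := by
    refine Finset.card_image_le.trans ?_
    simpa only [Finset.card_product, P, H, R, Finset.card_univ, Fintype.card_fin,
      Finset.card_range] using e3
  have c4 : A4.card ≤ 8 * (h * n ^ 7) := by
    refine Finset.card_image_le.trans ?_
    simp only [Finset.card_product, P, H, R, D, Finset.card_univ, Fintype.card_fin,
      Finset.card_range, Fintype.card_bool]
    calc n * (n * (h * (N * (2 * (n * n))))) = 2 * (n * (n * (h * (N * (n * n))))) := by ring
      _ ≤ 2 * (4 * (h * n ^ 7)) := by gcongr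
      _ = 8 * (h * n ^ 7) := by ring
  -- The coefficients are `4` for `h ^ 2 * n ^ 5` and `8 + 4 + 8 + 4 + 4 = 28` for `h * n ^ 7`.
  have u1 := Finset.card_union_le A1 (A2 ∪ (A3 ∪ (A4 ∪ (A5 ∪ A6))))
  have u2 := Finset.card_union_le A2 (A3 ∪ (A4 ∪ (A5 ∪ A6)))
  have u3 := Finset.card_union_le A3 (A4 ∪ (A5 ∪ A6))
  have u4 := Finset.card_union_le A4 (A5 ∪ A6)
  have u5 := Finset.card_union_le A5 A6
  omega

/-- With at least two elements the logarithm is at least `1`, so rounding up at most doubles it. -/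
theorem clog_le (q : ℕ) (hq : 2 ≤ q) : (Nat.clog 2 q : ℝ) ≤ 2 * Real.logb 2 q := by
  have h1 : (1 : ℝ) ≤ Real.logb 2 q := by
    rw [Real.le_logb_iff_rpow_le (by norm_num) (by positivity)]
    simpa using (show (2 : ℝ) ≤ q by exact_mod_cast hq)
  have h2 := (Nat.ceil_lt_add_one (zero_le_one.trans h1)).le
  have h3 := Real.natCeil_logb_natCast 2 q
  push_cast at h3
  rw [h3] at h2
  linarith

theorem IsRun.bits_le (hr : IsRun G K a b st x) (hQ : QCond 4 Finset.univ G.Z)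
    (hK : G.Admissible K) : (bits G K st : ℝ) ≤
      (56 : ℕ) * (h ^ 2 * n ^ 5 * Real.logb 2 (Fintype.card F)
        + h * n ^ 7 * Real.logb 2 (Fintype.card F)) := by
  have h1 : ((messages G K st).ncard : ℝ) ≤ 28 * (h ^ 2 * n ^ 5 + h * n ^ 7) := by
    exact_mod_cast (hr.messages_le hQ hK).2
  have h2 := clog_le (Fintype.card F) Fintype.one_lt_card
  unfold bits
  push_cast
  calc ((messages G K st).ncard : ℝ) * (Nat.clog 2 (Fintype.card F) : ℝ)
      ≤ (28 * (h ^ 2 * n ^ 5 + h * n ^ 7)) * (2 * Real.logb 2 (Fintype.card F)) :=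
        mul_le_mul h1 h2 (by positivity) (by positivity)
    _ = _ := by ring

end Runs

/-! ### Liveness -/

open Filter

section Live
variable {n h : ℕ} {F : Type*} [Field F] [DecidableEq F] {G : Setup n h} {K : Finset (Fin n)}
  {a b : Fin h → F} {st : ℕ → State n h F} {x : ℕ → Action n h F}

/-- The event has taken place. -/
def State.Done (s : State n h F) : Action n h F → Prop
  | .deal _ sid => (s.vss sid).isSome
  | .vote i sid _ => (s.loc i).voted sid = true
  | .send i r q => (s.sent i r q).isSome
  | .vssOut i sid => ((s.loc i).vss sid).isSome
  | .abaOut i sid => ((s.loc i).aba sid).isSome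
  | .deliver j i r q => ((s.loc i).msg r q j).isSome
  | _ => True

theorem isSome_mono {α : Type*} {f g : Option α} (hfg : ∀ v, f = some v → g = some v)
    (hf : f.isSome) : g.isSome := by
  obtain ⟨v, hv⟩ := Option.isSome_iff_exists.1 hf
  simp [hfg v hv]

omit [Field F] [DecidableEq F] in
theorem State.LE.done {s s' : State n h F} (hs : s.LE s') {y : Action n h F} (hy : s.Done y) :
    s'.Done y := by
  cases y with
  | deal i sid => exact isSome_mono (hs.vss sid) hy
  | vote i sid v => exact hs.voted i sid hy
  | send i r q => exact isSome_mono (hs.sent i r q) hy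
  | vssOut i sid => exact isSome_mono ((hs.loc i).vss sid) hy
  | abaOut i sid => exact isSome_mono ((hs.loc i).aba sid) hy
  | deliver j i r q => exact isSome_mono ((hs.loc i).msg r q j) hy
  | _ => trivial

theorem eventually_honest {P : Fin n → ℕ → Prop} (hP : ∀ i ∉ K, ∀ᶠ T in atTop, P i T) :
    ∀ᶠ T in atTop, ∀ i ∉ K, P i T := by
  rw [eventually_all]
  intro i
  by_cases hi : i ∈ K
  · exact Eventually.of_forall fun _ h => absurd hi h
  · filter_upwards [hP i hi] with T hT _ using hT

variable [Fintype F] [NeZero h]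

theorem done_of_support {s s' : State n h F} {y : Action n h F} {o : Obs h F}
    (he : Enabled G K s y) (hs : (s', o) ∈ (exec G K s y).support) : s'.Done y := by
  unfold exec at hs
  rw [if_pos he] at hs
  cases y with
  | deal i sid =>
    obtain ⟨h1, h2, h3⟩ := he
    simp only [h3, dite_true] at hs
    rw [PMF.support_map] at hs
    obtain ⟨v, hv, e⟩ := hs
    obtain rfl := congrArg Prod.fst e
    simp [State.Done]
  | vote i sid b =>
    rw [mem_support_pure_fst hs]
    simp [State.Done, State.setLoc]
  | send i r q =>
    obtain ⟨h1, h2, h3, h4⟩ := he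
    simp only [h4, dite_true] at hs
    rw [mem_support_pure_fst hs]
    simp [State.Done]
  | vssOut i sid =>
    rw [mem_support_pure_fst hs]
    simpa [State.Done, State.setLoc] using he.2.1
  | abaOut i sid =>
    rw [mem_support_pure_fst hs]
    simpa [State.Done, State.setLoc] using he.2.1
  | deliver j i r q =>
    rw [mem_support_pure_fst hs]
    simpa [State.Done, State.setMsg, State.setLoc] using he.2.2.2.2.1
  | _ => trivial

theorem IsRun.eventually_of_mono (hr : IsRun G K a b st x) {P : State n h F → Prop}
    (hP : ∀ s s', s.LE s' → P s → P s') (hex : ∃ T, P (st T)) : ∀ᶠ T in atTop, P (st T) := by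
  obtain ⟨T, hT⟩ := hex
  filter_upwards [eventually_ge_atTop T] with T' hT'
  exact hP _ _ (hr.le hT') hT

/-- The usable form of fairness: an event that from some time on is either done or enabled cannot be
skipped for ever. -/
theorem IsRun.eventually_done (hr : IsRun G K a b st x) (hf : Fair G K st x) {y : Action n h F}
    (hy : y.Due) (he : ∀ᶠ T in atTop, (st T).Done y ∨ Enabled G K (st T) y) :
    ∀ᶠ T in atTop, (st T).Done y := by
  refine hr.eventually_of_mono (fun _ _ hle => hle.done) ?_
  obtain ⟨T₀, hT₀⟩ := eventually_atTop.1 he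
  obtain ⟨T, hT, hx⟩ := hf.due y hy T₀
  rcases hT₀ T hT with hd | hen
  · exact ⟨T, hd⟩
  · rcases hx with rfl | hx
    · obtain ⟨o, ho⟩ := hr.step T
      exact ⟨T + 1, done_of_support hen ho⟩
    · exact absurd hen hx

theorem IsRun.eventually_vss (hr : IsRun G K a b st x) (hf : Fair G K st x) {i : Fin n} (hi : i ∉ K)
    {sid : VssId n h} (h1 : ∀ᶠ T in atTop, ((st T).loc i).RequestsVss G sid)
    (h2 : ∃ T, ((st T).vss sid).isSome) : ∀ᶠ T in atTop, (((st T).loc i).vss sid).isSome := by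
  refine hr.eventually_done hf (y := .vssOut i sid) trivial ?_
  filter_upwards [h1, hr.eventually_of_mono (P := fun s => (s.vss sid).isSome)
    (fun _ _ hle => isSome_mono (hle.vss sid)) h2] with T h1 h2
  by_cases hs : (((st T).loc i).vss sid).isSome
  · exact Or.inl hs
  · exact Or.inr ⟨hi, h2, by simpa using hs, h1⟩

theorem IsRun.eventually_aba (hr : IsRun G K a b st x) (hf : Fair G K st x) {i : Fin n} (hi : i ∉ K)
    {sid : AbaId n h} (h1 : ∀ᶠ T in atTop, ((st T).loc i).RequestsAba G sid)
    (h2 : ∃ T, ((st T).aba sid).out.isSome) : ∀ᶠ T in atTop, (((st T).loc i).aba sid).isSome := by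
  refine hr.eventually_done hf (y := .abaOut i sid) trivial ?_
  filter_upwards [h1, hr.eventually_of_mono (P := fun s => (s.aba sid).out.isSome)
    (fun _ _ hle => isSome_mono (hle.out sid)) h2] with T h1 h2
  by_cases hs : (((st T).loc i).aba sid).isSome
  · exact Or.inl hs
  · exact Or.inr ⟨hi, h2, by simpa using hs, h1⟩

omit [Fintype F] [NeZero h] in
theorem Inv.contributes_agree {s : State n h F} (hI : Inv G K a b s)
    (hQ : QCond 4 Finset.univ G.Z) (hK : G.Admissible K) {q : Fin h} {r : RecId n h}
    {i j : Fin n} (hi : i ∈ G.S q) (hj : j ∈ G.S q) {v w : F}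
    (hv : (s.loc i).Contributes G q v r) (hw : (s.loc j).Contributes G q w r) : v = w := by
  cases r with
  | diff iter z =>
    have e1 := (hI.shareLE hi i).diffIn hv.2
    have e2 := (hI.shareLE hj i).diffIn hw.2
    exact Option.some_injective _ (e1.symm.trans e2)
  | check iter z k =>
    obtain ⟨-, z₁, h1, -, -, hv⟩ := hv
    obtain ⟨-, z₂, h2, -, -, hw⟩ := hw
    obtain rfl := hI.conflict_agree hQ hK h1 h2
    have e1 := (hI.shareLE hi i).checkIn h1.complete hv
    have e2 := (hI.shareLE hj i).checkIn h2.complete hw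
    exact Option.some_injective _ (e1.symm.trans e2)
  | pair iter k l =>
    obtain ⟨-, z₁, h1, -, -, hv⟩ := hv
    obtain ⟨-, z₂, h2, -, -, hw⟩ := hw
    obtain rfl := hI.conflict_agree hQ hK h1 h2
    have e1 := (hI.shareLE hi i).pairIn hv
    have e2 := (hI.shareLE hj i).pairIn hw
    exact Option.some_injective _ (e1.symm.trans e2)
  | part iter z k l =>
    obtain ⟨-, z₁, -, -, hv⟩ := hv
    obtain ⟨-, z₂, -, -, hw⟩ := hw
    have e1 := (hI.shareLE hi i).partShare hv
    have e2 := (hI.shareLE hj i).partShare hw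
    exact Option.some_injective _ (e1.symm.trans e2)
  | inputA iter k l =>
    obtain ⟨-, z₁, -, -, -, hv⟩ := hv
    obtain ⟨-, z₂, -, -, -, hw⟩ := hw
    rw [hv, hw, hI.inputA, hI.inputA]
    simp [hi, hj]
  | inputB iter k l =>
    obtain ⟨-, z₁, -, -, -, hv⟩ := hv
    obtain ⟨-, z₂, -, -, -, hw⟩ := hw
    rw [hv, hw, hI.inputB, hI.inputB]
    simp [hi, hj]

/-- All honest members of the group send, and by `Inv.contributes_agree` they send the same value.
The members not heard from are corrupt, so the missing senders form an admissible set. -/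
theorem IsRun.eventually_recShare (hr : IsRun G K a b st x) (hf : Fair G K st x)
    (hQ : QCond 4 Finset.univ G.Z) (hK : G.Admissible K) {i : Fin n} (hi : i ∉ K)
    {r : RecId n h} {q : Fin h} {own : ℕ → Fin h → Option F}
    (hown : i ∈ G.S q → ∀ᶠ T in atTop, (own T q).isSome)
    (hcon : ∀ j ∉ K, j ∈ G.S q → ∀ᶠ T in atTop, ∃ v, ((st T).loc j).Contributes G q v r) :
    ∀ᶠ T in atTop, (((st T).loc i).recShare G r (own T) q).isSome := by
  by_cases hq : i ∈ G.S q
  · filter_upwards [hown hq] with T hT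
    rwa [Local.recShare_of_mem (by rwa [(hr.inv hQ hK T).me])]
  have hmsg : ∀ᶠ T in atTop, ∀ j ∉ K, j ∈ G.S q → (((st T).loc i).msg r q j).isSome := by
    refine eventually_honest fun j hj => ?_
    by_cases hjq : j ∈ G.S q
    swap
    · exact Eventually.of_forall fun _ h => absurd h hjq
    have hsent : ∀ᶠ T in atTop, ((st T).sent j r q).isSome := by
      refine hr.eventually_done hf (y := .send j r q) trivial ?_
      filter_upwards [hcon j hj hjq] with T hT
      by_cases hs : ((st T).sent j r q).isSome
      · exact Or.inl hs
      · exact Or.inr ⟨hj, hjq, by simpa using hs, hT⟩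
    have := hr.eventually_done hf (y := .deliver j i r q) trivial (by
      filter_upwards [hsent] with T hT
      by_cases hs : (((st T).loc i).msg r q j).isSome
      · exact Or.inl hs
      · exact Or.inr ⟨hj, hi, hjq, hq, hT, by simpa using hs⟩)
    filter_upwards [this] with T hT _ using hT
  obtain ⟨y, hy⟩ := id hK
  filter_upwards [hmsg] with T hT
  have hI := hr.inv hQ hK T
  have hval : ∀ j ∉ K, j ∈ G.S q → ∃ v, ((st T).loc i).msg r q j = some v ∧
      ((st T).loc j).Contributes G q v r := fun j hj hjq => by
    obtain ⟨v, hv⟩ := Option.isSome_iff_exists.1 (hT j hj hjq)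
    exact ⟨v, hv, (hI.sent j r q v (hI.msg i r q j v hj hv)).2.2⟩
  obtain ⟨j₀, h1, h2, -⟩ := hQ.exists_notMem q y q q
  obtain ⟨v, -, hv⟩ := hval j₀ (fun hj => h2 (hy hj)) (Setup.mem_S.2 h1)
  rw [(Local.recShare_of_notMem hQ (by rwa [hI.me]) (v := v)).2 ⟨y, fun j hj => ?_⟩]
  · rfl
  · by_contra hjy
    obtain ⟨hjq, hj⟩ := Finset.mem_sdiff.1 hj
    obtain ⟨w, hw, hw'⟩ := hval j (fun hj => hjy (hy hj)) hjq
    refine hj (Finset.mem_filter.2 ⟨hjq, ?_⟩)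
    rw [hw, hI.contributes_agree hQ hK hjq (Setup.mem_S.2 h1) hw' hv]

theorem IsRun.eventually_recValue (hr : IsRun G K a b st x) (hf : Fair G K st x)
    (hQ : QCond 4 Finset.univ G.Z) (hK : G.Admissible K) {i : Fin n} (hi : i ∉ K)
    {r : RecId n h} {own : ℕ → Fin h → Option F}
    (hown : ∀ᶠ T in atTop, ∀ q, i ∈ G.S q → (own T q).isSome)
    (hcon : ∀ᶠ T in atTop, ∀ j ∉ K, ∀ q, j ∈ G.S q → ∃ v, ((st T).loc j).Contributes G q v r) :
    ∀ᶠ T in atTop, (((st T).loc i).recValue G r (own T)).isSome := by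
  have : ∀ᶠ T in atTop, ∀ q, (((st T).loc i).recShare G r (own T) q).isSome := by
    rw [eventually_all]
    intro q
    refine hr.eventually_recShare hf hQ hK hi (fun hq => ?_) fun j hj hq => ?_
    · filter_upwards [hown] with T hT using hT q hq
    · filter_upwards [hcon] with T hT using hT j hj q hq
  filter_upwards [this] with T hT
  exact optSum_isSome.2 fun q _ => hT q

/-! #### Agreement on a common subset -/

/-- A vote counts as done once the party has voted at all, with either bit. It is thus enough that
every honest party may eventually cast the same bit `v`. -/
theorem IsRun.eventually_out (hr : IsRun G K a b st x) (hf : Fair G K st x)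
    (hQ : QCond 4 Finset.univ G.Z) (hK : G.Admissible K) {sid : AbaId n h} {v : Bool}
    (hv : ∀ i ∉ K, ∀ᶠ T in atTop, ((st T).loc i).MayVote G sid v) :
    ∃ T, ((st T).aba sid).out.isSome := by
  have hvoted : ∀ᶠ T in atTop, ∀ i ∉ K, ((st T).loc i).voted sid = true := by
    refine eventually_honest fun i hi => ?_
    refine hr.eventually_done hf (y := .vote i sid v) trivial ?_
    filter_upwards [hv i hi] with T hT
    by_cases hs : ((st T).loc i).voted sid = true
    · exact Or.inl hs
    · exact Or.inr ⟨hi, by simpa using hs, hT⟩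
  obtain ⟨T, hT⟩ := hvoted.exists
  by_cases ho : ((st T).aba sid).out.isSome
  · exact ⟨T, ho⟩
  · exact hf.aba sid T fun i hi =>
      ((((hr.inv hQ hK T).aba sid).voted i hi (hT i hi)).resolve_right ho)

/-- Some instance outputs `1`: otherwise there is never an outcome, all honest parties may vote `1`
for a common party, and an output `0` there would stem from an honest zero vote, cast only after
seeing an output `1`. From then on everybody may vote `0` wherever it has not voted, so every
instance produces an output. -/
theorem IsRun.eventually_winner (hr : IsRun G K a b st x) (hf : Fair G K st x)
    (hQ : QCond 4 Finset.univ G.Z) (hK : G.Admissible K) {sid : Fin n → AbaId n h}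
    (hreq : ∀ i ∉ K, ∀ᶠ T in atTop, ∀ j, ((st T).loc i).RequestsAba G (sid j))
    (hvotes : ∀ T, ∀ i ∉ K, ∀ j, ((st T).loc i).Votes G (sid j) false →
      ∃ k, ((st T).loc i).aba (sid k) = some true)
    (hfalse : ∀ i ∉ K, ∀ᶠ T in atTop, ((st T).loc i).winner sid = none →
      (∃ k, ((st T).loc i).aba (sid k) = some true) → ∀ j, ((st T).loc i).MayVote G (sid j) false)
    (htrue : (∀ T, ∀ i, ((st T).loc i).winner sid = none) →
      ∃ j, ∀ i ∉ K, ∀ᶠ T in atTop, ((st T).loc i).MayVote G (sid j) true) :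
    ∀ᶠ T in atTop, ∀ i ∉ K, (((st T).loc i).winner sid).isSome := by
  have hmono : ∀ {j : Fin n} {v : Bool}, (∃ T, ((st T).aba (sid j)).out = some v) →
      ∀ᶠ T in atTop, ((st T).aba (sid j)).out = some v := fun {j v} hex =>
    hr.eventually_of_mono (P := fun s => (s.aba (sid j)).out = some v)
      (fun _ _ hle => hle.out _ _) hex
  have hone : ∃ k, ∃ T, ((st T).aba (sid k)).out = some true := by
    by_contra hno
    push Not at hno
    obtain ⟨j, hj⟩ := htrue fun T i => by
      by_contra hne
      obtain ⟨k, hk⟩ := Option.ne_none_iff_exists'.1 hne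
      exact hno k T ((hr.inv hQ hK T).loc_aba i _ _ (Local.winner_eq_some hk).2)
    obtain ⟨T, hT⟩ := hr.eventually_out hf hQ hK hj
    obtain ⟨v, hv⟩ := Option.isSome_iff_exists.1 hT
    have hI := hr.inv hQ hK T
    cases v with
    | true => exact hno j T hv
    | false =>
      obtain ⟨i, hi, hvote⟩ := (hI.aba (sid j)).out false hv
      obtain ⟨k, hk⟩ := hvotes T i hi j hvote
      exact hno k T (hI.loc_aba i _ _ hk)
  obtain ⟨k, hk⟩ := hone
  have hk' : ∀ i ∉ K, ∀ᶠ T in atTop, ((st T).loc i).aba (sid k) = some true := fun i hi => by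
    obtain ⟨T, hT⟩ := id hk
    have := hr.eventually_aba hf hi ((hreq i hi).mono fun T hT => hT k) ⟨T, by simp [hT]⟩
    filter_upwards [this, hmono hk] with T h1 h2
    obtain ⟨v, hv⟩ := Option.isSome_iff_exists.1 h1
    rw [hv, ← (hr.inv hQ hK T).loc_aba i _ _ hv, h2]
  have hall : ∀ j, ∃ T, ((st T).aba (sid j)).out.isSome := by
    intro j
    by_contra hno
    push Not at hno
    have hw : ∀ T i, ((st T).loc i).winner sid = none := fun T i => by
      by_contra hne
      obtain ⟨l, hl⟩ := Option.ne_none_iff_exists'.1 hne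
      obtain ⟨v, hv⟩ := Option.isSome_iff_exists.1 ((Local.winner_eq_some hl).1 j)
      have := (hr.inv hQ hK T).loc_aba i _ _ hv
      exact hno T (by simp [this])
    obtain ⟨T, hT⟩ := hr.eventually_out hf hQ hK (sid := sid j) (v := false) fun i hi => by
      filter_upwards [hfalse i hi, hk' i hi] with T h1 h2
      exact h1 (hw T i) ⟨k, h2⟩ j
    exact hno T hT
  refine eventually_honest fun i hi => ?_
  have : ∀ᶠ T in atTop, ∀ j, (((st T).loc i).aba (sid j)).isSome := by
    rw [eventually_all]
    exact fun j => hr.eventually_aba hf hi ((hreq i hi).mono fun T hT => hT j) (hall j)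
  filter_upwards [this, hk' i hi] with T h1 h2
  exact Local.winner_isSome.2 ⟨h1, k, h2⟩

end Live

/-! ### Progress within an iteration -/

section Progress
variable {n h : ℕ} {F : Type*}

theorem Local.AbaLE.inHop_of_none [Field F] [DecidableEq F] {G : Setup n h} {L : Local n h F}
    {iter m : ℕ} {z : Fin h} (hr : L.Reached G iter) (hv : L.Visits G iter z m)
    (hw : L.winner (AbaId.select iter z m) = none) :
    L.InHop G iter z m ∧ L.opt G iter z = L.optAt G iter z m := by
  have he : L.opt G iter z = L.optAt G iter z m := by
    refine Local.optAt_fixed G ?_ hv.1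
    rcases Local.advance_cases G (L := L) (iter := iter) (z := z) (L.optAt G iter z m) with
      e | ⟨j, -, hj, -⟩
    · exact e
    · rw [hv.2.1, hw] at hj; simp at hj
  refine ⟨⟨hr, ?_, ?_⟩, he⟩
  · rw [he, hv.2.1]
  · rw [he]; exact hv.2.2

variable [Field F] [DecidableEq F] {G : Setup n h} {K : Finset (Fin n)}
  {a b : Fin h → F} {st : ℕ → State n h F} {x : ℕ → Action n h F}

theorem Inv.GD_subset {s : State n h F} (hI : Inv G K a b s) (hQ : QCond 4 Finset.univ G.Z)
    (hK : G.Admissible K) {i j : Fin n} {iter : ℕ} (hi : (s.loc i).Reached G iter)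
    (hj : j ∈ (s.loc i).GD G iter) : j ∈ K := by
  obtain ⟨r, h1, h2, -, h4⟩ := hj
  exact (hI.discard hQ hK (hi.of_le h1 h2.le) h4).1

omit [Field F] [DecidableEq F] in
theorem exists_honest (hQ : QCond 4 Finset.univ G.Z) (hK : G.Admissible K) : ∃ i, i ∉ K := by
  obtain ⟨y, hy⟩ := hK
  obtain ⟨i, hi, -⟩ := hQ.exists_notMem y y y y
  exact ⟨i, fun h => hi (hy h)⟩

variable (G K st) in
/-- All honest parties reach the iteration. -/
def AllReached (iter : ℕ) : Prop := ∀ᶠ T in atTop, ∀ i ∉ K, ((st T).loc i).Reached G iter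

variable (G K st) in
/-- All honest parties complete the optimistic multiplications of the iteration, in the same way. -/
def AllComplete (iter : ℕ) (O : Fin h → OptState n h) : Prop :=
  ∀ᶠ T in atTop, ∀ i ∉ K, ((st T).loc i).Reached G iter ∧
    ∀ z, ((st T).loc i).opt G iter z = O z ∧ (O z).summands = ∅

variable (G K st) in
/-- All honest parties find that the iteration fails. -/
def AllConflict (iter : ℕ) (z₀ : Fin h) (O : Fin h → OptState n h) : Prop :=
  AllComplete G K st iter O ∧ ∀ᶠ T in atTop, ∀ i ∉ K, ((st T).loc i).Conflict G iter z₀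

variable [Fintype F] [NeZero h] {iter : ℕ} {z z₀ : Fin h} {O : Fin h → OptState n h} {j k : Fin n}

theorem IsRun.allConflict_of_exists (hr : IsRun G K a b st x) (hQ : QCond 4 Finset.univ G.Z)
    (hK : G.Admissible K)
    (he : ∀ᶠ T in atTop, ∀ i ∉ K, ((st T).loc i).Reached G iter ∧
      ∃ z, ((st T).loc i).Conflict G iter z) : ∃ z₀ O, AllConflict G K st iter z₀ O := by
  obtain ⟨i₀, hi₀⟩ := exists_honest hQ hK
  obtain ⟨T₀, hT₀⟩ := eventually_atTop.1 he
  obtain ⟨-, z₀, hz₀⟩ := hT₀ T₀ le_rfl i₀ hi₀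
  refine ⟨z₀, fun z => ((st T₀).loc i₀).opt G iter z, ?_, ?_⟩
  · filter_upwards [eventually_ge_atTop T₀] with T hT i hi
    obtain ⟨h1, z₁, h2⟩ := hT₀ T hT i hi
    refine ⟨h1, fun z => ⟨?_, hz₀.complete z⟩⟩
    have hle := ((hr.le hT).loc i₀).aba
    rw [← hle.opt_of_empty G (hz₀.complete z)]
    have hI := hr.inv hQ hK T
    exact (hI.abaLE i₀ i₀).opt_congr (hI.abaLE i i₀) (hle.complete hz₀.complete z) (h2.complete z)
  · filter_upwards [eventually_ge_atTop T₀] with T hT i hi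
    obtain ⟨h1, z₁, h2⟩ := hT₀ T hT i hi
    have := ((hr.le hT).loc i₀).conflict hQ hz₀
    rwa [(hr.inv hQ hK T).conflict_agree hQ hK this h2]

theorem IsRun.allConflict_of_lt (hr : IsRun G K a b st x) (hQ : QCond 4 Finset.univ G.Z)
    (hK : G.Admissible K) (hR : AllReached G K st iter) {r : ℕ} (h1 : 1 ≤ r) (h2 : r < iter) :
    ∃ z₀ O, AllConflict G K st r z₀ O := by
  refine hr.allConflict_of_exists hQ hK ?_
  filter_upwards [hR] with T hT i hi
  exact ⟨(hT i hi).of_le h1 h2.le, ((hT i hi).2 r h1 h2).1⟩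

/-! #### Delivery of the parts of the summand-sums -/

omit [Fintype F] [NeZero h] in
theorem AllConflict.opp_selected (hC : AllConflict G K st iter z₀ O) :
    ∀ᶠ T in atTop, ∀ i ∉ K, ((st T).loc i).Reached G iter ∧ ((st T).loc i).Conflict G iter z₀ ∧
      ∀ z, ((st T).loc i).sel G iter z = (O z).selected := by
  filter_upwards [hC.1, hC.2] with T h1 h2 i hi
  exact ⟨(h1 i hi).1, h2 i hi, fun z => by rw [Local.sel, ((h1 i hi).2 z).1]⟩

theorem IsRun.part_dealt (hr : IsRun G K a b st x) (hf : Fair G K st x)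
    (hQ : QCond 4 Finset.univ G.Z) (hK : G.Admissible K) (hC : AllConflict G K st iter z₀ O)
    (hz : z = z₀ ∨ z = G.ref iter) (hj : j ∈ (O z).selected)
    (hk : k ∈ (O (G.opp iter z₀ z)).selected) (hjK : j ∉ K) :
    ∃ T, ((st T).vss (.part iter z j k)).isSome := by
  refine (hr.eventually_done hf (y := .deal j (.part iter z j k)) trivial ?_).exists
  filter_upwards [hC.opp_selected] with T hT
  obtain ⟨h1, h2, h3⟩ := hT j hjK
  by_cases hs : ((st T).vss (.part iter z j k)).isSome
  · exact Or.inl hs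
  · exact Or.inr ⟨hjK, by simpa using hs, _, ((hr.inv hQ hK T).me j).symm, h1, z₀, h2, hz,
      by rwa [h3], by rwa [h3], rfl⟩

theorem IsRun.part_received (hr : IsRun G K a b st x) (hf : Fair G K st x)
    (hC : AllConflict G K st iter z₀ O)
    (hz : z = z₀ ∨ z = G.ref iter) (hj : j ∈ (O z).selected)
    (hk : k ∈ (O (G.opp iter z₀ z)).selected)
    (hd : ∃ T, ((st T).vss (.part iter z j k)).isSome) :
    ∀ᶠ T in atTop, ∀ i ∉ K, (((st T).loc i).vss (.part iter z j k)).isSome := by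
  refine eventually_honest fun i hi => hr.eventually_vss hf hi ?_ hd
  filter_upwards [hC.opp_selected] with T hT
  obtain ⟨h1, h2, h3⟩ := hT i hi
  exact ⟨h1, z₀, h2, hz, by rwa [h3], by rwa [h3]⟩

/-- An honest selected party deals all of its finitely many parts, and once they are delivered
nobody waits for it any more. -/
theorem IsRun.eventually_notMem_W (hr : IsRun G K a b st x) (hf : Fair G K st x)
    (hQ : QCond 4 Finset.univ G.Z) (hK : G.Admissible K) (hC : AllConflict G K st iter z₀ O)
    (hjK : j ∉ K) : ∀ᶠ T in atTop, ∀ i ∉ K, j ∉ ((st T).loc i).W G iter := by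
  have : ∀ᶠ T in atTop, ∀ z k, (z = z₀ ∨ z = G.ref iter) → j ∈ (O z).selected →
      k ∈ (O (G.opp iter z₀ z)).selected →
      ∀ i ∉ K, (((st T).loc i).vss (.part iter z j k)).isSome := by
    rw [eventually_all]; intro z
    rw [eventually_all]; intro k
    by_cases hc : (z = z₀ ∨ z = G.ref iter) ∧ j ∈ (O z).selected ∧
      k ∈ (O (G.opp iter z₀ z)).selected
    · filter_upwards [hr.part_received hf hC hc.1 hc.2.1 hc.2.2
        (hr.part_dealt hf hQ hK hC hc.1 hc.2.1 hc.2.2 hjK)] with T hT _ _ _ using hT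
    · exact Eventually.of_forall fun T h1 h2 h3 => absurd ⟨h1, h2, h3⟩ hc
  filter_upwards [this, hC.opp_selected] with T hT hC i hi hW
  obtain ⟨-, h2, h3⟩ := hC i hi
  obtain ⟨z₁, h4, z, h5, h6, k, h7, h8⟩ := hW
  obtain rfl := h2.unique h4
  rw [h3] at h6 h7
  have := hT z k h5 h6 h7 i hi
  simp [h8] at this

/-! #### Optimistic multiplication -/

/-- An honest candidate cannot be blocked: its dealing arrives, it leaves all earlier wait-lists,
and it is never discarded, locally or globally. -/
theorem IsRun.eventually_mayVote (hr : IsRun G K a b st x) (hf : Fair G K st x)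
    (hQ : QCond 4 Finset.univ G.Z) (hK : G.Admissible K) (hR : AllReached G K st iter) {m : ℕ}
    (hjK : j ∉ K) (hjz : j ∉ G.Z z)
    (hin : ∀ᶠ T in atTop, ∀ i ∉ K, ((st T).loc i).InHop G iter z m ∧
      j ∉ ((st T).loc i).sel G iter z) :
    ∀ i ∉ K, ∀ᶠ T in atTop, ((st T).loc i).MayVote G (.select iter z m j) true := by
  have hdeal : ∃ T, ((st T).vss (.sum iter z m j)).isSome := by
    refine (hr.eventually_done hf (y := .deal j (.sum iter z m j)) trivial ?_).exists
    filter_upwards [hin] with T hT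
    obtain ⟨h1, h2⟩ := hT j hjK
    by_cases hs : ((st T).vss (.sum iter z m j)).isSome
    · exact Or.inl hs
    · exact Or.inr ⟨hjK, by simpa using hs, _, ((hr.inv hQ hK T).me j).symm, h1, hjz, h2, rfl⟩
  have hW : ∀ᶠ T in atTop, ∀ r ∈ Finset.Ico 1 iter, ∀ i ∉ K, j ∉ ((st T).loc i).W G r := by
    rw [Finset.eventually_all]
    intro r hri
    rw [Finset.mem_Ico] at hri
    obtain ⟨z₀, O, hC⟩ := hr.allConflict_of_lt hQ hK hR hri.1 hri.2
    exact hr.eventually_notMem_W hf hQ hK hC hjK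
  intro i hi
  have hvss := hr.eventually_vss hf hi (sid := .sum iter z m j) (by
    filter_upwards [hin] with T hT
    obtain ⟨h1, -⟩ := hT i hi
    exact Local.requestsVss_sum.2 ⟨h1.1, h1.visits⟩) hdeal
  filter_upwards [hin, hW, hvss] with T h1 h2 h3
  obtain ⟨h4, h5⟩ := h1 i hi
  have hI := hr.inv hQ hK T
  refine ⟨h4, fun hj => hjK (hI.GD_subset hQ hK h4.1 hj), hjz, h5, fun r hr1 hr2 => ⟨?_, ?_⟩, ?_⟩
  · exact h2 r (Finset.mem_Ico.2 ⟨hr1, hr2⟩) i hi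
  · exact fun hj => hjK (hI.LD_subset hQ hK hj)
  · intro hn
    simp [hn] at h3

/-- Induction over the hops with one state common to all honest parties. An unselected honest
candidate makes the agreement terminate, and all winners agree with the global ABA outputs. -/
theorem IsRun.eventually_optAt (hr : IsRun G K a b st x) (hf : Fair G K st x)
    (hQ : QCond 4 Finset.univ G.Z) (hK : G.Admissible K) (hR : AllReached G K st iter)
    (z : Fin h) (m : ℕ) (hm : m ≤ n) : ∃ o : OptState n h, (o.hop = m ∨ o.summands = ∅) ∧
      ∀ᶠ T in atTop, ∀ i ∉ K, ((st T).loc i).optAt G iter z m = o := by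
  induction m with
  | zero => exact ⟨OptState.init G, Or.inl rfl, Eventually.of_forall fun _ _ _ => rfl⟩
  | succ m ih =>
    obtain ⟨o, ho, hev⟩ := ih (by omega)
    by_cases hs : o.summands = ∅
    · refine ⟨o, Or.inr hs, ?_⟩
      filter_upwards [hev] with T hT i hi
      rw [Local.optAt_succ, hT i hi]
      exact Local.advance_of_empty G hs
    have hhop : o.hop = m := ho.resolve_right hs
    have hvis : ∀ᶠ T in atTop, ∀ i ∉ K, ((st T).loc i).Reached G iter ∧
        ((st T).loc i).Visits G iter z m := by
      filter_upwards [hev, hR] with T h1 h2 i hi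
      refine ⟨h2 i hi, by omega, ?_⟩
      rw [h1 i hi]
      exact ⟨hhop, hs⟩
    have hwin := hr.eventually_winner hf hQ hK (sid := AbaId.select iter z m) (fun i hi => by
        filter_upwards [hvis] with T hT j
        exact Local.requestsAba_select.2 (hT i hi))
      (fun T i _ j hv => hv.2)
      (fun i hi => by
        filter_upwards [hvis] with T hT hw hk j
        exact ⟨(Local.AbaLE.inHop_of_none (hT i hi).1 (hT i hi).2 hw).1, hk⟩)
      (fun hnone => by
        obtain ⟨i₀, hi₀⟩ := exists_honest hQ hK
        obtain ⟨T, hT⟩ := hev.exists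
        have hgood : OptGood F G z o := by
          have hI := hr.inv hQ hK T
          rw [← hT i₀ hi₀]
          exact hI.optGood (hI.abaLE i₀ i₀) iter z m
        obtain ⟨j, h1, h2, h3⟩ := hgood.exists_unselected hQ hK hs
        refine ⟨j, hr.eventually_mayVote hf hQ hK hR h1 h2 ?_⟩
        filter_upwards [hvis, hev] with T hT hT' i hi
        obtain ⟨h4, h5⟩ := Local.AbaLE.inHop_of_none (hT i hi).1 (hT i hi).2 (hnone T i)
        refine ⟨h4, ?_⟩
        rwa [Local.sel, h5, hT' i hi])
    obtain ⟨i₀, hi₀⟩ := exists_honest hQ hK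
    obtain ⟨T₀, hT₀⟩ := hwin.exists
    obtain ⟨j, hj⟩ := Option.isSome_iff_exists.1 (hT₀ i₀ hi₀)
    refine ⟨o.next G z j, Or.inl (by simp [OptState.next, hhop]), ?_⟩
    filter_upwards [hwin, hev, eventually_ge_atTop T₀] with T h1 h2 h3 i hi
    have hI := hr.inv hQ hK T
    obtain ⟨j', hj'⟩ := Option.isSome_iff_exists.1 (h1 i hi)
    have e1 := (hI.abaLE i i₀).winner hj'
    have e2 := (hI.abaLE i₀ i₀).winner (((hr.le h3).loc i₀).aba.winner hj)
    obtain rfl : j = j' := Option.some_injective _ (e2.symm.trans e1)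
    rw [Local.optAt_succ, h2 i hi]
    exact Local.advance_of_winner G hs (by rw [hhop]; exact hj')

theorem IsRun.exists_allComplete (hr : IsRun G K a b st x) (hf : Fair G K st x)
    (hQ : QCond 4 Finset.univ G.Z) (hK : G.Admissible K) (hR : AllReached G K st iter) :
    ∃ O, AllComplete G K st iter O := by
  choose O hO hev using fun z => hr.eventually_optAt hf hQ hK hR z n le_rfl
  have hev' : ∀ᶠ T in atTop, ∀ z, ∀ i ∉ K, ((st T).loc i).optAt G iter z n = O z :=
    eventually_all.2 hev
  refine ⟨O, ?_⟩
  filter_upwards [hev', hR] with T h1 h2 i hi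
  refine ⟨h2 i hi, fun z => ⟨h1 z i hi, ?_⟩⟩
  rcases hO z with hhop | hs
  -- A counter equal to `n` would mean that all parties have been selected, while a remaining
  -- summand guarantees an unselected one.
  · by_contra hs
    have hI := hr.inv hQ hK T
    have hgood := hI.optGood (hI.abaLE i i) iter z n
    rw [h1 z i hi] at hgood
    have := hgood.hop_lt hQ hK hs
    omega
  · exact hs

/-- This holds for corrupt selected parties too: an honest voter had received its shares, so the
functionality holds the sharing and delivers it to everybody. -/
theorem IsRun.sum_received (hr : IsRun G K a b st x) (hf : Fair G K st x)
    (hQ : QCond 4 Finset.univ G.Z) (hK : G.Admissible K) (hO : AllComplete G K st iter O) :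
    ∀ᶠ T in atTop, ∀ i ∉ K, ∀ z j q, (((st T).loc i).sumShare G iter z j q).isSome := by
  have key : ∀ᶠ T in atTop, ∀ z j, ∀ m ∈ Finset.range n, (O z).hopOf j = some m →
      ∀ i ∉ K, (((st T).loc i).vss (.sum iter z m j)).isSome := by
    rw [eventually_all]; intro z
    rw [eventually_all]; intro j
    rw [Finset.eventually_all]; intro m _
    by_cases hm : (O z).hopOf j = some m
    swap
    · exact Eventually.of_forall fun _ h => absurd h hm
    have hd : ∃ T, ((st T).vss (.sum iter z m j)).isSome := by
      obtain ⟨i₀, hi₀⟩ := exists_honest hQ hK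
      obtain ⟨T, hT⟩ := hO.exists
      have hI := hr.inv hQ hK T
      have hm' : (((st T).loc i₀).opt G iter z).hopOf j = some m := by
        rw [((hT i₀ hi₀).2 z).1, hm]
      obtain ⟨i, hi, hv⟩ := hI.exists_voter (hI.abaLE i₀ i₀) (Local.optAt_hopOf G hm').1
      obtain ⟨-, -, -, -, -, hv⟩ := hv
      obtain ⟨w, hw⟩ := Option.ne_none_iff_exists'.1 hv
      obtain ⟨v, hv, -⟩ := hI.vss i _ w hw
      exact ⟨T, by simp [hv]⟩
    have : ∀ᶠ T in atTop, ∀ i ∉ K, (((st T).loc i).vss (.sum iter z m j)).isSome := by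
      refine eventually_honest fun i hi => hr.eventually_vss hf hi ?_ hd
      filter_upwards [hO] with T hT
      have hm' : (((st T).loc i).opt G iter z).hopOf j = some m := by
        rw [((hT i hi).2 z).1, hm]
      obtain ⟨-, h2, h3, h4, -⟩ := Local.optAt_hopOf G hm'
      exact Local.requestsVss_sum.2 ⟨(hT i hi).1, h2.le, h3, h4⟩
    filter_upwards [this] with T hT _ using hT
  filter_upwards [key, hO] with T h1 h2 i hi z j q
  unfold Local.sumShare
  cases hm : (((st T).loc i).opt G iter z).hopOf j with
  | none => rfl
  | some m =>
    have hlt := (Local.optAt_hopOf G hm).2.1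
    rw [((h2 i hi).2 z).1] at hm
    simpa using h1 z j m (Finset.mem_range.2 hlt) hm i hi

omit [Fintype F] [NeZero h] in
theorem AllComplete.complete (hO : AllComplete G K st iter O) :
    ∀ᶠ T in atTop, ∀ i ∉ K, ((st T).loc i).Complete G iter := by
  filter_upwards [hO] with T hT i hi z
  rw [((hT i hi).2 z).1]
  exact ((hT i hi).2 z).2

theorem IsRun.eventually_verdict (hr : IsRun G K a b st x) (hf : Fair G K st x)
    (hQ : QCond 4 Finset.univ G.Z) (hK : G.Admissible K) (hO : AllComplete G K st iter O) :
    ∀ᶠ T in atTop, ∀ i ∉ K, (((st T).loc i).verdict G iter).isSome := by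
  have hdiff : ∀ᶠ T in atTop, ∀ i ∉ K, ∀ z q, (((st T).loc i).diffIn G iter z q).isSome := by
    filter_upwards [hr.sum_received hf hQ hK hO, hO.complete] with T h1 h2 i hi z q
    have hp : ∀ z, (((st T).loc i).prodShare G iter z q).isSome := fun z => by
      unfold Local.prodShare
      rw [if_pos (h2 i hi z)]
      exact optSum_isSome.2 fun j _ => h1 i hi z j q
    obtain ⟨u, hu⟩ := Option.isSome_iff_exists.1 (hp z)
    obtain ⟨v, hv⟩ := Option.isSome_iff_exists.1 (hp (G.ref iter))
    simp [Local.diffIn, hu, hv]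
  have hval : ∀ i ∉ K, ∀ᶠ T in atTop, ∀ z, (((st T).loc i).diffVal G iter z).isSome := by
    intro i hi
    rw [eventually_all]
    intro z
    refine hr.eventually_recValue hf hQ hK hi (own := fun T => ((st T).loc i).diffIn G iter z) ?_ ?_
    · filter_upwards [hdiff] with T hT q _ using hT i hi z q
    · filter_upwards [hdiff, hO] with T hT hO j hj q _
      obtain ⟨v, hv⟩ := Option.isSome_iff_exists.1 (hT j hj z q)
      exact ⟨v, (hO j hj).1, hv⟩
  filter_upwards [eventually_honest hval, hO.complete] with T h1 h2 i hi
  exact Local.verdict_isSome.2 ⟨h2 i hi, h1 i hi⟩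

end Progress

/-! ### Cheater identification -/

section Identify
variable {n h : ℕ} {F : Type*} [Field F] [DecidableEq F] {G : Setup n h} {K : Finset (Fin n)}
  {a b : Fin h → F}

omit [DecidableEq F] in
theorem Local.sum_prodShare {L : Local n h F} {iter : ℕ} {z : Fin h} {x : Fin h → F}
    (hx : ∀ q, L.prodShare G iter z q = some (x q)) :
    ∑ q, x q = ∑ j ∈ L.sel G iter z, ∑ q, (L.sumShare G iter z j q).getD 0 := by
  have hq : ∀ q, ∑ j, (L.sumShare G iter z j q).getD 0 = x q := fun q => by
    have := hx q
    unfold Local.prodShare at this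
    split_ifs at this
    exact (optSum_eq_some.1 this).2
  rw [← Finset.sum_congr rfl fun q _ => hq q, Finset.sum_comm]
  symm
  refine Finset.sum_subset (Finset.subset_univ _) fun j _ hj => Finset.sum_eq_zero fun q _ => ?_
  have hn : (L.opt G iter z).hopOf j = none := by
    simpa [Local.sel, OptState.mem_selected] using hj
  simp [Local.sumShare, hn]

omit [DecidableEq F] in
theorem optSum_univ_getD {ι : Type*} [Fintype ι] {f : ι → Option F} {v : F}
    (hv : optSum Finset.univ f = some v) : ∑ i, (f i).getD 0 = v := (optSum_eq_some.1 hv).2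

omit [DecidableEq F] in
theorem Local.sum_pairIn {L : Local n h F} {iter : ℕ} {z₀ : Fin h} {j k : Fin n} {v : F}
    (hv : optSum Finset.univ (L.pairIn G iter z₀ j k) = some v) :
    v = ∑ q, (L.partShare iter z₀ j k q).getD 0 -
      ∑ q, (L.partShare iter (G.ref iter) k j q).getD 0 := by
  obtain ⟨w, hw, rfl⟩ := optSum_univ_eq_some hv
  rw [← Finset.sum_sub_distrib]
  refine Finset.sum_congr rfl fun q _ => ?_
  obtain ⟨x, y, hx, hy, e⟩ := map₂_eq_some.1 (hw q)
  rw [hx, hy]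
  exact e.symm

/-- If all parts add up, then two corresponding parts differ. -/
theorem Inv.exists_pair {s : State n h F} {iter : ℕ} {z₀ : Fin h} {i : Fin n}
    (hI : Inv G K a b s) (hQ : QCond 4 Finset.univ G.Z) (hK : G.Admissible K)
    (hz : (s.loc i).Conflict G iter z₀) (i₀ : Fin n)
    (hc : ∀ z, (z = z₀ ∨ z = G.ref iter) → ∀ j ∈ (s.glob i₀).sel G iter z,
      optSum Finset.univ ((s.glob i₀).checkIn G iter z₀ z j) = some 0) :
    ∃ j ∈ (s.glob i₀).sel G iter z₀, ∃ k ∈ (s.glob i₀).sel G iter (G.ref iter),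
      optSum Finset.univ ((s.glob i₀).pairIn G iter z₀ j k) ≠ some 0 := by
  by_contra hp
  push Not at hp
  have hcheck : ∀ z, (z = z₀ ∨ z = G.ref iter) → ∀ j ∈ (s.glob i₀).sel G iter z,
      ∑ q, ((s.glob i₀).sumShare G iter z j q).getD 0 =
        ∑ k ∈ (s.glob i₀).sel G iter (G.opp iter z₀ z),
          ∑ q, ((s.glob i₀).partShare iter z j k q).getD 0 := fun z hz j hj => by
    obtain ⟨x, y, hx, hy, e⟩ := sum_checkIn (hc z hz j hj)
    rw [Finset.sum_congr rfl fun q _ => by rw [hx q, Option.getD_some], sub_eq_zero.1 e.symm]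
    exact Finset.sum_congr rfl fun k hk => Finset.sum_congr rfl fun q _ => by
      rw [hy k hk q, Option.getD_some]
  obtain ⟨v, hv, h0⟩ := hz.diffVal
  obtain ⟨x, y, hx, hy, rfl⟩ := sum_diffIn (hI.diffVal_sound hQ hK i₀ hv)
  -- Both products become double sums of parts over the two selected sets. They agree termwise after
  -- exchanging the order of summation, contrary to the non-zero difference.
  refine h0 (sub_eq_zero.2 ?_)
  rw [Local.sum_prodShare hx, Local.sum_prodShare hy,
    Finset.sum_congr rfl (hcheck z₀ (Or.inl rfl)),
    Finset.sum_congr rfl (hcheck _ (Or.inr rfl)), Setup.opp_left,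
    Setup.opp_ref (hI.ne_ref hQ hK hz), Finset.sum_comm]
  refine Finset.sum_congr rfl fun k hk => Finset.sum_congr rfl fun j hj => ?_
  exact sub_eq_zero.1 (Local.sum_pairIn (hp j hj k hk)).symm

variable {st : ℕ → State n h F} {x : ℕ → Action n h F} [Fintype F] [NeZero h]
  {iter : ℕ} {z₀ : Fin h} {O : Fin h → OptState n h} {j k : Fin n}

variable (G K st) in
/-- All parts are dealt in the cheater identification of a failed iteration. -/
def AllDealt (iter : ℕ) (z₀ : Fin h) (O : Fin h → OptState n h) : Prop :=
  ∀ z, (z = z₀ ∨ z = G.ref iter) → ∀ j ∈ (O z).selected, ∀ k ∈ (O (G.opp iter z₀ z)).selected,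
    ∃ T, ((st T).vss (.part iter z j k)).isSome

theorem IsRun.eventually_partShare (hr : IsRun G K a b st x) (hf : Fair G K st x)
    (hC : AllConflict G K st iter z₀ O) (hD : AllDealt G st iter z₀ O) :
    ∀ᶠ T in atTop, ∀ i ∉ K, ∀ z, (z = z₀ ∨ z = G.ref iter) → ∀ j ∈ (O z).selected,
      ∀ k ∈ (O (G.opp iter z₀ z)).selected, ∀ q,
        (((st T).loc i).partShare iter z j k q).isSome := by
  have : ∀ᶠ T in atTop, ∀ z, (z = z₀ ∨ z = G.ref iter) → ∀ j ∈ (O z).selected,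
      ∀ k ∈ (O (G.opp iter z₀ z)).selected,
        ∀ i ∉ K, (((st T).loc i).vss (.part iter z j k)).isSome := by
    rw [eventually_all]; intro z
    rw [eventually_imp_distrib_left]; intro hz
    rw [Finset.eventually_all]; intro j hj
    rw [Finset.eventually_all]; intro k hk
    exact hr.part_received hf hC hz hj hk (hD z hz j hj k hk)
  filter_upwards [this] with T hT i hi z hz j hj k hk q
  simpa [Local.partShare] using hT z hz j hj k hk i hi

theorem IsRun.eventually_checkVal (hr : IsRun G K a b st x) (hf : Fair G K st x)
    (hQ : QCond 4 Finset.univ G.Z) (hK : G.Admissible K)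
    (hC : AllConflict G K st iter z₀ O) (hD : AllDealt G st iter z₀ O) :
    ∀ᶠ T in atTop, ∀ i ∉ K, ∀ z, (z = z₀ ∨ z = G.ref iter) → ∀ j ∈ (O z).selected,
      (((st T).loc i).checkVal G iter z₀ z j).isSome := by
  have hin : ∀ᶠ T in atTop, ∀ i ∉ K, ∀ z, (z = z₀ ∨ z = G.ref iter) → ∀ j ∈ (O z).selected,
      ∀ q, (((st T).loc i).checkIn G iter z₀ z j q).isSome := by
    filter_upwards [hr.eventually_partShare hf hC hD, hr.sum_received hf hQ hK hC.1,
      hC.opp_selected] with T h1 h2 h3 i hi z hz j hj q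
    obtain ⟨u, hu⟩ := Option.isSome_iff_exists.1 (h2 i hi z j q)
    obtain ⟨v, hv⟩ := Option.isSome_iff_exists.1
      (optSum_isSome (s := ((st T).loc i).sel G iter (G.opp iter z₀ z)).2 fun k hk =>
        h1 i hi z hz j hj k (by rwa [(h3 i hi).2.2] at hk) q)
    simp [Local.checkIn, hu, hv]
  refine eventually_honest fun i hi => ?_
  rw [eventually_all]; intro z
  rw [eventually_imp_distrib_left]; intro hz
  rw [Finset.eventually_all]; intro j hj
  refine hr.eventually_recValue hf hQ hK hi
    (own := fun T => ((st T).loc i).checkIn G iter z₀ z j) ?_ ?_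
  · filter_upwards [hin] with T hT q _ using hT i hi z hz j hj q
  · filter_upwards [hin, hC.opp_selected] with T h1 h2 i' hi' q _
    obtain ⟨h3, h4, h5⟩ := h2 i' hi'
    obtain ⟨v, hv⟩ := Option.isSome_iff_exists.1 (h1 i' hi' z hz j hj q)
    exact ⟨v, h3, z₀, h4, hz, by rwa [h5], hv⟩

theorem IsRun.eventually_pairVal (hr : IsRun G K a b st x) (hf : Fair G K st x)
    (hQ : QCond 4 Finset.univ G.Z) (hK : G.Admissible K)
    (hC : AllConflict G K st iter z₀ O) (hD : AllDealt G st iter z₀ O)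
    (hj : j ∈ (O z₀).selected) (hk : k ∈ (O (G.ref iter)).selected) :
    ∀ᶠ T in atTop, ∀ i ∉ K, (((st T).loc i).pairVal G iter z₀ j k).isSome := by
  have hin : ∀ᶠ T in atTop, ∀ i ∉ K, ∀ q, (((st T).loc i).pairIn G iter z₀ j k q).isSome := by
    obtain ⟨i₀, hi₀⟩ := exists_honest hQ hK
    obtain ⟨T₀, hT₀⟩ := hC.2.exists
    have hne := (hr.inv hQ hK T₀).ne_ref hQ hK (hT₀ i₀ hi₀)
    filter_upwards [hr.eventually_partShare hf hC hD] with T h1 i hi q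
    obtain ⟨u, hu⟩ := Option.isSome_iff_exists.1
      (h1 i hi z₀ (Or.inl rfl) j hj k (by rwa [Setup.opp_left]) q)
    obtain ⟨v, hv⟩ := Option.isSome_iff_exists.1
      (h1 i hi (G.ref iter) (Or.inr rfl) k hk j (by rwa [Setup.opp_ref hne]) q)
    simp [Local.pairIn, hu, hv]
  refine eventually_honest fun i hi => ?_
  refine hr.eventually_recValue hf hQ hK hi
    (own := fun T => ((st T).loc i).pairIn G iter z₀ j k) ?_ ?_
  · filter_upwards [hin] with T hT q _ using hT i hi q
  · filter_upwards [hin, hC.opp_selected] with T h1 h2 i' hi' q _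
    obtain ⟨h3, h4, h5⟩ := h2 i' hi'
    obtain ⟨v, hv⟩ := Option.isSome_iff_exists.1 (h1 i' hi' q)
    exact ⟨v, h3, z₀, h4, by rwa [h5], by rwa [h5], hv⟩

theorem IsRun.eventually_partVal (hr : IsRun G K a b st x) (hf : Fair G K st x)
    (hQ : QCond 4 Finset.univ G.Z) (hK : G.Admissible K)
    (hC : AllConflict G K st iter z₀ O) (hD : AllDealt G st iter z₀ O)
    (hM : ∀ᶠ T in atTop, ∀ i ∉ K, ((st T).loc i).Mismatch G iter z₀ j k)
    (hj : j ∈ (O z₀).selected) (hk : k ∈ (O (G.ref iter)).selected) :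
    ∀ᶠ T in atTop, ∀ i ∉ K, (((st T).loc i).partVal G iter z₀ j k).isSome ∧
      (((st T).loc i).partVal G iter (G.ref iter) k j).isSome := by
  obtain ⟨i₀, hi₀⟩ := exists_honest hQ hK
  obtain ⟨T₀, hT₀⟩ := hC.2.exists
  have hne := (hr.inv hQ hK T₀).ne_ref hQ hK (hT₀ i₀ hi₀)
  have hin : ∀ᶠ T in atTop, ∀ i ∉ K, ∀ q, (((st T).loc i).partShare iter z₀ j k q).isSome ∧
      (((st T).loc i).partShare iter (G.ref iter) k j q).isSome := by
    filter_upwards [hr.eventually_partShare hf hC hD] with T h1 i hi q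
    exact ⟨h1 i hi z₀ (Or.inl rfl) j hj k (by rwa [Setup.opp_left]) q,
      h1 i hi (G.ref iter) (Or.inr rfl) k hk j (by rwa [Setup.opp_ref hne]) q⟩
  refine eventually_honest fun i hi => Filter.Eventually.and ?_ ?_
  · refine hr.eventually_recValue hf hQ hK hi
      (own := fun T => ((st T).loc i).partShare iter z₀ j k) ?_ ?_
    · filter_upwards [hin] with T hT q _ using (hT i hi q).1
    · filter_upwards [hin, hM, hC.opp_selected] with T h1 h2 h3 i' hi' q _
      obtain ⟨v, hv⟩ := Option.isSome_iff_exists.1 (h1 i' hi' q).1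
      exact ⟨v, (h3 i' hi').1, z₀, (h3 i' hi').2.1, Or.inl ⟨rfl, h2 i' hi'⟩, hv⟩
  · refine hr.eventually_recValue hf hQ hK hi
      (own := fun T => ((st T).loc i).partShare iter (G.ref iter) k j) ?_ ?_
    · filter_upwards [hin] with T hT q _ using (hT i hi q).2
    · filter_upwards [hin, hM, hC.opp_selected] with T h1 h2 h3 i' hi' q _
      obtain ⟨v, hv⟩ := Option.isSome_iff_exists.1 (h1 i' hi' q).2
      exact ⟨v, (h3 i' hi').1, z₀, (h3 i' hi').2.1, Or.inr ⟨rfl, h2 i' hi'⟩, hv⟩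

theorem IsRun.eventually_commonVal (hr : IsRun G K a b st x) (hf : Fair G K st x)
    (hQ : QCond 4 Finset.univ G.Z) (hK : G.Admissible K)
    (hC : AllConflict G K st iter z₀ O)
    (hM : ∀ᶠ T in atTop, ∀ i ∉ K, ((st T).loc i).Mismatch G iter z₀ j k) :
    ∀ᶠ T in atTop, ∀ i ∉ K, (((st T).loc i).commonVal G iter z₀ j k).isSome := by
  have hcommon : ∀ᶠ T in atTop, ∀ i ∉ K, ((st T).loc i).common G iter z₀ j k =
      (O z₀).own j ∩ (O (G.ref iter)).own k := by
    filter_upwards [hC.1] with T hT i hi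
    rw [Local.common, Local.summ, Local.summ, ((hT i hi).2 _).1, ((hT i hi).2 _).1]
  refine eventually_honest fun i hi => ?_
  have hsh : ∀ᶠ T in atTop, ∀ pq ∈ (O z₀).own j ∩ (O (G.ref iter)).own k,
      (((st T).loc i).recShare G (.inputA iter j k)
        (fun p => some (((st T).loc i).a p)) pq.1).isSome ∧
      (((st T).loc i).recShare G (.inputB iter j k)
        (fun p => some (((st T).loc i).b p)) pq.2).isSome := by
    rw [Finset.eventually_all]; intro pq hpq
    refine Filter.Eventually.and ?_ ?_
    · refine hr.eventually_recShare hf hQ hK hi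
        (own := fun T p => some (((st T).loc i).a p)) (fun _ => .of_forall fun _ => rfl) ?_
      intro j' hj' _
      filter_upwards [hM, hcommon, hC.opp_selected] with T h1 h2 h3
      exact ⟨_, (h3 j' hj').1, z₀, (h3 j' hj').2.1, h1 j' hj', ⟨pq.2, by rwa [h2 j' hj']⟩, rfl⟩
    · refine hr.eventually_recShare hf hQ hK hi
        (own := fun T p => some (((st T).loc i).b p)) (fun _ => .of_forall fun _ => rfl) ?_
      intro j' hj' _
      filter_upwards [hM, hcommon, hC.opp_selected] with T h1 h2 h3
      exact ⟨_, (h3 j' hj').1, z₀, (h3 j' hj').2.1, h1 j' hj', ⟨pq.1, by rwa [h2 j' hj']⟩, rfl⟩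
  filter_upwards [hsh, hcommon] with T h1 h2
  refine optSum_isSome.2 fun pq hpq => ?_
  rw [h2 i hi] at hpq
  obtain ⟨u, hu⟩ := Option.isSome_iff_exists.1 (h1 pq hpq).1
  obtain ⟨v, hv⟩ := Option.isSome_iff_exists.1 (h1 pq hpq).2
  simp [hu, hv]

/-- If all parts are dealt, then all honest parties discard the same corrupt party. -/
theorem IsRun.exists_LD (hr : IsRun G K a b st x) (hf : Fair G K st x)
    (hQ : QCond 4 Finset.univ G.Z) (hK : G.Admissible K)
    (hC : AllConflict G K st iter z₀ O) (hD : AllDealt G st iter z₀ O) :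
    ∃ j, ∀ᶠ T in atTop, ∀ i ∉ K, j ∈ ((st T).loc i).LD G iter := by
  obtain ⟨i₀, hi₀⟩ := exists_honest hQ hK
  have hchk := hr.eventually_checkVal hf hQ hK hC hD
  -- Failing infinitely often provides a moment at which the check value is also reconstructed.
  -- Otherwise there is one time after which all checks vanish, and some pair must differ.
  by_cases hA : ∃ z, (z = z₀ ∨ z = G.ref iter) ∧ ∃ j ∈ (O z).selected,
      ∃ᶠ T in atTop, optSum Finset.univ (((st T).glob i₀).checkIn G iter z₀ z j) ≠ some 0
  · obtain ⟨z, hz, j, hj, hne⟩ := hA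
    have hsel := hC.opp_selected
    obtain ⟨T₀, hne, hT₀, hs₀⟩ := (hne.and_eventually (hchk.and hsel)).exists
    obtain ⟨v, hv⟩ := Option.isSome_iff_exists.1 (hT₀ i₀ hi₀ z hz j hj)
    have hI₀ := hr.inv hQ hK T₀
    rw [hI₀.checkVal_sound hQ hK (hs₀ i₀ hi₀).2.1 i₀ hv] at hne
    refine ⟨j, ?_⟩
    filter_upwards [hchk, hsel, eventually_ge_atTop T₀] with T h1 h2 h3 i hi
    obtain ⟨w, hw⟩ := Option.isSome_iff_exists.1 (h1 i hi z hz j hj)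
    have hI := hr.inv hQ hK T
    have e1 := hI.checkVal_sound hQ hK (h2 i hi).2.1 i₀ hw
    have e2 := hI.checkVal_sound hQ hK (h2 i₀ hi₀).2.1 i₀
      (((hr.le h3).loc i₀).checkVal hQ (hs₀ i₀ hi₀).2.1.complete hv)
    rw [e1] at e2
    exact ⟨z₀, (h2 i hi).2.1, Or.inl ⟨z, hz, by rw [(h2 i hi).2.2]; exact hj, w, hw,
      fun h0 => hne (by rw [← e2, h0])⟩⟩
  · push Not at hA
    have hzero : ∀ᶠ T in atTop, ∀ z, (z = z₀ ∨ z = G.ref iter) → ∀ j ∈ (O z).selected,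
        optSum Finset.univ (((st T).glob i₀).checkIn G iter z₀ z j) = some 0 := by
      rw [eventually_all]; intro z
      rw [eventually_imp_distrib_left]; intro hz
      rw [Finset.eventually_all]; intro j hj
      simpa using hA z hz j hj
    have hsel := hC.opp_selected
    have hpv : ∀ᶠ T in atTop, ∀ j ∈ (O z₀).selected, ∀ k ∈ (O (G.ref iter)).selected,
        ∀ i ∉ K, (((st T).loc i).pairVal G iter z₀ j k).isSome := by
      rw [Finset.eventually_all]; intro j hj
      rw [Finset.eventually_all]; intro k hk
      exact hr.eventually_pairVal hf hQ hK hC hD hj hk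
    obtain ⟨T₀, hz₀, hs₀, hp₀⟩ := (hzero.and (hsel.and hpv)).exists
    have hI₀ := hr.inv hQ hK T₀
    have hconf := (hs₀ i₀ hi₀).2.1
    have hglob : ∀ z, ((st T₀).glob i₀).sel G iter z = (O z).selected := fun z => by
      rw [(hI₀.abaLE i₀ i₀).sel_eq hconf.complete, (hs₀ i₀ hi₀).2.2]
    obtain ⟨j, hj, k, hk, hne⟩ := hI₀.exists_pair hQ hK hconf i₀ fun z hz j hj =>
      hz₀ z hz j (by rwa [hglob] at hj)
    rw [hglob] at hj hk
    have hpair : ∀ᶠ T in atTop, ∀ i ∉ K, ∃ v, v ≠ 0 ∧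
        ((st T).loc i).pairVal G iter z₀ j k = some v := by
      obtain ⟨u, hu⟩ := Option.isSome_iff_exists.1 (hp₀ j hj k hk i₀ hi₀)
      filter_upwards [hpv, hsel, eventually_ge_atTop T₀] with T h1 h2 h3 i hi
      obtain ⟨v, hv⟩ := Option.isSome_iff_exists.1 (h1 j hj k hk i hi)
      refine ⟨v, ?_, hv⟩
      rintro rfl
      have e := (hr.inv hQ hK T).pairVal_sound hQ hK (h2 i hi).2.1 i₀ hv
      rw [(hr.inv hQ hK T).pairVal_sound hQ hK (h2 i₀ hi₀).2.1 i₀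
        (((hr.le h3).loc i₀).pairVal hQ hu)] at e
      exact hne ((hI₀.pairVal_sound hQ hK hconf i₀ hu).trans e)
    have hM : ∀ᶠ T in atTop, ∀ i ∉ K, ((st T).loc i).Mismatch G iter z₀ j k := by
      filter_upwards [hpair, hsel] with T h1 h2 i hi
      obtain ⟨v, h0, hv⟩ := h1 i hi
      exact ⟨by rwa [(h2 i hi).2.2], by rwa [(h2 i hi).2.2], v, hv, h0⟩
    have hall := ((hr.eventually_partVal hf hQ hK hC hD hM hj hk).and
      (hr.eventually_commonVal hf hQ hK hC hM)).and (hpair.and (hM.and hsel))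
    have hval : ∀ᶠ T in atTop, ∀ i ∉ K, ∃ d e s, d ≠ e ∧
        ((st T).loc i).partVal G iter z₀ j k = some d ∧
        ((st T).loc i).partVal G iter (G.ref iter) k j = some e ∧
        ((st T).loc i).commonVal G iter z₀ j k = some s := by
      filter_upwards [hall] with T ⟨⟨h1, h2⟩, h3, h4, h5⟩ i hi
      obtain ⟨d, hd⟩ := Option.isSome_iff_exists.1 (h1 i hi).1
      obtain ⟨e, he⟩ := Option.isSome_iff_exists.1 (h1 i hi).2
      obtain ⟨s, hs⟩ := Option.isSome_iff_exists.1 (h2 i hi)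
      obtain ⟨v, h0, hv⟩ := h3 i hi
      refine ⟨d, e, s, fun hde => h0 ?_, hd, he, hs⟩
      have hI := hr.inv hQ hK T
      rw [Local.sum_pairIn (hI.pairVal_sound hQ hK (h5 i hi).2.1 i₀ hv), sub_eq_zero,
        optSum_univ_getD (hI.partVal_sound hQ hK i₀ hd),
        optSum_univ_getD (hI.partVal_sound hQ hK i₀ he), hde]
    obtain ⟨T₁, h1, h2, h3⟩ := (hval.and (hM.and hsel)).exists
    obtain ⟨d, e, s, hde, hd, he, hs⟩ := h1 i₀ hi₀
    -- The opened values are functions of the global record, so all honest parties obtain those that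
    -- `i₀` has at `T₁` and hence name the same culprit.
    have key : ∀ T ≥ T₁, ∀ i ∉ K, ∀ d' e' s',
        ((st T).loc i).Conflict G iter z₀ →
        ((st T).loc i).partVal G iter z₀ j k = some d' →
        ((st T).loc i).partVal G iter (G.ref iter) k j = some e' →
        ((st T).loc i).commonVal G iter z₀ j k = some s' → d' = d ∧ e' = e ∧ s' = s := by
      intro T hT i hi d' e' s' hc hd' he' hs'
      have hI := hr.inv hQ hK T
      have hle := (hr.le hT).loc i₀
      have hc₀ := (h3 i₀ hi₀).2.1
      refine ⟨?_, ?_, ?_⟩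
      · have e1 := hI.partVal_sound hQ hK i₀ hd'
        rw [hI.partVal_sound hQ hK i₀ (hle.partVal hQ hd)] at e1
        exact (Option.some_injective _ e1).symm
      · have e1 := hI.partVal_sound hQ hK i₀ he'
        rw [hI.partVal_sound hQ hK i₀ (hle.partVal hQ he)] at e1
        exact (Option.some_injective _ e1).symm
      · rw [hI.commonVal_sound hQ hK hs',
          hI.commonVal_sound hQ hK (hle.commonVal hQ hc₀.complete hs)]
        congr 1
        rw [Local.common, Local.common, ← (hI.abaLE i i₀).summ_eq hc.complete,
          ← (hI.abaLE i i₀).summ_eq hc.complete,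
          ← (hI.abaLE i₀ i₀).summ_eq (hle.conflict hQ hc₀).complete,
          ← (hI.abaLE i₀ i₀).summ_eq (hle.conflict hQ hc₀).complete]
    -- Two different parts cannot both equal the correct sum `s`.
    by_cases hds : d = s
    · refine ⟨k, ?_⟩
      filter_upwards [hval, hM, hsel, eventually_ge_atTop T₁] with T h4 h5 h6 h7 i hi
      obtain ⟨d', e', s', -, hd', he', hs'⟩ := h4 i hi
      obtain ⟨-, rfl, rfl⟩ := key T h7 i hi d' e' s' (h6 i hi).2.1 hd' he' hs'
      exact ⟨z₀, (h6 i hi).2.1, Or.inr <| Or.inr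
        ⟨j, h5 i hi, _, _, he', hs', fun h => hde (hds.trans h.symm)⟩⟩
    · refine ⟨j, ?_⟩
      filter_upwards [hval, hM, hsel, eventually_ge_atTop T₁] with T h4 h5 h6 h7 i hi
      obtain ⟨d', e', s', -, hd', he', hs'⟩ := h4 i hi
      obtain ⟨rfl, -, rfl⟩ := key T h7 i hi d' e' s' (h6 i hi).2.1 hd' he' hs'
      exact ⟨z₀, (h6 i hi).2.1, Or.inr <| Or.inl ⟨k, h5 i hi, _, _, hd', hs', hds⟩⟩

end Identify

/-! ### Termination -/

section Termination
variable {n h : ℕ} {F : Type*} [Field F] [DecidableEq F] {G : Setup n h} {K : Finset (Fin n)}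
  {a b : Fin h → F}

theorem Local.exists_sel_of_mem_LD {L : Local n h F} {iter : ℕ} {j : Fin n}
    (hj : j ∈ L.LD G iter) : ∃ z, j ∈ L.sel G iter z := by
  obtain ⟨z₀, -, ⟨z, -, hj, -⟩ | ⟨k, hm, -⟩ | ⟨k, hm, -⟩⟩ := hj
  · exact ⟨z, hj⟩
  · exact ⟨_, hm.1⟩
  · exact ⟨_, hm.2.1⟩

variable {st : ℕ → State n h F} {x : ℕ → Action n h F} [Fintype F] [NeZero h]
  {iter : ℕ} {z z₀ : Fin h} {O : Fin h → OptState n h} {j k : Fin n}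

/-- A party that is selected in a later iteration has dealt all of its parts. -/
theorem IsRun.dealt_of_selected (hr : IsRun G K a b st x) (hQ : QCond 4 Finset.univ G.Z)
    (hK : G.Admissible K) (hC : AllConflict G K st iter z₀ O)
    (hz : z = z₀ ∨ z = G.ref iter) (hj : j ∈ (O z).selected)
    (hk : k ∈ (O (G.opp iter z₀ z)).selected) {iter' : ℕ} {O' : Fin h → OptState n h}
    (hC' : AllComplete G K st iter' O') (hlt : iter < iter') {z' : Fin h}
    (hj' : j ∈ (O' z').selected) : ∃ T, ((st T).vss (.part iter z j k)).isSome := by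
  obtain ⟨i₀, hi₀⟩ := exists_honest hQ hK
  obtain ⟨T, h1, h2⟩ := (hC.opp_selected.and hC').exists
  obtain ⟨m, hm⟩ := Option.isSome_iff_exists.1 (OptState.mem_selected.1 hj')
  rw [← ((h2 i₀ hi₀).2 z').1] at hm
  obtain ⟨h3, -, h4, -⟩ := Local.optAt_hopOf G hm
  have hI := hr.inv hQ hK T
  obtain ⟨-, -, i, hi, hv⟩ := hI.fresh (hI.abaLE i₀ i₀) h4 h3
  obtain ⟨h5, h6, h7⟩ := h1 i hi
  have hW := hv.2.2.2.2.1 iter h5.1 hlt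
  cases hn : ((st T).loc i).vss (.part iter z j k) with
  | none => exact absurd ⟨z₀, h6, z, hz, by rwa [h7], k, by rwa [h7], hn⟩ hW
  | some w =>
    obtain ⟨v, hv, -⟩ := hI.vss i _ w hn
    exact ⟨T, by simp [hv]⟩

/-- In every block of failed iterations there is one in which all parts are dealt. -/
theorem IsRun.exists_allDealt (hr : IsRun G K a b st x) (hf : Fair G K st x)
    (hQ : QCond 4 Finset.univ G.Z) (hK : G.Admissible K) (hle : G.block ≤ iter)
    (hC : ∀ r, 1 ≤ r → r ≤ iter → ∃ z₀ O, AllConflict G K st r z₀ O) :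
    ∃ r z₀ O, iter - G.block < r ∧ r ≤ iter ∧ AllConflict G K st r z₀ O ∧
      AllDealt G st r z₀ O := by
  by_contra hno
  push Not at hno
  have : Nonempty (Fin n) := ⟨⟨0, hQ.pos hK⟩⟩
  -- To every iteration of the block is assigned a party that withholds a part for ever; it is
  -- corrupt since honest parties deal.
  have hbad : ∀ r ∈ Finset.Ioc (iter - G.block) iter, ∃ j ∈ K, ∃ z₀ O z k,
      AllConflict G K st r z₀ O ∧ (z = z₀ ∨ z = G.ref r) ∧ j ∈ (O z).selected ∧
        k ∈ (O (G.opp r z₀ z)).selected ∧ ¬ ∃ T, ((st T).vss (.part r z j k)).isSome := by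
    intro r hri
    rw [Finset.mem_Ioc] at hri
    obtain ⟨z₀, O, hcr⟩ := hC r (by omega) hri.2
    have := hno r z₀ O hri.1 hri.2 hcr
    unfold AllDealt at this
    push Not at this
    obtain ⟨z, hz, j, hj, k, hk, hd⟩ := this
    refine ⟨j, ?_, z₀, O, z, k, hcr, hz, hj, hk, by simpa using hd⟩
    by_contra hjK
    obtain ⟨T, hT⟩ := hr.part_dealt hf hQ hK hcr hz hj hk hjK
    exact hd T hT
  choose! f hfK hfb using hbad
  -- There are at most `t` corrupt parties, fewer than the `t * n + 1` iterations of the block. Two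
  -- iterations would share a withholding party, which could not have been selected in the later
  -- one.
  have hcard : K.card < (Finset.Ioc (iter - G.block) iter).card := by
    have hn := hQ.pos hK
    have hb : G.block = G.t * n + 1 := rfl
    have ht := hK.card_le
    have := Nat.le_mul_of_pos_right G.t hn
    rw [Nat.card_Ioc]
    omega
  have key : ∀ r ∈ Finset.Ioc (iter - G.block) iter, ∀ r' ∈ Finset.Ioc (iter - G.block) iter,
      f r = f r' → ¬ r < r' := by
    intro r hri r' hri' he hlt
    obtain ⟨z₀, O, z, k, hcr, hz, hj, hk, hd⟩ := hfb r hri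
    obtain ⟨z₀', O', z', k', hcr', -, hj', -⟩ := hfb r' hri'
    exact hd (hr.dealt_of_selected hQ hK hcr hz hj hk hcr'.1 hlt (he ▸ hj'))
  obtain ⟨r, hri, r', hri', hne, he⟩ :=
    Finset.exists_ne_map_eq_of_card_lt_of_maps_to hcard fun r hri => hfK r hri
  rcases lt_or_gt_of_ne hne with hlt | hlt
  · exact key r hri r' hri' he hlt
  · exact key r' hri' r hri he.symm hlt

theorem IsRun.eventually_discard (hr : IsRun G K a b st x) (hf : Fair G K st x)
    (hQ : QCond 4 Finset.univ G.Z) (hK : G.Admissible K) (hC : AllConflict G K st iter z₀ O)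
    (hb : G.block ∣ iter) :
    ∀ᶠ T in atTop, ∀ i ∉ K, (((st T).loc i).winner (AbaId.discard iter)).isSome := by
  have hin : ∀ᶠ T in atTop, ∀ i ∉ K, ((st T).loc i).InDiscard G iter := by
    filter_upwards [hC.opp_selected] with T hT i hi
    exact ⟨(hT i hi).1, hb, z₀, (hT i hi).2.1⟩
  have hR : AllReached G K st iter := by
    filter_upwards [hin] with T hT i hi using (hT i hi).1
  refine hr.eventually_winner hf hQ hK (sid := AbaId.discard iter) (fun i hi => ?_)
    (fun T i _ j hv => hv.2) (fun i hi => ?_) (fun hnone => ?_)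
  · filter_upwards [hin] with T hT j using hT i hi
  · filter_upwards [hin] with T hT hw hk j using ⟨hT i hi, hw, hk⟩
  · obtain ⟨i₀, hi₀⟩ := exists_honest hQ hK
    obtain ⟨T₀, hT₀⟩ := hR.exists
    have hle := Nat.le_of_dvd (hT₀ i₀ hi₀).1 hb
    obtain ⟨r, z₁, O₁, h1, h2, h3, h4⟩ := hr.exists_allDealt hf hQ hK hle fun r h1 h2 => by
      rcases h2.eq_or_lt with rfl | hlt
      · exact ⟨z₀, O, hC⟩
      · exact hr.allConflict_of_lt hQ hK hR h1 hlt
    obtain ⟨j, hj⟩ := hr.exists_LD hf hQ hK h3 h4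
    refine ⟨j, fun i hi => ?_⟩
    filter_upwards [hj, hin] with T hj hin
    have hI := hr.inv hQ hK T
    have hrr := (hin i hi).1
    refine ⟨hin i hi, hnone T i, ⟨r, by omega, h2, hj i hi⟩, ?_⟩
    rintro ⟨s, h5, h6, h7, h8⟩
    -- The culprit was selected in iteration `r`, so it was not discarded before `r`; and no
    -- multiple of the block length lies between `r` and `iter - 1`. It is therefore new.
    obtain ⟨z, hz⟩ := Local.exists_sel_of_mem_LD (hj i hi)
    refine hI.notMem_GD_of_sel (hrr.of_le (by omega) h2) (hI.abaLE i i) hz ⟨s, h5, ?_, h7, h8⟩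
    have := Nat.le_of_dvd (by omega) (Nat.dvd_sub hb h7)
    omega

theorem IsRun.allReached_succ (hr : IsRun G K a b st x) (hf : Fair G K st x)
    (hQ : QCond 4 Finset.univ G.Z) (hK : G.Admissible K) (hR : AllReached G K st iter) :
    AllReached G K st (iter + 1) ∨ ∀ᶠ T in atTop, ∀ i ∉ K, ((st T).loc i).Finished G := by
  obtain ⟨O, hO⟩ := hr.exists_allComplete hf hQ hK hR
  have hv := hr.eventually_verdict hf hQ hK hO
  obtain ⟨i₀, hi₀⟩ := exists_honest hQ hK
  obtain ⟨T₀, hT₀⟩ := hv.exists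
  obtain ⟨w, hw⟩ := Option.isSome_iff_exists.1 (hT₀ i₀ hi₀)
  have hall : ∀ᶠ T in atTop, ∀ i ∉ K, ((st T).loc i).verdict G iter = some w := by
    filter_upwards [hv, eventually_ge_atTop T₀] with T h1 h2 i hi
    obtain ⟨w', hw'⟩ := Option.isSome_iff_exists.1 (h1 i hi)
    rw [hw', (hr.inv hQ hK T).verdict_agree hQ hK hw' (((hr.le h2).loc i₀).verdict hQ hw)]
  cases w with
  | none =>
    right
    filter_upwards [hall, hR] with T h1 h2 i hi using ⟨iter, h2 i hi, h1 i hi⟩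
  | some z₀ =>
    left
    have hd : ∀ᶠ T in atTop, ∀ i ∉ K,
        G.block ∣ iter → (((st T).loc i).winner (AbaId.discard iter)).isSome := by
      by_cases hb : G.block ∣ iter
      · filter_upwards [hr.eventually_discard hf hQ hK ⟨hO, hall⟩ hb] with T hT i hi _
        exact hT i hi
      · exact .of_forall fun _ _ _ h => absurd h hb
    filter_upwards [hall, hR, hd] with T h1 h2 h3 i hi
    refine ⟨by omega, fun r h4 h5 => ?_⟩
    rcases (Nat.lt_succ_iff.1 h5).eq_or_lt with rfl | hlt
    · exact ⟨⟨z₀, h1 i hi⟩, h3 i hi⟩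
    · exact (h2 i hi).2 r h4 hlt

/-- Otherwise every iteration would be followed by another one, beyond the bound of
`Inv.reached_le`. -/
theorem IsRun.eventually_finished (hr : IsRun G K a b st x) (hf : Fair G K st x)
    (hQ : QCond 4 Finset.univ G.Z) (hK : G.Admissible K) :
    ∀ᶠ T in atTop, ∀ i ∉ K, ((st T).loc i).Finished G := by
  by_contra hno
  have hR : ∀ m, AllReached G K st (m + 1) := fun m => by
    induction m with
    | zero => exact .of_forall fun T i _ => ⟨le_rfl, fun r h1 h2 => by omega⟩
    | succ m ih => exact (hr.allReached_succ hf hQ hK ih).resolve_right hno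
  obtain ⟨i₀, hi₀⟩ := exists_honest hQ hK
  obtain ⟨T, hT⟩ := (hR (G.t * G.block + 1)).exists
  have := (hr.inv hQ hK T).reached_le hQ hK (hT i₀ hi₀)
  omega

end Termination
end AsyncMult

/-! ### The theorem -/

theorem mainTheorem7 :
    ∃ C : ℕ, ∀ (n h : ℕ) [NeZero h] (F : Type*) [Field F] [Fintype F] [DecidableEq F]
      (G : AsyncMult.Setup n h) (K : Finset (Fin n)),
      Function.Injective G.Z → AsyncMult.QCond 4 Finset.univ G.Z → G.Admissible K →
      -- every execution, for every behaviour of the adversary and all random choices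
      (∀ (a b : Fin h → F) (st : ℕ → AsyncMult.State n h F) (x : ℕ → AsyncMult.Action n h F),
        AsyncMult.IsRun G K a b st x →
        -- the number of iterations, and of failed iterations
        (∀ T, ∀ i ∉ K, ∀ iter, ((st T).loc i).Reached G iter →
          iter ≤ G.t * (G.t * n + 1) + 1 ∧
          ((∃ z, ((st T).loc i).Conflict G iter z) → iter ≤ G.t * (G.t * n + 1))) ∧
        -- the honest parties output a sharing of the product, and eventually do so
        (∃ c : Fin h → F, ∑ q, c q = (∑ q, a q) * (∑ q, b q) ∧
          (∀ T, ∀ i ∉ K, ∀ q, i ∈ G.S q → ∀ v, ((st T).loc i).Outputs G q v → v = c q) ∧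
          (AsyncMult.Fair G K st x → ∃ T₀, ∀ T ≥ T₀, ∀ i ∉ K, ((st T).loc i).Finished G ∧
            ∀ q, i ∈ G.S q → ((st T).loc i).Outputs G q (c q))) ∧
        -- the number of calls and of additional bits
        (AsyncMult.vssCalls G K st).Finite ∧
        (AsyncMult.vssCalls G K st).ncard ≤ C * (h * n ^ 5) ∧
        (AsyncMult.abaCalls G K st).Finite ∧
        (AsyncMult.abaCalls G K st).ncard ≤ C * (h * n ^ 5) ∧
        (AsyncMult.messages G K st).Finite ∧
        (AsyncMult.bits G K st : ℝ) ≤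
          C * (h ^ 2 * n ^ 5 * Real.logb 2 (Fintype.card F)
            + h * n ^ 7 * Real.logb 2 (Fintype.card F))) ∧
      -- the view of the adversary depends on nothing but the shares that it holds
      (∀ (adv : AsyncMult.View n h F → PMF (AsyncMult.Action n h F)) (a b a' b' : Fin h → F),
        (∀ q, AsyncMult.Known G K q → a q = a' q ∧ b q = b' q) →
        ∀ T, AsyncMult.viewDist G K adv a b T = AsyncMult.viewDist G K adv a' b' T) := by
  -- The bit count determines the constant: `28` from the number of messages, doubled by rounding
  -- the logarithm up.
  refine ⟨56, fun n h _ F _ _ _ G K _ hQ hK => ⟨fun a b st x hr => ⟨?_, ?_, ?_⟩, ?_⟩⟩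
  · exact fun T i _ iter hi => ⟨(hr.inv hQ hK T).reached_le hQ hK hi,
      fun ⟨z, hz⟩ => (hr.inv hQ hK T).conflict_le hQ hK hi hz⟩
  · obtain ⟨c, hc, ho⟩ := hr.exists_output hQ hK
    refine ⟨c, hc, ho, fun hf => ?_⟩
    obtain ⟨T₀, hT₀⟩ := Filter.eventually_atTop.1 (hr.eventually_finished hf hQ hK)
    refine ⟨T₀, fun T hT i hi => ⟨hT₀ T hT i hi, fun q hq => ?_⟩⟩
    obtain ⟨v, hv⟩ := (hr.inv hQ hK T).outputs_of_finished (hT₀ T hT i hi) hq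
    rwa [← ho T i hi q hq v hv]
  · exact ⟨(hr.vssCalls_le hQ hK).1, (hr.vssCalls_le hQ hK).2, (hr.abaCalls_le hQ hK).1,
      (hr.abaCalls_le hQ hK).2, (hr.messages_le hQ hK).1, hr.bits_le hQ hK⟩
  · exact fun adv a b a' b' hkn T => AsyncMult.viewDist_eq hQ hK hkn adv T
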